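/- Let $V$ be a real affine space of dimension $n\ge 1$. A polytope $P\subset V$ is a compact set with non-empty interior that is a finite intersection of closed half spaces; it is simple if every vertex lies on exactly $n$ facets. A flat measure on a polytope, or on a face of it, is the restriction of a translation invariant measure on its affine span that is positive on non-empty open sets and finite on compact sets; a flat measure on $\partial P$ is a measure on $\partial P$ whose restriction to each facet is flat. Let $\mathcal P=(P,d\mu,d\sigma)$ be a simple polytope system, i.e. $P\subset V$ is a simple polytope, $d\mu$ is a flat measure on $P$ and $d\sigma$ is a flat measure on $\partial P$. For $1\le p\le\infty$ let $\mathcal M^p(P)$ be the set of lower semi-continuous functions $u:P\to(0,\infty]$ which are log-convex, $u((1-t)x_0+tx_1)\le u(x_0)^{1-t}u(x_1)^t$ for $x_0,x_1\in P$, $t\in[0,1]$, normalized by $\int_P u\,d\mu=\int_P d\mu$, and in $L^p(P,d\mu)$. For $u\in\mathcal M^1(P)$ put $$S(u)=-\frac{1}{\int_P d\mu}\int_P u\log u\,d\mu\in[-\infty,0],\qquad U(u)=\frac{1}{\int_P d\mu}\int_{\partial P}u\,d\sigma\in(0,\infty],$$ and for $T\in\mathbb R$ define the free $\mu$-energy by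 $F(T,u)=U(u)-T\,S(u)$ if $S(u)>-\infty$ and $F(T,u)=\infty$ if $S(u)=-\infty$. Call $u\in\mathcal M^1(P)$ a minimizer of $F(T,\cdot)$ if $F(T,u)\le F(T,v)$ for all $v\in\mathcal M^1(P)$. Then: 1. (Existence) For every $T\in\mathbb R$ there is a minimizer of $F(T,\cdot)$, and every minimizer lies in $\mathcal M^{n/(n-1)}(P)$ (where $n/(n-1)=\infty$ if $n=1$). 2. (Uniqueness) If $T>0$, the minimizer of $F(T,\cdot)$ is unique. 3. (Conditional uniqueness) $F(0,u)=U(u)$ for all $u\in\mathcal M^1(P)$, and there is a unique minimizer of $F(0,\cdot)$ that maximizes $S$ among all minimizers of $F(0,\cdot)$. 4. (Regularity) If $n=2$, every minimizer of $F(0,\cdot)$ is bounded and continuous on $P$. -/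

import Mathlib

open MeasureTheory Set
open scoped ENNReal NNReal

namespace MuEnergy

variable {E : Type*} [NormedAddCommGroup E] [NormedSpace ℝ E]

/-- A (closed) half space `ℓ⁻¹([0, ∞))` of `E`, for a non-constant affine function `ℓ`. -/
def IsHalfSpace (H : Set E) : Prop :=
  ∃ ℓ : E →ᵃ[ℝ] ℝ, ℓ.linear ≠ 0 ∧ H = {x | 0 ≤ ℓ x}

/-- A polytope: a compact set with non-empty interior which is the intersection of finitely many
half spaces. -/
def IsPolytope (P : Set E) : Prop :=
  IsCompact P ∧ (interior P).Nonempty ∧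
    ∃ 𝓗 : Set (Set E), 𝓗.Finite ∧ (∀ H ∈ 𝓗, IsHalfSpace H) ∧ P = ⋂₀ 𝓗

/-- A (non-empty) face of `P`: the intersection of `P` with the bounding hyperplane `ℓ⁻¹(0)` of a
half space `ℓ⁻¹([0, ∞))` containing `P`. -/
def IsFace (P F : Set E) : Prop :=
  F.Nonempty ∧ ∃ ℓ : E →ᵃ[ℝ] ℝ, ℓ.linear ≠ 0 ∧ P ⊆ {x | 0 ≤ ℓ x} ∧ F = P ∩ {x | ℓ x = 0}

/-- A facet: a face whose affine span has codimension one. -/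
def IsFacet (P F : Set E) : Prop :=
  IsFace P F ∧ Module.finrank ℝ (affineSpan ℝ F).direction + 1 = Module.finrank ℝ E

/-- A simple polytope: every vertex (one-point face) lies on precisely `dim E` facets. -/
def IsSimplePolytope (P : Set E) : Prop :=
  IsPolytope P ∧
    ∀ v : E, IsFace P {v} → {F : Set E | IsFacet P F ∧ v ∈ F}.ncard = Module.finrank ℝ E

variable [MeasurableSpace E]

/-- `m` is (the push-forward to `E` of) a translation invariant measure on the affine subspace `W`
which gives finite mass to compact sets and positive mass to non-empty relatively open subsets
of `W`. -/
structure IsInvariantMeasureOn (m : Measure E) (W : AffineSubspace ℝ E) : Prop where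
  carried : m (W : Set E)ᶜ = 0
  invariant : ∀ w ∈ W.direction, m.map (fun x => x + w) = m
  finite_of_isCompact : ∀ K : Set E, IsCompact K → m K < ∞
  pos_of_isOpen : ∀ O : Set E, IsOpen O → (O ∩ (W : Set E)).Nonempty → 0 < m O

/-- A flat measure on a polytope or on a face of a polytope: the restriction of a translation
invariant measure on its affine span. -/
def IsFlatMeasureOn (ν : Measure E) (F : Set E) : Prop :=
  ∃ m : Measure E, IsInvariantMeasureOn m (affineSpan ℝ F) ∧ ν = m.restrict F

/-- A flat measure on the boundary of `P`: a measure carried by `∂P` whose restriction to each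
facet is flat. -/
def IsFlatBoundaryMeasure (σ : Measure E) (P : Set E) : Prop :=
  σ (frontier P)ᶜ = 0 ∧ ∀ F : Set E, IsFacet P F → IsFlatMeasureOn (σ.restrict F) F

/-- A simple polytope system `(P, dμ, dσ)`. -/
structure IsSimpleSystem (P : Set E) (μ σ : Measure E) : Prop where
  simple : IsSimplePolytope P
  flat : IsFlatMeasureOn μ P
  flat_boundary : IsFlatBoundaryMeasure σ P

/-- The space of states: lower semi-continuous log-convex `u : P → (0, ∞]`, normalized by
`∫_P u dμ = ∫_P dμ`, which are `p`-integrable on `P` (essentially bounded if `p = ∞`).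
Only the values of `u` on `P` matter. -/
structure IsState (P : Set E) (μ : Measure E) (p : ℝ≥0∞) (u : E → ℝ≥0∞) : Prop where
  pos : ∀ x ∈ P, 0 < u x
  lsc : LowerSemicontinuousOn u P
  logConvex : ∀ x ∈ P, ∀ y ∈ P, ∀ t ∈ Icc (0 : ℝ) 1,
    u ((1 - t) • x + t • y) ≤ u x ^ (1 - t) * u y ^ t
  normalized : ∫⁻ x in P, u x ∂μ = μ P
  integrable : eLpNorm u p (μ.restrict P) < ∞

/-- The integral, with values in `[-∞, ∞]`, of an extended real valued function whose negative
part has finite integral. -/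
noncomputable def extIntegral (f : E → EReal) (ν : Measure E) : EReal :=
  ((∫⁻ x, (f x).toENNReal ∂ν : ℝ≥0∞) : EReal) - ((∫⁻ x, (-f x).toENNReal ∂ν : ℝ≥0∞) : EReal)

/-- The entropy `S(u) = - (∫_P dμ)⁻¹ ∫_P u log u dμ`. The negative part of `u log u` is at
most `1/e`, so the integral makes sense in `(-∞, ∞]`. -/
noncomputable def entropy (P : Set E) (μ : Measure E) (u : E → ℝ≥0∞) : EReal :=
  -(extIntegral (fun x => (u x : EReal) * ENNReal.log (u x)) (μ.restrict P) / (μ P : EReal))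

/-- The internal `μ`-energy `U(u) = (∫_P dμ)⁻¹ ∫_{∂P} u dσ`. -/
noncomputable def internalEnergy (P : Set E) (μ σ : Measure E) (u : E → ℝ≥0∞) : ℝ≥0∞ :=
  (∫⁻ x in frontier P, u x ∂σ) / μ P

open Classical in
/-- The free `μ`-energy: `F(T, u) = U(u) - T S(u)` if `S(u) > -∞`, and `∞` if `S(u) = -∞`. -/
noncomputable def freeEnergy (P : Set E) (μ σ : Measure E) (T : ℝ) (u : E → ℝ≥0∞) : EReal :=
  if entropy P μ u = ⊥ then ⊤
  else (internalEnergy P μ σ u : EReal) - (T : EReal) * entropy P μ u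

/-- `u` minimizes `F(T, ·)` among all states. -/
def IsMinimizer (P : Set E) (μ σ : Measure E) (T : ℝ) (u : E → ℝ≥0∞) : Prop :=
  IsState P μ 1 u ∧ ∀ v, IsState P μ 1 v → freeEnergy P μ σ T u ≤ freeEnergy P μ σ T v

/-- `u` is a minimizer of `F(T, ·)` with the largest entropy among all minimizers. -/
def IsMaxEntropyMinimizer (P : Set E) (μ σ : Measure E) (T : ℝ) (u : E → ℝ≥0∞) : Prop :=
  IsMinimizer P μ σ T u ∧ ∀ v, IsMinimizer P μ σ T v → entropy P μ v ≤ entropy P μ u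

end MuEnergy

open MuEnergy

/-!
# Minimizers of the free energy of a simple polytope system

Everything rests on comparing integrals over the polytope `P` with integrals over its boundary by
slicing `P` along lines in a direction `e` transversal to all facets. Such a line leaves `P` in two
boundary points, and the product of Haar measure on lines and the flat measures on the facets
controls Haar measure on `P` (`IsFacetPresentation.exists_slice`).

*Energy estimate.* On a segment a log-convex function is at most the maximum of its values at the
end points. Hence `u x` is bounded, for each vector of a transversal basis, by a function which is
constant along that vector and whose integral over the remaining variables is at most a constant
times the boundary integral of `u`. The grid-lines inequality then bounds the norm of `u` in
`L^(n/(n-1))` by the boundary integral (`IsFacetPresentation.exists_lintegral_rpow_le`). Since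
`u log u` grows more slowly than any power `u ^ q`, `q > 1`, the entropy is of lower order than the
internal energy, so that the free energy is bounded below and coercive for every real `T`
(`IsPolytopeSystem.exists_relEntropy_le`, `IsPolytopeSystem.exists_energy_ge`).

*Existence.* Log-convex functions bounded in some `L^q`, `q > 1`, are locally bounded above and,
by normalization, uniformly bounded below; a subsequence converges pointwise in the interior of `P`
and the limit extends to a state lying below the lower limit of the sequence also on the boundary
(`exists_limit_state`). The internal energy is lower semi-continuous by Fatou's lemma and the
entropy is continuous by uniform integrability (`IsPolytopeSystem.exists_limit`).

*Uniqueness.* The mean of two states is a state, the internal energy is affine, and `t ↦ t log t` is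
strictly convex. Two states that agree almost everywhere agree on `P`, because a lower
semi-continuous log-convex function is determined by its values in the interior.

*Regularity.* Let `u` minimize the internal energy. Its lower envelope with logarithmic slope at
most `L` in the direction `e` (`slopeLimit`) is again log-convex; the defect increases in the
direction `e` and, for large `L`, it is supported in a thin layer along the boundary. By slicing,
the integral of the defect over `P` is then small compared to that over the boundary, so that
normalizing the envelope would produce a state of lower energy unless the defect vanishes
(`IsPolytopeSystem.exists_le_mul_exp`). Therefore `u` is bounded near each boundary point by a
multiple of its values near an interior point. Bounded lower semi-continuous log-convex functions on
polytopes are continuous (`IsFacetPresentation.continuousOn_of_le`). This argument does not depend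
on the dimension.
-/

namespace MuEnergy

open Filter Topology InformationTheory

/-! ### Log-convex functions with values in `[0, ∞]` -/

section LogConvex

variable {E : Type*} [NormedAddCommGroup E] [NormedSpace ℝ E]

/-- Log-convexity on `P` of a function with values in `[0, ∞]`, in the multiplicative form used in
the definition of a state. -/
def IsLogConvexOn (P : Set E) (u : E → ℝ≥0∞) : Prop :=
  ∀ x ∈ P, ∀ y ∈ P, ∀ t ∈ Icc (0 : ℝ) 1, u ((1 - t) • x + t • y) ≤ u x ^ (1 - t) * u y ^ t

lemma rpow_mul_rpow_le_max (a b : ℝ≥0∞) {t : ℝ} (ht : t ∈ Icc (0 : ℝ) 1) :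
    a ^ (1 - t) * b ^ t ≤ max a b := by
  have h1 : 0 ≤ 1 - t := by linarith [ht.2]
  calc a ^ (1 - t) * b ^ t ≤ max a b ^ (1 - t) * max a b ^ t :=
        mul_le_mul' (ENNReal.rpow_le_rpow (le_max_left _ _) h1)
          (ENNReal.rpow_le_rpow (le_max_right _ _) ht.1)
    _ = max a b := by rw [← ENNReal.rpow_add_of_nonneg _ _ h1 ht.1]; simp

/-- Hölder's inequality for two summands. -/
lemma rpow_mul_rpow_add_le (a b c d : ℝ≥0∞) {t : ℝ} (ht : t ∈ Icc (0 : ℝ) 1) :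
    a ^ (1 - t) * b ^ t + c ^ (1 - t) * d ^ t ≤ (a + c) ^ (1 - t) * (b + d) ^ t := by
  have h1 : 0 ≤ 1 - t := by linarith [ht.2]
  have h := ENNReal.lintegral_mul_norm_pow_le (μ := (Measure.count : Measure Bool))
    (f := fun i => if i then a else c) (g := fun i => if i then b else d) (p := 1 - t) (q := t)
    (measurable_from_top).aemeasurable (measurable_from_top).aemeasurable h1 ht.1 (by ring)
  simpa [lintegral_count, tsum_fintype] using h

variable {P : Set E} {u v : E → ℝ≥0∞}

namespace IsLogConvexOn

lemma mono (hu : IsLogConvexOn P u) {Q : Set E} (h : Q ⊆ P) : IsLogConvexOn Q u :=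
  fun x hx y hy t ht => hu x (h hx) y (h hy) t ht

lemma le_max (hu : IsLogConvexOn P u) {x y : E} (hx : x ∈ P) (hy : y ∈ P) {t : ℝ}
    (ht : t ∈ Icc (0 : ℝ) 1) : u ((1 - t) • x + t • y) ≤ max (u x) (u y) :=
  (hu x hx y hy t ht).trans (rpow_mul_rpow_le_max _ _ ht)

lemma add (hu : IsLogConvexOn P u) (hv : IsLogConvexOn P v) :
    IsLogConvexOn P (fun x => u x + v x) := fun x hx y hy t ht =>
  (add_le_add (hu x hx y hy t ht) (hv x hx y hy t ht)).trans (rpow_mul_rpow_add_le _ _ _ _ ht)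

lemma const_mul (hu : IsLogConvexOn P u) (c : ℝ≥0∞) : IsLogConvexOn P (fun x => c * u x) := by
  intro x hx y hy t ht
  have h1 : 0 ≤ 1 - t := by linarith [ht.2]
  have hc : c = c ^ (1 - t) * c ^ t := by rw [← ENNReal.rpow_add_of_nonneg _ _ h1 ht.1]; simp
  calc c * u ((1 - t) • x + t • y) ≤ c * (u x ^ (1 - t) * u y ^ t) := by
        gcongr; exact hu x hx y hy t ht
    _ = (c ^ (1 - t) * c ^ t) * (u x ^ (1 - t) * u y ^ t) := by rw [← hc]
    _ = (c * u x) ^ (1 - t) * (c * u y) ^ t := by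
        rw [ENNReal.mul_rpow_of_nonneg _ _ h1, ENNReal.mul_rpow_of_nonneg _ _ ht.1]; ring

lemma rpow (hu : IsLogConvexOn P u) {s : ℝ} (hs : 0 ≤ s) :
    IsLogConvexOn P (fun x => u x ^ s) := by
  intro x hx y hy t ht
  calc u ((1 - t) • x + t • y) ^ s ≤ (u x ^ (1 - t) * u y ^ t) ^ s :=
        ENNReal.rpow_le_rpow (hu x hx y hy t ht) hs
    _ = (u x ^ s) ^ (1 - t) * (u y ^ s) ^ t := by
        rw [ENNReal.mul_rpow_of_nonneg _ _ hs]
        simp only [← ENNReal.rpow_mul]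
        rw [mul_comm (1 - t), mul_comm t]

lemma iSup {ι : Sort*} {w : ι → E → ℝ≥0∞} (hw : ∀ i, IsLogConvexOn P (w i)) :
    IsLogConvexOn P (fun x => ⨆ i, w i x) := by
  intro x hx y hy t ht
  have h1 : 0 ≤ 1 - t := by linarith [ht.2]
  refine iSup_le fun i => (hw i x hx y hy t ht).trans ?_
  exact mul_le_mul' (ENNReal.rpow_le_rpow (le_iSup (fun i => w i x) i) h1)
    (ENNReal.rpow_le_rpow (le_iSup (fun i => w i y) i) ht.1)

/-- The logarithm of a finite positive log-convex function is convex. -/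
lemma convexOn_log (hu : IsLogConvexOn P u) (hP : Convex ℝ P) (h0 : ∀ x ∈ P, 0 < u x)
    (h1 : ∀ x ∈ P, u x < ∞) : ConvexOn ℝ P (fun x => Real.log (u x).toReal) := by
  refine ⟨hP, fun x hx y hy a b ha hb hab => ?_⟩
  obtain rfl : a = 1 - b := by linarith
  have hz : (1 - b) • x + b • y ∈ P := hP hx hy ha hb hab
  have hxp := ENNReal.toReal_pos (h0 x hx).ne' (h1 x hx).ne
  have hyp := ENNReal.toReal_pos (h0 y hy).ne' (h1 y hy).ne
  have h := hu x hx y hy b ⟨hb, by linarith⟩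
  have h' := ENNReal.toReal_mono (ENNReal.mul_ne_top
    (ENNReal.rpow_ne_top_of_nonneg ha (h1 x hx).ne)
    (ENNReal.rpow_ne_top_of_nonneg hb (h1 y hy).ne)) h
  rw [ENNReal.toReal_mul, ← ENNReal.toReal_rpow, ← ENNReal.toReal_rpow] at h'
  calc Real.log (u ((1 - b) • x + b • y)).toReal
      ≤ Real.log ((u x).toReal ^ (1 - b) * (u y).toReal ^ b) :=
        Real.log_le_log (ENNReal.toReal_pos (h0 _ hz).ne' (h1 _ hz).ne) h'
    _ = (1 - b) • Real.log (u x).toReal + b • Real.log (u y).toReal := by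
        rw [Real.log_mul (Real.rpow_pos_of_pos hxp _).ne' (Real.rpow_pos_of_pos hyp _).ne',
          Real.log_rpow hxp, Real.log_rpow hyp]; simp

lemma continuousOn_interior [FiniteDimensional ℝ E] (hu : IsLogConvexOn P u) (hP : Convex ℝ P)
    (h0 : ∀ x ∈ interior P, 0 < u x) (h1 : ∀ x ∈ interior P, u x < ∞) :
    ContinuousOn u (interior P) := by
  have hc := ((hu.mono interior_subset).convexOn_log hP.interior h0 h1).continuousOn
    isOpen_interior
  have h2 : ContinuousOn (fun x => ENNReal.ofReal (Real.exp (Real.log (u x).toReal)))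
      (interior P) :=
    ENNReal.continuous_ofReal.comp_continuousOn (Real.continuous_exp.comp_continuousOn hc)
  refine h2.congr fun x hx => ?_
  simp only []
  rw [Real.exp_log (ENNReal.toReal_pos (h0 x hx).ne' (h1 x hx).ne),
    ENNReal.ofReal_toReal (h1 x hx).ne]

end IsLogConvexOn

/-! ### Regularization at the boundary -/

/-- For log-convex `u` and an interior point `x₀`, the extrapolation to `x` of the values of `log u`
at `x₀` and at the point `(1 - t) x + t x₀`. It increases to the radial limit as `t → 0`. -/
noncomputable def extrapolate (x₀ : E) (u : E → ℝ≥0∞) (t : ℝ) (x : E) : ℝ≥0∞ :=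
  u x₀ ^ (-t / (1 - t)) * u ((1 - t) • x + t • x₀) ^ (1 / (1 - t))

/-- The lower semi-continuous log-convex function determined by the values of `u` in the interior:
the supremum of the radial extrapolations towards the boundary. -/
noncomputable def regularize (x₀ : E) (u : E → ℝ≥0∞) (x : E) : ℝ≥0∞ :=
  ⨆ t : Ioo (0 : ℝ) 1, extrapolate x₀ u t x

variable {x₀ : E}

lemma contract_mem_interior (hP : Convex ℝ P) (hx₀ : x₀ ∈ interior P) {x : E} (hx : x ∈ P) {t : ℝ}
    (ht : t ∈ Ioo (0 : ℝ) 1) : (1 - t) • x + t • x₀ ∈ interior P := by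
  have := hP.combo_interior_self_mem_interior hx₀ hx ht.1 (by linarith [ht.2] : (0:ℝ) ≤ 1 - t)
    (by ring)
  rwa [add_comm]

lemma IsLogConvexOn.extrapolate_le (hu : IsLogConvexOn P u) (hx₀ : x₀ ∈ P) (h0 : 0 < u x₀)
    (h1 : u x₀ < ∞) {x : E} (hx : x ∈ P) {t : ℝ} (ht : t ∈ Ioo (0 : ℝ) 1) :
    extrapolate x₀ u t x ≤ u x := by
  have h1t : 0 < 1 - t := by linarith [ht.2]
  have h := ENNReal.rpow_le_rpow (hu x hx x₀ hx₀ t ⟨ht.1.le, ht.2.le⟩)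
    (by positivity : 0 ≤ 1 / (1 - t))
  rw [ENNReal.mul_rpow_of_nonneg _ _ (by positivity), ← ENNReal.rpow_mul, ← ENNReal.rpow_mul,
    mul_one_div_cancel h1t.ne', ENNReal.rpow_one] at h
  calc extrapolate x₀ u t x ≤ u x₀ ^ (-t / (1 - t)) * (u x * u x₀ ^ (t * (1 / (1 - t)))) := by
        unfold extrapolate; gcongr
    _ = u x * (u x₀ ^ (-t / (1 - t)) * u x₀ ^ (t * (1 / (1 - t)))) := by ring
    _ = u x := by
        rw [← ENNReal.rpow_add _ _ h0.ne' h1.ne,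
          show -t / (1 - t) + t * (1 / (1 - t)) = 0 by field_simp; ring]
        simp

lemma IsLogConvexOn.regularize_le (hu : IsLogConvexOn P u) (hx₀ : x₀ ∈ P) (h0 : 0 < u x₀)
    (h1 : u x₀ < ∞) {x : E} (hx : x ∈ P) : regularize x₀ u x ≤ u x :=
  iSup_le fun t => hu.extrapolate_le hx₀ h0 h1 hx t.2

lemma isLogConvexOn_regularize (hP : Convex ℝ P) (hx₀ : x₀ ∈ interior P)
    (hu : IsLogConvexOn (interior P) u) : IsLogConvexOn P (regularize x₀ u) := by
  refine IsLogConvexOn.iSup fun t => IsLogConvexOn.const_mul (IsLogConvexOn.rpow ?_ ?_) _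
  · intro x hx y hy s hs
    have := hu _ (contract_mem_interior hP hx₀ hx t.2) _ (contract_mem_interior hP hx₀ hy t.2) s hs
    convert this using 2
    module
  · have := t.2.2
    have : 0 < 1 - (t : ℝ) := by linarith
    positivity

lemma lowerSemicontinuousOn_regularize (hP : Convex ℝ P) (hx₀ : x₀ ∈ interior P)
    (h0 : 0 < u x₀) (h1 : u x₀ < ∞)
    (hu : ContinuousOn u (interior P)) : LowerSemicontinuousOn (regularize x₀ u) P := by
  refine lowerSemicontinuousOn_iSup fun t => ContinuousOn.lowerSemicontinuousOn ?_
  have h2 : ContinuousOn (fun x => u ((1 - (t : ℝ)) • x + (t : ℝ) • x₀)) P :=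
    hu.comp (by fun_prop) fun x hx => contract_mem_interior hP hx₀ hx t.2
  have h3 : ContinuousOn (fun x => u ((1 - (t : ℝ)) • x + (t : ℝ) • x₀) ^ (1 / (1 - (t : ℝ)))) P :=
    ENNReal.continuous_rpow_const.comp_continuousOn h2
  exact (ENNReal.continuous_const_mul
    (ENNReal.rpow_ne_top_of_ne_zero h0.ne' h1.ne)).comp_continuousOn h3

/-- At points of lower semi-continuity a log-convex function is recovered from its values in the
interior. -/
lemma IsLogConvexOn.regularize_eq (hP : Convex ℝ P) (hu : IsLogConvexOn P u)
    (hx₀ : x₀ ∈ interior P) (h0 : 0 < u x₀) (h1 : u x₀ < ∞) {x : E} (hx : x ∈ P)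
    (hl : LowerSemicontinuousWithinAt u P x) : regularize x₀ u x = u x := by
  refine le_antisymm (hu.regularize_le (interior_subset hx₀) h0 h1 hx) ?_
  refine le_of_forall_lt fun c hc => ?_
  obtain ⟨d, hcd, hd⟩ := exists_between hc
  have hdt : d ≠ ∞ := hd.ne_top
  have hd0 : d ≠ 0 := (zero_le.trans_lt hcd).ne'
  have htend : Tendsto (fun t : ℝ => (1 - t) • x + t • x₀) (𝓝[>] 0) (𝓝[P] x) := by
    refine tendsto_nhdsWithin_iff.2 ⟨?_, ?_⟩
    · have : Continuous fun t : ℝ => (1 - t) • x + t • x₀ := by fun_prop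
      have := this.tendsto 0
      simp only [sub_zero, one_smul, zero_smul, add_zero] at this
      exact this.mono_left nhdsWithin_le_nhds
    · filter_upwards [Ioo_mem_nhdsGT (zero_lt_one (α := ℝ))] with t ht
      exact interior_subset (contract_mem_interior hP hx₀ hx ht)
  have h2 : ∀ᶠ t in 𝓝[>] (0 : ℝ), d < u ((1 - t) • x + t • x₀) := htend.eventually (hl d hd)
  have h3 : Tendsto (fun t : ℝ => (u x₀).toReal ^ (-t / (1 - t)) * d.toReal ^ (1 / (1 - t)))
      (𝓝[>] 0) (𝓝 d.toReal) := by
    have hA : 0 < (u x₀).toReal := ENNReal.toReal_pos h0.ne' h1.ne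
    have hB : 0 < d.toReal := ENNReal.toReal_pos hd0 hdt
    have : ContinuousAt
        (fun t : ℝ => (u x₀).toReal ^ (-t / (1 - t)) * d.toReal ^ (1 / (1 - t))) 0 := by
      refine ContinuousAt.mul ?_ ?_
      · refine ContinuousAt.rpow continuousAt_const ?_ (Or.inl hA.ne')
        exact ContinuousAt.div (by fun_prop) (by fun_prop) (by simp)
      · refine ContinuousAt.rpow continuousAt_const ?_ (Or.inl hB.ne')
        exact ContinuousAt.div (by fun_prop) (by fun_prop) (by simp)
    have h4 := this.tendsto
    simp only [neg_zero, sub_zero, div_one, Real.rpow_zero, Real.rpow_one, one_mul] at h4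
    exact h4.mono_left nhdsWithin_le_nhds
  have hcd' : c.toReal < d.toReal := (ENNReal.toReal_lt_toReal (hcd.ne_top) hdt).2 hcd
  obtain ⟨t, ht2, ht3, ht⟩ := (h2.and ((h3.eventually (lt_mem_nhds hcd')).and
    (Ioo_mem_nhdsGT (zero_lt_one (α := ℝ))))).exists
  refine lt_of_lt_of_le ?_ (le_iSup (fun t : Ioo (0 : ℝ) 1 => extrapolate x₀ u t x) ⟨t, ht⟩)
  have h1t : 0 < 1 - t := by linarith [ht.2]
  calc c < u x₀ ^ (-t / (1 - t)) * d ^ (1 / (1 - t)) := by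
        have hne : u x₀ ^ (-t / (1 - t)) * d ^ (1 / (1 - t)) ≠ ∞ := ENNReal.mul_ne_top
          (ENNReal.rpow_ne_top_of_ne_zero h0.ne' h1.ne) (ENNReal.rpow_ne_top_of_ne_zero hd0 hdt)
        rw [← ENNReal.toReal_lt_toReal hcd.ne_top hne, ENNReal.toReal_mul, ← ENNReal.toReal_rpow,
          ← ENNReal.toReal_rpow]
        exact ht3
    _ ≤ extrapolate x₀ u t x := by
        unfold extrapolate
        gcongr

end LogConvex

/-! ### Facets and the boundary of a polytope -/

section Polytope

variable {E : Type*} [NormedAddCommGroup E] [NormedSpace ℝ E]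

/-- `s` is a finite set of affine functions presenting `P` as the intersection of the half spaces
`ℓ ≥ 0`, such that each bounding hyperplane cuts out a facet of `P`. -/
structure IsFacetPresentation (P : Set E) (s : Finset (E →ᵃ[ℝ] ℝ)) : Prop where
  linear_ne_zero : ∀ ℓ ∈ s, ℓ.linear ≠ 0
  eq : P = {x | ∀ ℓ ∈ s, 0 ≤ ℓ x}
  isFacet : ∀ ℓ ∈ s, IsFacet P (P ∩ {x | ℓ x = 0})

lemma IsFacetPresentation.mem_iff {P : Set E} {s : Finset (E →ᵃ[ℝ] ℝ)}
    (h : IsFacetPresentation P s) {x : E} : x ∈ P ↔ ∀ ℓ ∈ s, 0 ≤ ℓ x := by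
  conv_lhs => rw [h.eq]
  rfl

lemma affine_add_smul (ℓ : E →ᵃ[ℝ] ℝ) (x e : E) (r : ℝ) : ℓ (x + r • e) = ℓ x + r * ℓ.linear e := by
  have := ℓ.map_vadd x (r • e)
  simp only [vadd_eq_add, map_smul, smul_eq_mul] at this
  rw [add_comm x, this, add_comm]

lemma affine_combo (ℓ : E →ᵃ[ℝ] ℝ) (x y : E) (t : ℝ) :
    ℓ ((1 - t) • x + t • y) = (1 - t) * ℓ x + t * ℓ y := by
  have h := affine_add_smul ℓ x (y - x) t
  have h1 := affine_add_smul ℓ x (y - x) 1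
  simp only [one_smul, add_sub_cancel, one_mul] at h1
  rw [show (1 - t) • x + t • y = x + t • (y - x) by module, h, h1]
  ring

/-- A non-constant affine function that is non-negative on a set is positive in its interior. -/
lemma affine_pos_of_mem_interior {ℓ : E →ᵃ[ℝ] ℝ} (hℓ : ℓ.linear ≠ 0) {P : Set E}
    (hP : ∀ x ∈ P, 0 ≤ ℓ x) {x : E} (hx : x ∈ interior P) : 0 < ℓ x := by
  obtain ⟨e, he⟩ : ∃ e, ℓ.linear e ≠ 0 := by
    by_contra! h
    exact hℓ (LinearMap.ext h)
  refine lt_of_le_of_ne (hP x (interior_subset hx)) fun h0 => ?_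
  have ht : Tendsto (fun r : ℝ => x + r • e) (𝓝 0) (𝓝 x) := by
    have : Continuous fun r : ℝ => x + r • e := by fun_prop
    simpa using this.tendsto 0
  have hev := ht.eventually (mem_interior_iff_mem_nhds.1 hx)
  obtain ⟨ε, hε, h⟩ := Metric.eventually_nhds_iff.1 hev
  have h1 := hP _ (h (y := ε / 2) (by simp [abs_of_pos hε, hε]))
  have h2 := hP _ (h (y := -(ε / 2)) (by simp [abs_of_pos hε, hε]))
  rw [affine_add_smul, ← h0] at h1 h2
  have : ε / 2 * ℓ.linear e = 0 := by linarith
  exact (mul_ne_zero (by positivity) he) this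

lemma convex_setOf_forall_nonneg (s : Finset (E →ᵃ[ℝ] ℝ)) :
    Convex ℝ {x : E | ∀ ℓ ∈ s, 0 ≤ ℓ x} := by
  intro x hx y hy a b ha hb hab ℓ hℓ
  obtain rfl : a = 1 - b := by linarith
  rw [affine_combo]
  have := hx ℓ hℓ
  have := hy ℓ hℓ
  positivity

lemma IsFacetPresentation.convex {P : Set E} {s : Finset (E →ᵃ[ℝ] ℝ)}
    (h : IsFacetPresentation P s) : Convex ℝ P :=
  h.eq ▸ convex_setOf_forall_nonneg s

variable [FiniteDimensional ℝ E]

lemma continuous_affine (ℓ : E →ᵃ[ℝ] ℝ) : Continuous ℓ := ℓ.continuous_of_finiteDimensional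

lemma isClosed_setOf_forall_nonneg (s : Finset (E →ᵃ[ℝ] ℝ)) :
    IsClosed {x : E | ∀ ℓ ∈ s, 0 ≤ ℓ x} := by
  simp only [ofPred_forall]
  exact isClosed_biInter fun ℓ _ => isClosed_le continuous_const (continuous_affine ℓ)

/-- A set whose affine span has codimension at least two spans, together with a further point, a
proper affine subspace. -/
lemma affineSpan_insert_ne_top {F : Set E} {ℓ : E →ᵃ[ℝ] ℝ} (hℓ : ℓ.linear ≠ 0)
    (hF : ∀ x ∈ F, ℓ x = 0) (hne : F.Nonempty)
    (hdim : Module.finrank ℝ (affineSpan ℝ F).direction + 1 ≠ Module.finrank ℝ E) (y : E) :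
    affineSpan ℝ (insert y F) ≠ ⊤ := by
  obtain ⟨p, hp⟩ := hne
  have hsub : (affineSpan ℝ F).direction ≤ LinearMap.ker ℓ.linear := by
    rw [direction_affineSpan, vectorSpan_def, Submodule.span_le]
    rintro _ ⟨a, ha, b, hb, rfl⟩
    simp only [SetLike.mem_coe, LinearMap.mem_ker]
    have := ℓ.linearMap_vsub a b
    rw [this, hF a ha, hF b hb]; simp
  have hker : Module.finrank ℝ (LinearMap.ker ℓ.linear) < Module.finrank ℝ E := by
    refine Submodule.finrank_lt fun h => hℓ ?_
    exact LinearMap.ker_eq_top.1 h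
  have h1 := Submodule.finrank_mono hsub
  intro htop
  have h2 : Module.finrank ℝ (affineSpan ℝ (insert y F)).direction = Module.finrank ℝ E := by
    rw [htop, AffineSubspace.direction_top, finrank_top]
  have h3 : Module.finrank ℝ (affineSpan ℝ (insert y F)).direction ≤
      Module.finrank ℝ (affineSpan ℝ F).direction + 1 := by
    have := finrank_vectorSpan_insert_le_set ℝ F y
    rw [direction_affineSpan, direction_affineSpan]
    exact this
  omega

/-- Every polytope is the intersection of the half spaces belonging to its facets. Otherwise some
`y ∉ P` satisfies all the facet inequalities, and the segments from `y` to the interior points of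
`P` would all meet faces of codimension at least two. -/
lemma IsPolytope.exists_isFacetPresentation {P : Set E} (hP : IsPolytope P) :
    ∃ s : Finset (E →ᵃ[ℝ] ℝ), IsFacetPresentation P s := by
  classical
  obtain ⟨hc, hne, 𝓗, hfin, hH, rfl⟩ := hP
  choose! L hL0 hL using hH
  set P := ⋂₀ 𝓗 with hPdef
  have hmem : ∀ x, x ∈ P ↔ ∀ H ∈ 𝓗, 0 ≤ L H x := by
    intro x
    rw [hPdef, mem_sInter]
    refine forall₂_congr fun H hH => ?_
    conv_lhs => rw [hL H hH]
    rfl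
  let s := (hfin.toFinset.image L).filter fun ℓ => IsFacet P (P ∩ {x | ℓ x = 0})
  have hs : ∀ ℓ, ℓ ∈ s ↔ (∃ H ∈ 𝓗, L H = ℓ) ∧ IsFacet P (P ∩ {x | ℓ x = 0}) := by
    intro ℓ; simp [s]
  have hsub : ∀ x ∈ P, ∀ ℓ ∈ s, 0 ≤ ℓ x := by
    intro x hx ℓ hℓ
    obtain ⟨⟨H, hH, rfl⟩, -⟩ := (hs ℓ).1 hℓ
    exact (hmem x).1 hx H hH
  refine ⟨s, fun ℓ hℓ => ?_, subset_antisymm hsub fun y hy => ?_, fun ℓ hℓ => ((hs ℓ).1 hℓ).2⟩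
  · obtain ⟨⟨H, hH, rfl⟩, -⟩ := (hs ℓ).1 hℓ
    exact hL0 H hH
  by_contra hyP
  -- the interior is covered by the affine spans of `y` and the sections that are not facets; these
  -- spans are proper subspaces, hence null sets
  have hcover : interior P ⊆ ⋃ H ∈ {H ∈ 𝓗 | L H ∉ s ∧ (P ∩ {x | L H x = 0}).Nonempty},
      (affineSpan ℝ (insert y (P ∩ {x | L H x = 0})) : Set E) := by
    intro z hz
    have hzP : z ∈ P := interior_subset hz
    -- the exit point of the segment from `z` to `y`
    let A : Set ℝ := {t ∈ Icc (0 : ℝ) 1 | (1 - t) • z + t • y ∈ P}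
    have hcont : Continuous fun t : ℝ => (1 - t) • z + t • y := by fun_prop
    have hA : IsCompact A :=
      isCompact_Icc.inter_right (hc.isClosed.preimage hcont)
    obtain ⟨t, htA, htmax⟩ := hA.exists_isGreatest ⟨0, by simp, by simpa using hzP⟩
    have ht1 : t < 1 := lt_of_le_of_ne htA.1.2 fun h => by
      have := htA.2; simp [h] at this; exact hyP this
    have hpP := htA.2
    set p := (1 - t) • z + t • y with hp
    obtain ⟨H, hH, hpH⟩ : ∃ H ∈ 𝓗, L H p = 0 := by
      by_contra! hpos
      have hpos' : ∀ H ∈ 𝓗, 0 < L H p := fun H hH =>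
        lt_of_le_of_ne ((hmem p).1 hpP H hH) (hpos H hH).symm
      have hev : ∀ᶠ r in 𝓝 t, ∀ H ∈ 𝓗, 0 < L H ((1 - r) • z + r • y) := by
        rw [hfin.eventually_all]
        intro H hH
        exact ((continuous_affine (L H)).comp hcont).continuousAt.eventually
          (lt_mem_nhds (hpos' H hH))
      have hev' : ∀ᶠ r in 𝓝[>] t, r ∈ A := by
        filter_upwards [nhdsWithin_le_nhds hev, Ioo_mem_nhdsGT ht1] with r hr hr1
        exact ⟨⟨htA.1.1.trans hr1.1.le, hr1.2.le⟩, (hmem _).2 fun H hH => (hr H hH).le⟩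
      obtain ⟨r, hrA, hrt⟩ := (hev'.and self_mem_nhdsWithin).exists
      exact absurd (htmax hrA) (not_le.2 hrt)
    have hHs : L H ∉ s := by
      intro hHs
      have h1 := affine_pos_of_mem_interior (hL0 H hH) (fun x hx => (hmem x).1 hx H hH) hz
      have h2 := hy (L H) hHs
      rw [hp, affine_combo] at hpH
      have := htA.1.1
      have h3 : 0 < (1 - t) * L H z := mul_pos (by linarith) h1
      have h4 : 0 ≤ t * L H y := by positivity
      linarith
    refine mem_biUnion (x := H) ⟨hH, hHs, p, hpP, hpH⟩ ?_
    have hy' : y ∈ affineSpan ℝ (insert y (P ∩ {x | L H x = 0})) :=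
      subset_affineSpan ℝ _ (mem_insert _ _)
    have hp' : p ∈ affineSpan ℝ (insert y (P ∩ {x | L H x = 0})) :=
      subset_affineSpan ℝ _ (mem_insert_of_mem _ ⟨hpP, hpH⟩)
    have h1t : 1 - t ≠ 0 := by linarith
    have : z = AffineMap.lineMap y p (1 / (1 - t)) := by
      rw [AffineMap.lineMap_apply, hp]
      simp only [vsub_eq_sub, vadd_eq_add]
      rw [show (1 - t) • z + t • y - y = (1 - t) • (z - y) by module, smul_smul,
        one_div_mul_cancel h1t]
      module
    rw [this]
    exact AffineMap.lineMap_mem _ hy' hp'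
  let _ : MeasurableSpace E := borel E
  have _ : BorelSpace E := ⟨rfl⟩
  have hnull : (Measure.addHaar : Measure E) (interior P) = 0 := by
    refine measure_mono_null hcover ?_
    refine (measure_biUnion_null_iff (hfin.subset (sep_subset _ _)).countable).2 fun H hH => ?_
    refine Measure.addHaar_affineSubspace _ _ ?_
    refine affineSpan_insert_ne_top (hL0 H hH.1) (fun x hx => hx.2) hH.2.2 (fun hdim => ?_) y
    refine hH.2.1 ((hs _).2 ⟨⟨H, hH.1, rfl⟩, ⟨hH.2.2, L H, hL0 H hH.1,
      fun x hx => (hmem x).1 hx H hH.1, rfl⟩, hdim⟩)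
  exact (isOpen_interior.measure_pos Measure.addHaar hne).ne' hnull

namespace IsFacetPresentation

variable {P : Set E} {s : Finset (E →ᵃ[ℝ] ℝ)}

lemma isClosed (h : IsFacetPresentation P s) : IsClosed P :=
  h.eq ▸ isClosed_setOf_forall_nonneg s

lemma mem_interior (h : IsFacetPresentation P s) {x : E} (hx : ∀ ℓ ∈ s, 0 < ℓ x) :
    x ∈ interior P := by
  rw [mem_interior_iff_mem_nhds]
  have : ∀ᶠ y in 𝓝 x, ∀ ℓ ∈ s, 0 < ℓ y := by
    rw [Finset.eventually_all]
    exact fun ℓ hℓ => (continuous_affine ℓ).continuousAt.eventually (lt_mem_nhds (hx ℓ hℓ))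
  filter_upwards [this] with y hy
  exact h.mem_iff.2 fun ℓ hℓ => (hy ℓ hℓ).le

lemma frontier_eq (h : IsFacetPresentation P s) :
    frontier P = ⋃ ℓ ∈ s, P ∩ {x | ℓ x = 0} := by
  ext x
  rw [h.isClosed.frontier_eq]
  simp only [Set.mem_sdiff, mem_iUnion, mem_inter_iff, mem_ofPred_eq, exists_prop]
  constructor
  · rintro ⟨hx, hi⟩
    by_contra! hpos
    exact hi (h.mem_interior fun ℓ hℓ =>
      lt_of_le_of_ne (h.mem_iff.1 hx ℓ hℓ) (hpos ℓ hℓ hx).symm)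
  · rintro ⟨ℓ, hℓ, hx, h0⟩
    exact ⟨hx, fun hi => (affine_pos_of_mem_interior (h.linear_ne_zero ℓ hℓ)
      (fun y hy => h.mem_iff.1 hy ℓ hℓ) hi).ne' h0⟩

lemma facet_subset_frontier (h : IsFacetPresentation P s) {ℓ : E →ᵃ[ℝ] ℝ} (hℓ : ℓ ∈ s) :
    P ∩ {x | ℓ x = 0} ⊆ frontier P := by
  rw [h.frontier_eq]
  exact subset_biUnion_of_mem (u := fun ℓ : E →ᵃ[ℝ] ℝ => P ∩ {x | ℓ x = 0}) hℓ

/-- From every point of a compact polytope, the ray in a non-zero direction leaves through a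
facet. -/
lemma exists_exit (h : IsFacetPresentation P s) (hc : IsCompact P) {x e : E} (hx : x ∈ P)
    (he : e ≠ 0) : ∃ r : ℝ, 0 ≤ r ∧ x + r • e ∈ P ∧ (∃ ℓ ∈ s, ℓ (x + r • e) = 0) ∧
      ∀ r' : ℝ, x + r' • e ∈ P → r' ≤ r := by
  have hcont : Continuous fun r : ℝ => x + r • e := by fun_prop
  obtain ⟨R, hR⟩ := hc.isBounded.exists_norm_le
  let A : Set ℝ := {r | x + r • e ∈ P}
  have hA : IsCompact A := by
    refine Metric.isCompact_of_isClosed_isBounded (h.isClosed.preimage hcont) ?_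
    refine (Metric.isBounded_closedBall (x := (0 : ℝ)) (r := (R + R) / ‖e‖)).subset fun r hr => ?_
    have h1 := hR _ hr
    have h2 := hR _ hx
    have h3 : ‖r • e‖ ≤ R + R := by
      calc ‖r • e‖ = ‖(x + r • e) - x‖ := by congr 1; abel
        _ ≤ R + R := (norm_sub_le _ _).trans (add_le_add h1 h2)
    rw [norm_smul] at h3
    rw [mem_closedBall_zero_iff, le_div_iff₀ (norm_pos_iff.2 he)]
    exact h3
  have h0 : (0 : ℝ) ∈ A := by simpa [A] using hx
  obtain ⟨r, hrA, hrmax⟩ := hA.exists_isGreatest ⟨0, h0⟩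
  refine ⟨r, hrmax h0, hrA, ?_, fun r' hr' => hrmax hr'⟩
  by_contra! hpos
  have hi : x + r • e ∈ interior P := h.mem_interior fun ℓ hℓ =>
    lt_of_le_of_ne (h.mem_iff.1 hrA ℓ hℓ) (hpos ℓ hℓ).symm
  have hev : ∀ᶠ r' in 𝓝[>] r, r' ∈ A := by
    refine nhdsWithin_le_nhds (hcont.continuousAt.eventually ?_)
    exact mem_interior_iff_mem_nhds.1 hi
  obtain ⟨r', hr', hlt⟩ := (hev.and self_mem_nhdsWithin).exists
  exact absurd (hrmax hr') (not_le.2 hlt)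

end IsFacetPresentation

end Polytope

/-! ### Slicing an invariant measure along lines transversal to a facet -/

section Slice

variable {E : Type*} [NormedAddCommGroup E] [NormedSpace ℝ E]

/-- The signed time, in units of `e`, needed to reach `x` from the hyperplane `ℓ = 0`. -/
noncomputable def slantTime (ℓ : E →ᵃ[ℝ] ℝ) (e x : E) : ℝ := ℓ x / ℓ.linear e

/-- The projection of `x` to the hyperplane `ℓ = 0` along the direction `e`. -/
noncomputable def slantFoot (ℓ : E →ᵃ[ℝ] ℝ) (e x : E) : E := x - slantTime ℓ e x • e

lemma slantTime_add_smul {ℓ : E →ᵃ[ℝ] ℝ} {e z : E} (he : ℓ.linear e ≠ 0) (hz : ℓ z = 0) (s : ℝ) :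
    slantTime ℓ e (z + s • e) = s := by
  rw [slantTime, affine_add_smul, hz, zero_add, mul_div_cancel_right₀ _ he]

lemma slantFoot_add_smul {ℓ : E →ᵃ[ℝ] ℝ} {e z : E} (he : ℓ.linear e ≠ 0) (hz : ℓ z = 0) (s : ℝ) :
    slantFoot ℓ e (z + s • e) = z := by
  rw [slantFoot, slantTime_add_smul he hz, add_sub_cancel_right]

lemma IsFlatMeasureOn.lt_top [MeasurableSpace E] {σ : Measure E} {F : Set E} (hF : IsCompact F)
    (hσ : IsFlatMeasureOn (σ.restrict F) F) : σ F < ∞ := by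
  obtain ⟨mF, hmF, hres⟩ := hσ
  have : σ F = mF F := by
    rw [← Measure.restrict_apply_self, hres, Measure.restrict_apply_self]
  rw [this]
  exact hmF.finite_of_isCompact F hF

/-- A flat measure on a set with non-empty interior is the restriction of a Haar measure. -/
lemma IsFlatMeasureOn.exists_isAddHaarMeasure [MeasurableSpace E] {P : Set E}
    (hP : (interior P).Nonempty) {μ : Measure E} (hμ : IsFlatMeasureOn μ P) :
    ∃ m : Measure E, m.IsAddHaarMeasure ∧ μ = m.restrict P := by
  obtain ⟨m, hm, rfl⟩ := hμ
  have htop : affineSpan ℝ P = ⊤ := by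
    have h1 := isOpen_interior.affineSpan_eq_top hP
    exact top_unique (h1 ▸ affineSpan_mono ℝ interior_subset)
  rw [htop] at hm
  have h1 : IsFiniteMeasureOnCompacts m := ⟨hm.finite_of_isCompact⟩
  have h2 : m.IsAddLeftInvariant := ⟨fun g => by
    simpa only [add_comm] using hm.invariant g (by simp)⟩
  have h3 : m.IsOpenPosMeasure :=
    ⟨fun U hU hne => (hm.pos_of_isOpen U hU (by simpa using hne)).ne'⟩
  exact ⟨m, {}, rfl⟩

variable [FiniteDimensional ℝ E]

lemma continuous_slantTime (ℓ : E →ᵃ[ℝ] ℝ) (e : E) : Continuous (slantTime ℓ e) :=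
  (continuous_affine ℓ).div_const _

lemma continuous_slantFoot (ℓ : E →ᵃ[ℝ] ℝ) (e : E) : Continuous (slantFoot ℓ e) :=
  continuous_id.sub ((continuous_slantTime ℓ e).smul continuous_const)

variable [MeasurableSpace E] [BorelSpace E]

/-- The image of (invariant measure on a hyperplane) × (Lebesgue measure) under `(z, s) ↦ z + s e`
is translation invariant, hence a multiple of any given Haar measure. -/
lemma exists_slice_hyperplane (m : Measure E) [m.IsAddHaarMeasure] {W : AffineSubspace ℝ E}
    {mW : Measure E} (hmW : IsInvariantMeasureOn mW W)
    (hdim : Module.finrank ℝ W.direction + 1 = Module.finrank ℝ E) {ℓ : E →ᵃ[ℝ] ℝ}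
    (hℓ : ∀ x ∈ W, ℓ x = 0) (hne : (W : Set E).Nonempty) {e : E} (he : ℓ.linear e ≠ 0) :
    ∃ C : ℝ≥0∞, C ≠ ∞ ∧ ∀ k : E × ℝ → ℝ≥0∞, Measurable k →
      ∫⁻ x, k (slantFoot ℓ e x, slantTime ℓ e x) ∂m = C * ∫⁻ p, k p ∂(mW.prod volume) := by
  have hfc : IsFiniteMeasureOnCompacts mW := ⟨hmW.finite_of_isCompact⟩
  let φ : E × ℝ → E := fun p => p.1 + p.2 • e
  have hφ : Continuous φ := by fun_prop
  let M : Measure E := (mW.prod volume).map φ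
  have hW0 : ∀ᵐ p ∂(mW.prod (volume : Measure ℝ)), p.1 ∈ W := by
    have : (mW.prod (volume : Measure ℝ)) ((W : Set E)ᶜ ×ˢ univ) = 0 := by
      rw [Measure.prod_prod, hmW.carried, zero_mul]
    refine measure_mono_null ?_ this
    intro p hp
    exact ⟨hp, mem_univ _⟩
  have hdir : W.direction = LinearMap.ker ℓ.linear := by
    obtain ⟨p, hp⟩ := hne
    have hsub : W.direction ≤ LinearMap.ker ℓ.linear := by
      intro v hv
      have h1 := AffineSubspace.vadd_mem_of_mem_direction hv hp
      have h2 := affine_add_smul ℓ p v 1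
      rw [one_smul, add_comm, ← vadd_eq_add, hℓ _ h1, hℓ _ hp] at h2
      simpa using h2.symm
    refine Submodule.eq_of_le_of_finrank_le hsub ?_
    have hker : Module.finrank ℝ (LinearMap.ker ℓ.linear) < Module.finrank ℝ E := by
      refine Submodule.finrank_lt fun h => he ?_
      rw [LinearMap.ker_eq_top.1 h]; rfl
    omega
  have hinv : M.IsAddLeftInvariant := by
    refine ⟨fun g => ?_⟩
    let r := ℓ.linear g / ℓ.linear e
    let w := g - r • e
    have hw : w ∈ W.direction := by
      rw [hdir, LinearMap.mem_ker, map_sub, map_smul, smul_eq_mul, div_mul_cancel₀ _ he, sub_self]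
    have hprod : mW.prod (volume : Measure ℝ) =
        (mW.prod volume).map (Prod.map (fun x => x + w) (fun s => s + r)) := by
      rw [← Measure.map_prod_map _ _ (by fun_prop) (by fun_prop), hmW.invariant w hw,
        map_add_right_eq_self]
    change ((mW.prod volume).map φ).map (fun x => g + x) = (mW.prod volume).map φ
    rw [Measure.map_map (by fun_prop) hφ.measurable]
    conv_rhs => rw [hprod, Measure.map_map hφ.measurable (by fun_prop)]
    congr 1
    ext p
    simp only [Function.comp_apply, φ, Prod.map_fst, Prod.map_snd, w]
    module
  have hcomp : IsFiniteMeasureOnCompacts M := by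
    refine ⟨fun K hK => ?_⟩
    have hpre : M K = (mW.prod volume) (φ ⁻¹' K) :=
      Measure.map_apply hφ.measurable hK.measurableSet
    rw [hpre]
    have hle : (mW.prod (volume : Measure ℝ)) (φ ⁻¹' K) ≤
        (mW.prod volume) ((slantFoot ℓ e '' K) ×ˢ (slantTime ℓ e '' K)) := by
      refine measure_mono_ae ?_
      filter_upwards [hW0] with p hp hpK
      exact ⟨⟨φ p, hpK, slantFoot_add_smul he (hℓ _ hp) _⟩,
        ⟨φ p, hpK, slantTime_add_smul he (hℓ _ hp) _⟩⟩
    refine hle.trans_lt ?_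
    rw [Measure.prod_prod]
    exact ENNReal.mul_lt_top (hK.image (continuous_slantFoot ℓ e)).measure_lt_top
      (hK.image (continuous_slantTime ℓ e)).measure_lt_top
  have hM := Measure.isAddLeftInvariant_eq_smul M m
  set c := Measure.addHaarScalarFactor M m with hc
  have hc0 : c ≠ 0 := by
    intro h0
    have h1 : M univ = 0 := by rw [hM, h0]; simp
    have h2 : M univ = mW univ * volume (univ : Set ℝ) := by
      rw [Measure.map_apply hφ.measurable MeasurableSet.univ, preimage_univ, ← Measure.prod_prod,
        univ_prod_univ]
    have h3 := hmW.pos_of_isOpen univ isOpen_univ (by simpa using hne)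
    rw [h1] at h2
    simp [h3.ne'] at h2
  refine ⟨(c : ℝ≥0∞)⁻¹, ENNReal.inv_ne_top.2 (by simpa using hc0), fun k hk => ?_⟩
  have hmeas : Measurable fun x => k (slantFoot ℓ e x, slantTime ℓ e x) :=
    hk.comp ((continuous_slantFoot ℓ e).measurable.prodMk (continuous_slantTime ℓ e).measurable)
  have h1 : ∫⁻ x, k (slantFoot ℓ e x, slantTime ℓ e x) ∂M =
      c * ∫⁻ x, k (slantFoot ℓ e x, slantTime ℓ e x) ∂m := by
    rw [hM, lintegral_smul_measure]; rfl
  have h2 : ∫⁻ x, k (slantFoot ℓ e x, slantTime ℓ e x) ∂M = ∫⁻ p, k p ∂(mW.prod volume) := by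
    rw [lintegral_map hmeas hφ.measurable]
    refine lintegral_congr_ae ?_
    filter_upwards [hW0] with p hp
    simp only [φ]
    rw [slantFoot_add_smul he (hℓ _ hp), slantTime_add_smul he (hℓ _ hp)]
  rw [← h2, h1, ← mul_assoc, ENNReal.inv_mul_cancel (by simpa using hc0) (by simp), one_mul]

/-- Integrals over a slab of lines in direction `e` transversal to a facet `F` are a fixed
multiple of the product of the thickness of the slab and the integral over the facet. -/
lemma exists_slice_facet (m : Measure E) [m.IsAddHaarMeasure] {σ : Measure E} {F : Set E}
    (hF : MeasurableSet F) (hσ : IsFlatMeasureOn (σ.restrict F) F)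
    (hdim : Module.finrank ℝ (affineSpan ℝ F).direction + 1 = Module.finrank ℝ E)
    {ℓ : E →ᵃ[ℝ] ℝ} (hℓ : ∀ x ∈ F, ℓ x = 0) (hne : F.Nonempty) {e : E} (he : ℓ.linear e ≠ 0) :
    ∃ C : ℝ≥0∞, C ≠ ∞ ∧ ∀ h : E → ℝ≥0∞, Measurable h → ∀ I : Set ℝ, MeasurableSet I →
      ∫⁻ x, F.indicator h (slantFoot ℓ e x) * I.indicator 1 (slantTime ℓ e x) ∂m =
        C * (volume I * ∫⁻ z in F, h z ∂σ) := by
  obtain ⟨mF, hmF, hres⟩ := hσ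
  have hℓ' : ∀ x ∈ affineSpan ℝ F, ℓ x = 0 := by
    intro x hx
    have h1 : affineSpan ℝ F ≤ (affineSpan ℝ {(0 : ℝ)}).comap ℓ := by
      rw [affineSpan_le]
      intro y hy
      simp [hℓ y hy]
    simpa using h1 hx
  obtain ⟨C, hC, H⟩ := exists_slice_hyperplane m hmF hdim hℓ' (hne.mono (subset_affineSpan ℝ F)) he
  have hfc : IsFiniteMeasureOnCompacts mF := ⟨hmF.finite_of_isCompact⟩
  refine ⟨C, hC, fun h hh I hI => ?_⟩
  rw [H (fun p => F.indicator h p.1 * I.indicator 1 p.2)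
    (((hh.indicator hF).comp measurable_fst).mul
      ((measurable_one.indicator hI).comp measurable_snd)),
    lintegral_prod_mul (hh.indicator hF).aemeasurable (measurable_one.indicator hI).aemeasurable,
    lintegral_indicator hF, lintegral_indicator_one hI, mul_comm (volume I), ← hres]

end Slice

/-! ### The boundary integral controls the `L^{n/(n-1)}` norm -/

section BoundaryBound

variable {E : Type*} [NormedAddCommGroup E] [NormedSpace ℝ E]

lemma measurable_indicator_of_lowerSemicontinuousOn {X : Type*} [TopologicalSpace X]
    [MeasurableSpace X] [BorelSpace X] {P : Set X} {u : X → ℝ≥0∞} (hP : IsClosed P)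
    (hu : LowerSemicontinuousOn u P) : Measurable (P.indicator u) := by
  classical
  have h1 : LowerSemicontinuous (fun x => if x ∈ P then u x else ∞) := by
    intro x c hc
    by_cases hx : x ∈ P
    · simp only [hx, if_true] at hc
      have := hu x hx c hc
      rw [eventually_nhdsWithin_iff] at this
      filter_upwards [this] with y hy
      by_cases hyP : y ∈ P
      · simpa [hyP] using hy hyP
      · simpa [hyP] using hc.trans_le le_top
    · filter_upwards [hP.isOpen_compl.mem_nhds hx] with y hy
      simp only [hx, if_false] at hc
      simpa [show y ∉ P from hy] using hc
  have h2 : P.indicator u = P.indicator (fun x => if x ∈ P then u x else ∞) := by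
    refine indicator_congr fun x hx => ?_
    simp [hx]
  rw [h2]
  exact h1.measurable.indicator hP.measurableSet

lemma exists_forall_linear_ne_zero {s : Finset (E →ᵃ[ℝ] ℝ)} (hs : ∀ ℓ ∈ s, ℓ.linear ≠ 0) :
    ∃ d : E, ∀ ℓ ∈ s, ℓ.linear d ≠ 0 := by
  have h := Subspace.biUnion_ne_univ_of_top_notMem
    (s := (s.image fun ℓ : E →ᵃ[ℝ] ℝ => LinearMap.ker ℓ.linear)) (by
      simp only [Finset.mem_image, not_exists, not_and]
      intro ℓ hℓ h
      exact hs ℓ hℓ (LinearMap.ker_eq_top.1 h))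
  obtain ⟨d, hd⟩ := (ne_univ_iff_exists_notMem _).1 h
  refine ⟨d, fun ℓ hℓ h0 => hd ?_⟩
  simp only [mem_iUnion]
  exact ⟨LinearMap.ker ℓ.linear, Finset.mem_image_of_mem _ hℓ, h0⟩

/-- The vectors transversal to finitely many hyperplanes are dense along every line in a transversal
direction; in particular they span. -/
lemma eventually_transversal {s : Finset (E →ᵃ[ℝ] ℝ)} {d : E} (hd : ∀ ℓ ∈ s, ℓ.linear d ≠ 0)
    (x : E) : ∀ᶠ t in 𝓝[≠] (0 : ℝ), ∀ ℓ ∈ s, ℓ.linear (x + t • d) ≠ 0 := by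
  rw [Finset.eventually_all]
  intro ℓ hℓ
  have hfin : ({-(ℓ.linear x) / ℓ.linear d} : Set ℝ).Finite := finite_singleton _
  by_cases hx : ℓ.linear x = 0
  · filter_upwards [self_mem_nhdsWithin] with t ht h0
    rw [map_add, map_smul, hx, zero_add, smul_eq_mul] at h0
    exact mul_ne_zero ht (hd ℓ hℓ) h0
  · have hne : (0 : ℝ) ≠ -(ℓ.linear x) / ℓ.linear d :=
      (div_ne_zero (neg_ne_zero.2 hx) (hd ℓ hℓ)).symm
    filter_upwards [nhdsWithin_le_nhds (isOpen_ne.mem_nhds hne)] with t ht h0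
    rw [map_add, map_smul, smul_eq_mul] at h0
    refine ht ?_
    rw [eq_div_iff (hd ℓ hℓ)]
    linarith

lemma exists_basis_transversal [FiniteDimensional ℝ E] {s : Finset (E →ᵃ[ℝ] ℝ)}
    (hs : ∀ ℓ ∈ s, ℓ.linear ≠ 0) :
    ∃ b : Module.Basis (Fin (Module.finrank ℝ E)) ℝ E, ∀ i, ∀ ℓ ∈ s, ℓ.linear (b i) ≠ 0 := by
  obtain ⟨d, hd⟩ := exists_forall_linear_ne_zero hs
  have hspan : ⊤ ≤ Submodule.span ℝ {e : E | ∀ ℓ ∈ s, ℓ.linear e ≠ 0} := by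
    intro x _
    obtain ⟨t, ht, -⟩ := ((eventually_transversal hd x).and self_mem_nhdsWithin).exists
    have : x = (x + t • d) - t • d := by abel
    rw [this]
    exact Submodule.sub_mem _ (Submodule.subset_span ht)
      (Submodule.smul_mem _ _ (Submodule.subset_span hd))
  let b := Module.Basis.ofSpan hspan
  have := FiniteDimensional.fintypeBasisIndex b
  let b' : Module.Basis (Fin (Module.finrank ℝ E)) ℝ E := b.reindex (Fintype.equivOfCardEq (by
    rw [← Module.finrank_eq_card_basis b, Fintype.card_fin]))
  refine ⟨b', fun i => ?_⟩
  have : b' i ∈ range b := by simp [b']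
  exact Module.Basis.ofSpan_subset hspan this

variable {P : Set E} {s : Finset (E →ᵃ[ℝ] ℝ)} {u : E → ℝ≥0∞}

lemma slantFoot_smul_add {ℓ : E →ᵃ[ℝ] ℝ} {e : E} (he : ℓ.linear e ≠ 0) (x : E) (r : ℝ) :
    slantFoot ℓ e (x + r • e) = slantFoot ℓ e x := by
  have : slantTime ℓ e (x + r • e) = slantTime ℓ e x + r := by
    rw [slantTime, affine_add_smul, add_div, mul_div_cancel_right₀ _ he, slantTime]
  rw [slantFoot, slantFoot, this]
  module

lemma slantFoot_eq {ℓ : E →ᵃ[ℝ] ℝ} {e x : E} {r : ℝ} (he : ℓ.linear e ≠ 0)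
    (h : ℓ (x + r • e) = 0) : slantFoot ℓ e x = x + r • e := by
  rw [← slantFoot_smul_add he x r]
  simpa using slantFoot_add_smul he h 0

lemma slantTime_eq {ℓ : E →ᵃ[ℝ] ℝ} {e x : E} {r : ℝ} (he : ℓ.linear e ≠ 0)
    (h : ℓ (x + r • e) = 0) : slantTime ℓ e x = -r := by
  have := slantTime_add_smul he h (-r)
  rwa [neg_smul, add_neg_cancel_right] at this

variable [FiniteDimensional ℝ E]

lemma isCompact_facet (hc : IsCompact P)
    (ℓ : E →ᵃ[ℝ] ℝ) : IsCompact (P ∩ {x | ℓ x = 0}) :=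
  hc.inter_right (isClosed_eq (continuous_affine ℓ) continuous_const)

/-- Along any line, a log-convex function is bounded by its value at one of the two boundary points
of the line. -/
lemma IsFacetPresentation.exists_le_boundary (h : IsFacetPresentation P s) (hc : IsCompact P)
    (hu : IsLogConvexOn P u) {x e : E} (hx : x ∈ P) (he : e ≠ 0) :
    ∃ ℓ ∈ s, ∃ r : ℝ, x + r • e ∈ P ∧ ℓ (x + r • e) = 0 ∧ u x ≤ u (x + r • e) := by
  obtain ⟨r, hr, hrP, ⟨ℓ, hℓ, hℓ0⟩, -⟩ := h.exists_exit hc hx he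
  obtain ⟨r', hr', hrP', ⟨ℓ', hℓ', hℓ0'⟩, -⟩ := h.exists_exit hc hx (neg_ne_zero.2 he)
  rw [smul_neg, ← neg_smul] at hrP' hℓ0'
  rcases (add_nonneg hr hr').eq_or_lt with h0 | hpos
  · obtain rfl : r = 0 := by linarith
    exact ⟨ℓ, hℓ, 0, hrP, hℓ0, by simp⟩
  have hx' : x = (1 - r / (r + r')) • (x + r • e) + (r / (r + r')) • (x + (-r') • e) := by
    have h1 : (1 - r / (r + r')) • (x + r • e) + (r / (r + r')) • (x + (-r') • e) =
        x + (((1 - r / (r + r')) * r) + (r / (r + r')) * (-r')) • e := by module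
    rw [h1, show (1 - r / (r + r')) * r + r / (r + r') * -r' = 0 by field_simp; ring]
    simp
  have hle := hu.le_max hrP hrP' (t := r / (r + r'))
    ⟨by positivity, by rw [div_le_one hpos]; linarith⟩
  rw [← hx', le_max_iff] at hle
  rcases hle with hle | hle
  · exact ⟨ℓ, hℓ, r, hrP, hℓ0, hle⟩
  · exact ⟨ℓ', hℓ', -r', hrP', hℓ0', hle⟩

variable [MeasurableSpace E] [BorelSpace E]

/-- The facets of `P` carry flat measures induced by `σ`. -/
def IsFlatOnFacets (σ : Measure E) (P : Set E) (s : Finset (E →ᵃ[ℝ] ℝ)) : Prop :=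
  ∀ ℓ ∈ s, IsFlatMeasureOn (σ.restrict (P ∩ {x | ℓ x = 0})) (P ∩ {x | ℓ x = 0})

/-- The sum of the slab integrals over all facets, for a fixed transversal direction, is bounded by
the boundary integral. -/
lemma IsFacetPresentation.exists_slice (h : IsFacetPresentation P s) (hc : IsCompact P)
    (m : Measure E) [m.IsAddHaarMeasure] {σ : Measure E} (hσ : IsFlatOnFacets σ P s) {e : E}
    (he : ∀ ℓ ∈ s, ℓ.linear e ≠ 0) :
    ∃ C : ℝ≥0∞, C ≠ ∞ ∧ ∀ g : E → ℝ≥0∞, Measurable g → ∀ I : Set ℝ, MeasurableSet I →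
      ∫⁻ x, ∑ ℓ ∈ s, (P ∩ {x | ℓ x = 0}).indicator g (slantFoot ℓ e x) *
        I.indicator 1 (slantTime ℓ e x) ∂m ≤ C * (volume I * ∫⁻ z in frontier P, g z ∂σ) := by
  have hex : ∀ ℓ : E →ᵃ[ℝ] ℝ, ∃ C : ℝ≥0∞, ℓ ∈ s → C ≠ ∞ ∧ ∀ g : E → ℝ≥0∞, Measurable g →
      ∀ I : Set ℝ, MeasurableSet I →
      ∫⁻ x, (P ∩ {x | ℓ x = 0}).indicator g (slantFoot ℓ e x) *
        I.indicator 1 (slantTime ℓ e x) ∂m =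
        C * (volume I * ∫⁻ z in (P ∩ {x | ℓ x = 0}), g z ∂σ) := by
    intro ℓ
    by_cases hℓ : ℓ ∈ s
    · obtain ⟨C, hC⟩ := exists_slice_facet m (isCompact_facet hc ℓ).measurableSet (hσ ℓ hℓ)
        (h.isFacet ℓ hℓ).2 (fun x hx => hx.2) (h.isFacet ℓ hℓ).1.1 (he ℓ hℓ)
      exact ⟨C, fun _ => hC⟩
    · exact ⟨0, fun h => absurd h hℓ⟩
  choose C hC using hex
  refine ⟨∑ ℓ ∈ s, C ℓ, ENNReal.sum_ne_top.2 fun ℓ hℓ => (hC ℓ hℓ).1, fun g hg I hI => ?_⟩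
  rw [lintegral_finsetSum]
  · rw [Finset.sum_mul]
    refine Finset.sum_le_sum fun ℓ hℓ => ?_
    rw [(hC ℓ hℓ).2 g hg I hI]
    gcongr
    exact h.facet_subset_frontier hℓ
  · intro ℓ hℓ
    exact ((hg.indicator (isCompact_facet hc ℓ).measurableSet).comp
      (continuous_slantFoot ℓ e).measurable).mul
      ((measurable_one.indicator hI).comp (continuous_slantTime ℓ e).measurable)

/-- For log-convex `u` on an `n`-dimensional polytope, `n ≥ 2`, the boundary integral controls the
`L^{n/(n-1)}` norm. Along each of `n` independent directions `u` is bounded by a function that is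
constant on the lines in that direction and is controlled by the boundary values of `u`, so that
the grid-lines inequality (as in the Gagliardo-Nirenberg-Sobolev inequality) applies. -/
lemma IsFacetPresentation.exists_lintegral_rpow_le (h : IsFacetPresentation P s)
    (hc : IsCompact P) (m : Measure E) [m.IsAddHaarMeasure] {σ : Measure E}
    (hσ : IsFlatOnFacets σ P s) {n : ℕ} (hn : 2 ≤ n) (hdim : Module.finrank ℝ E = n) :
    ∃ C : ℝ≥0∞, C ≠ ∞ ∧ ∀ u : E → ℝ≥0∞, IsLogConvexOn P u → LowerSemicontinuousOn u P →
      ∫⁻ x in P, u x ^ ((n : ℝ) / (n - 1)) ∂m ≤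
        (C * ∫⁻ z in frontier P, u z ∂σ) ^ ((n : ℝ) / (n - 1)) := by
  subst hdim
  set n := Module.finrank ℝ E
  have hn1 : (1 : ℝ) < n := by exact_mod_cast hn
  have hn0 : (0 : ℝ) < (n : ℝ) - 1 := by linarith
  have hp0 : 0 < (n : ℝ) / (n - 1) := by positivity
  have hconj : Real.HolderConjugate (Fintype.card (Fin n) : ℝ) ((n : ℝ) / (n - 1)) := by
    rw [Fintype.card_fin]
    exact Real.HolderConjugate.conjExponent hn1
  obtain ⟨b, hb⟩ := exists_basis_transversal h.linear_ne_zero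
  let Φ : (Fin n → ℝ) ≃L[ℝ] E := b.equivFunL.symm
  have hΦ : ∀ (y : Fin n → ℝ) (i : Fin n) (t : ℝ),
      Φ (Function.update y i t) = Φ y + (t - y i) • b i := by
    intro y i t
    have : Function.update y i t = y + (t - y i) • Pi.single i 1 := by
      ext j
      by_cases hj : j = i
      · subst hj; simp
      · simp [hj]
    rw [this, map_add, map_smul]
    congr 2
    change b.equivFun.symm _ = _
    rw [Module.Basis.equivFun_symm_apply]
    simp [Pi.single_apply]
  let ν : Measure (Fin n → ℝ) := m.map Φ.symm
  have hν : ν.IsAddHaarMeasure := Φ.symm.isAddHaarMeasure_map m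
  have hν1 := Measure.isAddLeftInvariant_eq_smul ν volume
  have hν2 := Measure.isAddLeftInvariant_eq_smul (volume : Measure (Fin n → ℝ)) ν
  set c := Measure.addHaarScalarFactor ν volume
  set c' := Measure.addHaarScalarFactor volume ν
  have hmν : m = ν.map Φ := by
    simp only [ν]
    rw [Measure.map_map Φ.continuous.measurable Φ.symm.continuous.measurable]
    simp
  -- a box containing `P` in the coordinates of the basis
  obtain ⟨R, hR1, hR⟩ : ∃ R : ℝ, 1 ≤ R ∧ ∀ y, Φ y ∈ P → ∀ i, y i ∈ Icc (-R) R := by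
    obtain ⟨R, hR⟩ := (hc.image Φ.symm.continuous).isBounded.exists_norm_le
    refine ⟨max 1 R, le_max_left _ _, fun y hy i => ?_⟩
    have h1 := hR y ⟨Φ y, hy, by simp⟩
    have h2 := (norm_le_pi_norm y i).trans h1
    rw [Real.norm_eq_abs, abs_le] at h2
    have := le_max_right 1 R
    exact ⟨by linarith, by linarith⟩
  let box : Set (Fin n → ℝ) := univ.pi fun _ => Icc (-R) R
  have hbox : IsCompact box := isCompact_univ_pi fun _ => isCompact_Icc
  obtain ⟨T, hT⟩ : ∃ T : ℝ, ∀ y ∈ box, ∀ i, ∀ ℓ ∈ s, slantTime ℓ (b i) (Φ y) ∈ Icc (-T) T := by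
    have hcont : Continuous fun y => ∑ i, ∑ ℓ ∈ s, |slantTime ℓ (b i) (Φ y)| :=
      continuous_finsetSum _ fun i _ => continuous_finsetSum _ fun ℓ _ =>
        ((continuous_slantTime ℓ (b i)).comp Φ.continuous).abs
    obtain ⟨T, hT⟩ := (hbox.image hcont).bddAbove
    refine ⟨T, fun y hy i ℓ hℓ => abs_le.1 ?_⟩
    have h1 : |slantTime ℓ (b i) (Φ y)| ≤ ∑ ℓ ∈ s, |slantTime ℓ (b i) (Φ y)| :=
      Finset.single_le_sum (f := fun ℓ => |slantTime ℓ (b i) (Φ y)|) (fun _ _ => abs_nonneg _) hℓ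
    have h2 : ∑ ℓ ∈ s, |slantTime ℓ (b i) (Φ y)| ≤ ∑ i, ∑ ℓ ∈ s, |slantTime ℓ (b i) (Φ y)| :=
      Finset.single_le_sum (f := fun i => ∑ ℓ ∈ s, |slantTime ℓ (b i) (Φ y)|)
        (fun _ _ => Finset.sum_nonneg fun _ _ => abs_nonneg _) (Finset.mem_univ i)
    exact h1.trans (h2.trans (hT ⟨y, hy, rfl⟩))
  choose K hKtop hK using fun i => h.exists_slice hc m hσ (hb i)
  refine ⟨(c : ℝ≥0∞) ^ (1 / ((n : ℝ) / (n - 1))) *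
    (c' * ∑ i, K i * volume (Icc (-T) T)), ?_, fun u hu hul => ?_⟩
  · refine ENNReal.mul_ne_top (ENNReal.rpow_ne_top_of_nonneg (by positivity) (by simp))
      (ENNReal.mul_ne_top (by simp) (ENNReal.sum_ne_top.2 fun i _ =>
        ENNReal.mul_ne_top (hKtop i) (by simp)))
  have hg : Measurable (P.indicator u) :=
    measurable_indicator_of_lowerSemicontinuousOn h.isClosed hul
  set g := P.indicator u with hgdef
  have hD : ∫⁻ z in frontier P, u z ∂σ = ∫⁻ z in frontier P, g z ∂σ := by
    refine setLIntegral_congr_fun isClosed_frontier.measurableSet fun z hz => ?_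
    rw [hgdef, indicator_of_mem (h.isClosed.frontier_subset hz)]
  -- `G i` is constant along `b i`, collects the values of `u` on all facets, and bounds `u`
  let G : Fin n → E → ℝ≥0∞ := fun i x =>
    ∑ ℓ ∈ s, (P ∩ {x | ℓ x = 0}).indicator g (slantFoot ℓ (b i) x)
  have hGmeas : ∀ i, Measurable (G i) := fun i => Finset.measurable_fun_sum _ fun ℓ _ =>
    (hg.indicator (isCompact_facet hc ℓ).measurableSet).comp
      (continuous_slantFoot ℓ (b i)).measurable
  have huG : ∀ i, ∀ x ∈ P, u x ≤ G i x := by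
    intro i x hx
    obtain ⟨ℓ, hℓ, r, hr, hr0, hle⟩ := h.exists_le_boundary hc hu hx (b.ne_zero i)
    refine hle.trans ?_
    have h1 : u (x + r • b i) =
        (P ∩ {x | ℓ x = 0}).indicator g (slantFoot ℓ (b i) x) := by
      rw [slantFoot_eq (hb i ℓ hℓ) hr0, indicator_of_mem (show x + r • b i ∈
        P ∩ {x | ℓ x = 0} from ⟨hr, hr0⟩), hgdef, indicator_of_mem hr]
    rw [h1]
    exact Finset.single_le_sum_of_canonicallyOrdered
      (f := fun ℓ : E →ᵃ[ℝ] ℝ => (P ∩ {x | ℓ x = 0}).indicator g (slantFoot ℓ (b i) x)) hℓ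
  have hGconst : ∀ i y t, G i (Φ (Function.update y i t)) = G i (Φ y) := by
    intro i y t
    refine Finset.sum_congr rfl fun ℓ hℓ => ?_
    rw [hΦ, slantFoot_smul_add (hb i ℓ hℓ)]
  -- each line integral of `f` through a point of `P` runs over a length of at least `1` in the box,
  -- since `1 ≤ R`, and hence bounds `u`
  let f : (Fin n → ℝ) → ℝ≥0∞ := fun y => ∑ i, box.indicator 1 y * G i (Φ y)
  have hf : Measurable f := Finset.measurable_fun_sum _ fun i _ =>
    (measurable_one.indicator hbox.measurableSet).mul
      ((hGmeas i).comp Φ.continuous.measurable)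
  have hline : ∀ y, Φ y ∈ P → ∀ i, u (Φ y) ≤ ∫⁻ t, f (Function.update y i t) := by
    intro y hy i
    calc u (Φ y) ≤ u (Φ y) * volume (Icc (-R) R) := by
          refine le_mul_of_one_le_right' ?_
          rw [Real.volume_Icc, ENNReal.one_le_ofReal]
          linarith
      _ = ∫⁻ t in Icc (-R) R, u (Φ y) := by rw [setLIntegral_const]
      _ ≤ ∫⁻ t in Icc (-R) R, f (Function.update y i t) := by
          refine setLIntegral_mono' measurableSet_Icc fun t ht => ?_
          have hmem : Function.update y i t ∈ box := by
            intro j _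
            by_cases hj : j = i
            · subst hj; simpa using ht
            · simpa [hj] using hR y hy j
          calc u (Φ y) ≤ G i (Φ (Function.update y i t)) := by
                rw [hGconst]; exact huG i _ hy
            _ = box.indicator 1 (Function.update y i t) * G i (Φ (Function.update y i t)) := by
                rw [indicator_of_mem hmem]; simp
            _ ≤ f (Function.update y i t) :=
                Finset.single_le_sum_of_canonicallyOrdered (f := fun i' =>
                  box.indicator 1 (Function.update y i t) * G i' (Φ (Function.update y i t)))
                  (Finset.mem_univ i)
      _ ≤ _ := setLIntegral_le_lintegral _ _
  have hfint : ∫⁻ y, f y ≤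
      c' * (∑ i, K i * volume (Icc (-T) T)) * ∫⁻ z in frontier P, u z ∂σ := by
    have hfm : ∫⁻ y, f y ∂ν = ∫⁻ x, f (Φ.symm x) ∂m :=
      lintegral_map hf Φ.symm.continuous.measurable
    calc ∫⁻ y, f y = c' * ∫⁻ y, f y ∂ν := by
          conv_lhs => rw [hν2]
          rw [lintegral_smul_measure]; rfl
      _ = c' * ∑ i, ∫⁻ x, box.indicator 1 (Φ.symm x) * G i x ∂m := by
          rw [hfm, ← lintegral_finsetSum]
          · simp [f]
          · intro i _
            exact ((measurable_one.indicator hbox.measurableSet).comp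
              Φ.symm.continuous.measurable).mul (hGmeas i)
      _ ≤ c' * ∑ i, K i * (volume (Icc (-T) T) * ∫⁻ z in frontier P, g z ∂σ) := by
          gcongr with i
          refine (lintegral_mono fun x => ?_).trans (hK i g hg _ measurableSet_Icc)
          by_cases hx : Φ.symm x ∈ box
          · rw [indicator_of_mem hx, Pi.one_apply, one_mul]
            refine Finset.sum_le_sum fun ℓ hℓ => ?_
            have := hT _ hx i ℓ hℓ
            rw [ContinuousLinearEquiv.apply_symm_apply] at this
            rw [indicator_of_mem this, Pi.one_apply, mul_one]
          · rw [indicator_of_notMem hx, zero_mul]; exact zero_le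
      _ = _ := by rw [hD, mul_assoc, Finset.sum_mul]; simp only [mul_assoc]
  calc ∫⁻ x in P, u x ^ ((n : ℝ) / (n - 1)) ∂m
      = ∫⁻ x, P.indicator (fun x => g x ^ ((n : ℝ) / (n - 1))) x ∂m := by
        rw [lintegral_indicator h.isClosed.measurableSet]
        refine setLIntegral_congr_fun h.isClosed.measurableSet fun z hz => ?_
        simp only [hgdef, indicator_of_mem hz]
    _ = ∫⁻ y, P.indicator (fun x => g x ^ ((n : ℝ) / (n - 1))) (Φ y) ∂ν := by
        conv_lhs => rw [hmν]
        rw [lintegral_map ((hg.pow_const _).indicator h.isClosed.measurableSet)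
          Φ.continuous.measurable]
    _ = c * ∫⁻ y, P.indicator (fun x => g x ^ ((n : ℝ) / (n - 1))) (Φ y) := by
        rw [hν1, lintegral_smul_measure]; rfl
    _ ≤ c * ∫⁻ y, ∏ i, (∫⁻ t, f (Function.update y i t)) ^
          ((1 : ℝ) / ((Fintype.card (Fin n) : ℝ) - 1)) := by
        gcongr with y
        by_cases hy : Φ y ∈ P
        · rw [indicator_of_mem hy, hgdef, indicator_of_mem hy]
          calc u (Φ y) ^ ((n : ℝ) / (n - 1))
              = ∏ _i : Fin n, u (Φ y) ^ ((1 : ℝ) / ((Fintype.card (Fin n) : ℝ) - 1)) := by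
                rw [Finset.prod_const, Finset.card_univ, Fintype.card_fin, ← ENNReal.rpow_natCast,
                  ← ENNReal.rpow_mul]
                congr 1
                field_simp
            _ ≤ _ := by
                refine Finset.prod_le_prod' fun i _ => ENNReal.rpow_le_rpow (hline y hy i) ?_
                rw [Fintype.card_fin]; positivity
        · rw [indicator_of_notMem hy]; exact zero_le
    _ ≤ c * (∫⁻ y, f y) ^ ((n : ℝ) / (n - 1)) := by
        gcongr
        exact lintegral_prod_lintegral_pow_le (fun _ => volume) hconj hf
    _ = ((c : ℝ≥0∞) ^ (1 / ((n : ℝ) / (n - 1))) * ∫⁻ y, f y) ^ ((n : ℝ) / (n - 1)) := by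
        rw [ENNReal.mul_rpow_of_nonneg _ _ hp0.le, ← ENNReal.rpow_mul, one_div_mul_cancel hp0.ne',
          ENNReal.rpow_one]
    _ ≤ _ := by
        refine ENNReal.rpow_le_rpow ?_ hp0.le
        rw [mul_assoc]
        gcongr

/-- In dimension one a log-convex function is bounded by its boundary integral. -/
lemma IsFacetPresentation.exists_le_boundary_integral (h : IsFacetPresentation P s)
    (hc : IsCompact P) {σ : Measure E}
    (hσ : IsFlatOnFacets σ P s) (hdim : Module.finrank ℝ E = 1) :
    ∃ C : ℝ≥0∞, C ≠ ∞ ∧ ∀ u : E → ℝ≥0∞, IsLogConvexOn P u → ∀ x ∈ P,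
      u x ≤ C * ∫⁻ z in frontier P, u z ∂σ := by
  have hsub : ∀ ℓ ∈ s, (P ∩ {x | ℓ x = 0}).Subsingleton := by
    intro ℓ hℓ
    have h1 : (affineSpan ℝ (P ∩ {x | ℓ x = 0})).direction = ⊥ :=
      Submodule.finrank_eq_zero.1 (by have := (h.isFacet ℓ hℓ).2; omega)
    rw [direction_affineSpan] at h1
    intro x hx y hy
    have h2 := vsub_mem_vectorSpan ℝ hx hy
    rw [h1, Submodule.mem_bot, vsub_eq_sub, sub_eq_zero] at h2
    exact h2
  have hpos : ∀ ℓ ∈ s, σ (P ∩ {x | ℓ x = 0}) ≠ 0 := by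
    intro ℓ hℓ h0
    obtain ⟨mF, hmF, hres⟩ := hσ ℓ hℓ
    obtain ⟨b, hb⟩ := (h.isFacet ℓ hℓ).1.1
    have hF : P ∩ {x | ℓ x = 0} = {b} := (hsub ℓ hℓ).eq_singleton_of_mem hb
    rw [hF] at hmF hres h0
    have h1 : mF {b} = 0 := by
      rw [← Measure.restrict_apply_self, ← hres, Measure.restrict_apply_self, h0]
    have h2 : mF {b}ᶜ = 0 := by simpa using hmF.carried
    have h3 := hmF.pos_of_isOpen univ isOpen_univ (by simp)
    refine h3.ne' ?_
    rw [← union_compl_self {b}]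
    exact measure_union_null h1 h2
  obtain ⟨e, he⟩ : ∃ e : E, e ≠ 0 := by
    have : Nontrivial E := Module.nontrivial_of_finrank_pos (R := ℝ) (by omega)
    exact exists_ne 0
  refine ⟨∑ ℓ ∈ s, (σ (P ∩ {x | ℓ x = 0}))⁻¹, ENNReal.sum_ne_top.2 fun ℓ hℓ =>
    ENNReal.inv_ne_top.2 (hpos ℓ hℓ), fun u hu x hx => ?_⟩
  obtain ⟨ℓ, hℓ, r, hr, hr0, hle⟩ := h.exists_le_boundary hc hu hx he
  have hF : P ∩ {x | ℓ x = 0} = {x + r • e} := (hsub ℓ hℓ).eq_singleton_of_mem ⟨hr, hr0⟩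
  have h1 : u (x + r • e) * σ (P ∩ {x | ℓ x = 0}) ≤ ∫⁻ z in frontier P, u z ∂σ := by
    calc u (x + r • e) * σ (P ∩ {x | ℓ x = 0}) = ∫⁻ z in P ∩ {x | ℓ x = 0}, u z ∂σ := by
          rw [hF, Measure.restrict_singleton, lintegral_smul_measure, lintegral_dirac,
            smul_eq_mul, mul_comm]
      _ ≤ _ := lintegral_mono_set (h.facet_subset_frontier hℓ)
  have hfin : σ (P ∩ {x | ℓ x = 0}) ≠ ∞ :=
    (IsFlatMeasureOn.lt_top (isCompact_facet hc ℓ) (hσ ℓ hℓ)).ne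
  calc u x ≤ u (x + r • e) := hle
    _ = (σ (P ∩ {x | ℓ x = 0}))⁻¹ * (u (x + r • e) * σ (P ∩ {x | ℓ x = 0})) := by
        rw [mul_comm, mul_assoc, ENNReal.mul_inv_cancel (hpos ℓ hℓ) hfin, mul_one]
    _ ≤ _ := by
        refine mul_le_mul' ?_ h1
        exact Finset.single_le_sum_of_canonicallyOrdered
          (f := fun ℓ : E →ᵃ[ℝ] ℝ => (σ (P ∩ {x : E | ℓ x = 0}))⁻¹) hℓ

end BoundaryBound

/-! ### Entropy as an integral of a non-negative convex function -/

section Entropy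

/-- The function `y log y + 1 - y` on `[0, ∞]`. -/
noncomputable def klENN (y : ℝ≥0∞) : ℝ≥0∞ :=
  if y = ∞ then ∞ else ENNReal.ofReal (klFun y.toReal)

lemma klENN_of_ne_top {y : ℝ≥0∞} (hy : y ≠ ∞) : klENN y = ENNReal.ofReal (klFun y.toReal) :=
  if_neg hy

lemma measurable_klENN : Measurable klENN :=
  Measurable.ite (measurableSet_singleton _) measurable_const
    (ENNReal.measurable_ofReal.comp (measurable_klFun.comp ENNReal.measurable_toReal))

lemma continuousAt_klENN {y : ℝ≥0∞} (hy : y ≠ ∞) : ContinuousAt klENN y := by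
  have h1 : ContinuousAt (fun y : ℝ≥0∞ => ENNReal.ofReal (klFun y.toReal)) y :=
    ENNReal.continuous_ofReal.continuousAt.comp
      (continuous_klFun.continuousAt.comp (ENNReal.tendsto_toReal hy))
  refine h1.congr ?_
  filter_upwards [isOpen_ne.mem_nhds hy] with z hz
  rw [klENN_of_ne_top hz]

/-- The positive and negative parts of `y log y` in terms of `y log y + 1 - y`. -/
lemma toENNReal_mul_log_add_one (y : ℝ≥0∞) :
    ((y : EReal) * ENNReal.log y).toENNReal + 1 =
      klENN y + y + (-((y : EReal) * ENNReal.log y)).toENNReal := by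
  induction y with
  | top => simp [klENN]
  | coe r =>
    have hlog : ((r : ℝ≥0∞) : EReal) * ENNReal.log r = ((r * Real.log r : ℝ) : EReal) := by
      by_cases hr : r = 0
      · simp [hr]
      · rw [ENNReal.log_pos_real' (by simpa using pos_iff_ne_zero.2 hr)]
        simp only [ENNReal.coe_toReal, EReal.coe_mul]
        rfl
    rw [hlog, klENN_of_ne_top ENNReal.coe_ne_top, ← EReal.coe_neg, EReal.toENNReal_of_ne_top,
      EReal.toENNReal_of_ne_top, EReal.toReal_coe, EReal.toReal_coe, ENNReal.coe_toReal]
    · have hr : (0 : ℝ) ≤ r := r.2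
      have hkl := klFun_nonneg hr
      rw [← ENNReal.ofReal_coe_nnreal, ← ENNReal.ofReal_one]
      rcases le_total 0 ((r : ℝ) * Real.log r) with h | h
      · rw [ENNReal.ofReal_of_nonpos (neg_nonpos.2 h), add_zero, ← ENNReal.ofReal_add h zero_le_one,
          ← ENNReal.ofReal_add hkl hr, klFun_apply]
        congr 1; ring
      · rw [ENNReal.ofReal_of_nonpos h, zero_add, ← ENNReal.ofReal_add hkl hr,
          ← ENNReal.ofReal_add (by positivity) (by linarith), klFun_apply]
        congr 1; ring
    · exact EReal.coe_ne_top _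
    · exact EReal.coe_ne_top _

lemma toENNReal_neg_mul_log_le (y : ℝ≥0∞) :
    (-((y : EReal) * ENNReal.log y)).toENNReal ≤ 1 := by
  by_cases h : 0 ≤ (y : EReal) * ENNReal.log y
  · rw [EReal.toENNReal_of_nonpos (by simpa using h)]; exact zero_le_one
  · have h1 := toENNReal_mul_log_add_one y
    rw [EReal.toENNReal_of_nonpos (not_le.1 h).le, zero_add] at h1
    rw [h1]; exact le_add_self

variable {E : Type*} [MeasurableSpace E] {P : Set E} {m : Measure E} {u v : E → ℝ≥0∞}

/-- The negative of the entropy of a normalized function, as an element of `[0, ∞]`. -/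
noncomputable def relEntropy (P : Set E) (m : Measure E) (u : E → ℝ≥0∞) : ℝ≥0∞ :=
  (∫⁻ x in P, klENN (u x) ∂m) / m P

lemma entropy_eq_neg_relEntropy (h0 : m P ≠ 0) (h1 : m P ≠ ∞)
    (hu : AEMeasurable u (m.restrict P)) (hnorm : ∫⁻ x in P, u x ∂m = m P) :
    entropy P m u = -(relEntropy P m u : EReal) := by
  have hn : ∫⁻ x in P, (-((u x : EReal) * ENNReal.log (u x))).toENNReal ∂m ≤ m P := by
    calc _ ≤ ∫⁻ x in P, 1 ∂m := lintegral_mono fun x => toENNReal_neg_mul_log_le (u x)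
      _ = m P := by simp
  have hnt := (hn.trans_lt h1.lt_top).ne
  have hkl : AEMeasurable (fun x => klENN (u x)) (m.restrict P) :=
    measurable_klENN.comp_aemeasurable hu
  have key : ∫⁻ x in P, ((u x : EReal) * ENNReal.log (u x)).toENNReal ∂m =
      ∫⁻ x in P, klENN (u x) ∂m +
        ∫⁻ x in P, (-((u x : EReal) * ENNReal.log (u x))).toENNReal ∂m := by
    have h2 : ∫⁻ x in P, (((u x : EReal) * ENNReal.log (u x)).toENNReal + 1) ∂m =
        ∫⁻ x in P, (klENN (u x) + u x + (-((u x : EReal) * ENNReal.log (u x))).toENNReal) ∂m :=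
      lintegral_congr fun x => toENNReal_mul_log_add_one (u x)
    rw [lintegral_add_right _ measurable_const, lintegral_add_left' (by exact hkl.add hu),
      lintegral_add_left' hkl, hnorm] at h2
    simp only [lintegral_const, Measure.restrict_apply_univ, one_mul] at h2
    rw [add_right_comm] at h2
    exact (ENNReal.add_left_inj h1).1 h2
  unfold entropy extIntegral relEntropy
  rw [key]
  congr 1
  rw [EReal.coe_ennreal_add, ← EReal.coe_ennreal_toReal hnt, EReal.add_sub_cancel_right,
    EReal.div_eq_iff (by simp) (by simpa using h1) (by simpa using h0), ← EReal.coe_ennreal_mul,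
    ENNReal.div_mul_cancel h0 h1]

lemma freeEnergy_eq_top {σ : Measure E} [NormedAddCommGroup E] {T : ℝ}
    (hS : entropy P m u = -(relEntropy P m u : EReal))
    (h : internalEnergy P m σ u = ∞ ∨ relEntropy P m u = ∞) : freeEnergy P m σ T u = ⊤ := by
  unfold freeEnergy
  rw [hS]
  split_ifs with h1
  · rfl
  · have h2 : relEntropy P m u ≠ ∞ := by
      intro h2; apply h1; rw [h2]; simp
    rw [h.resolve_right h2, ← EReal.coe_ennreal_toReal h2, ← EReal.coe_neg, ← EReal.coe_mul,
      EReal.coe_ennreal_top, EReal.top_sub_coe]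

lemma freeEnergy_eq_coe {σ : Measure E} [NormedAddCommGroup E] {T : ℝ}
    (hS : entropy P m u = -(relEntropy P m u : EReal))
    (hU : internalEnergy P m σ u ≠ ∞) (hJ : relEntropy P m u ≠ ∞) :
    freeEnergy P m σ T u =
      (((internalEnergy P m σ u).toReal + T * (relEntropy P m u).toReal : ℝ) : EReal) := by
  unfold freeEnergy
  rw [hS, if_neg, ← EReal.coe_ennreal_toReal hU, ← EReal.coe_ennreal_toReal hJ, ← EReal.coe_neg,
    ← EReal.coe_mul, ← EReal.coe_sub]
  · congr 1; ring
  · rw [← EReal.coe_ennreal_toReal hJ, ← EReal.coe_neg]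
    exact EReal.coe_ne_bot _

/-- Strict convexity of the entropy: if the mean of two functions has no smaller relative entropy
than the mean of the relative entropies, then the functions agree almost everywhere. -/
lemma ae_eq_of_relEntropy_mean_le (h0 : m P ≠ 0) (h1 : m P ≠ ∞)
    (hu : AEMeasurable u (m.restrict P)) (hv : AEMeasurable v (m.restrict P))
    (hut : ∀ᵐ x ∂m.restrict P, u x ≠ ∞) (hvt : ∀ᵐ x ∂m.restrict P, v x ≠ ∞)
    (hJu : relEntropy P m u ≠ ∞) (hJv : relEntropy P m v ≠ ∞)
    (h : relEntropy P m u + relEntropy P m v ≤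
      2 * relEntropy P m (fun x => 2⁻¹ * (u x + v x))) : u =ᵐ[m.restrict P] v := by
  have hint : ∀ {w : E → ℝ≥0∞}, relEntropy P m w ≠ ∞ → ∫⁻ x in P, klENN (w x) ∂m ≠ ∞ := by
    intro w hw hinf
    apply hw
    rw [relEntropy, hinf, ENNReal.top_div_of_ne_top h1]
  have hmu : AEMeasurable (fun x => klENN (u x)) (m.restrict P) :=
    measurable_klENN.comp_aemeasurable hu
  have hmv : AEMeasurable (fun x => klENN (v x)) (m.restrict P) :=
    measurable_klENN.comp_aemeasurable hv
  have hmw : AEMeasurable (fun x => klENN (2⁻¹ * (u x + v x))) (m.restrict P) :=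
    measurable_klENN.comp_aemeasurable ((hu.add hv).const_mul _)
  have hle : ∫⁻ x in P, (klENN (u x) + klENN (v x)) ∂m ≤
      ∫⁻ x in P, 2 * klENN (2⁻¹ * (u x + v x)) ∂m := by
    rw [lintegral_add_left' hmu, lintegral_const_mul'' _ hmw]
    simp only [relEntropy, ← ENNReal.add_div, ← mul_div_assoc] at h
    rwa [ENNReal.div_le_iff h0 h1, ENNReal.div_mul_cancel h0 h1] at h
  have hreal : ∀ a b : ℝ≥0∞, a ≠ ∞ → b ≠ ∞ →
      (2⁻¹ * (a + b)).toReal = (2⁻¹ : ℝ) • a.toReal + (2⁻¹ : ℝ) • b.toReal := by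
    intro a b ha hb
    rw [ENNReal.toReal_mul, ENNReal.toReal_add ha hb]
    simp; ring
  have hpt : ∀ᵐ x ∂m.restrict P, 2 * klENN (2⁻¹ * (u x + v x)) ≤ klENN (u x) + klENN (v x) := by
    filter_upwards [hut, hvt] with x hx hy
    have hc := convexOn_klFun.2 (ENNReal.toReal_nonneg (a := u x))
      (ENNReal.toReal_nonneg (a := v x)) (by norm_num : (0 : ℝ) ≤ 2⁻¹) (by norm_num : (0 : ℝ) ≤ 2⁻¹)
      (by norm_num)
    have hw : 2⁻¹ * (u x + v x) ≠ ∞ := by finiteness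
    rw [klENN_of_ne_top hx, klENN_of_ne_top hy, klENN_of_ne_top hw, hreal _ _ hx hy,
      ← ENNReal.ofReal_add (klFun_nonneg ENNReal.toReal_nonneg)
      (klFun_nonneg ENNReal.toReal_nonneg), ← ENNReal.ofReal_ofNat,
      ← ENNReal.ofReal_mul (by norm_num)]
    refine ENNReal.ofReal_le_ofReal ?_
    simp only [smul_eq_mul] at hc ⊢
    linarith
  have hfin : ∫⁻ x in P, 2 * klENN (2⁻¹ * (u x + v x)) ∂m ≠ ∞ := by
    refine ((lintegral_mono_ae hpt).trans_lt ?_).ne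
    rw [lintegral_add_left' hmu]
    exact ENNReal.add_lt_top.2 ⟨(hint hJu).lt_top, (hint hJv).lt_top⟩
  have hae := ae_eq_of_ae_le_of_lintegral_le hpt hfin (hmu.add hmv) hle
  filter_upwards [hae, hut, hvt] with x hxe hx hy
  by_contra hne
  have hne' : (u x).toReal ≠ (v x).toReal := fun h' =>
    hne ((ENNReal.toReal_eq_toReal_iff' hx hy).1 h')
  have hc := strictConvexOn_klFun.2 (ENNReal.toReal_nonneg (a := u x))
    (ENNReal.toReal_nonneg (a := v x)) hne' (by norm_num : (0 : ℝ) < 2⁻¹)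
    (by norm_num : (0 : ℝ) < 2⁻¹)
    (by norm_num)
  have hw : 2⁻¹ * (u x + v x) ≠ ∞ := by finiteness
  rw [klENN_of_ne_top hx, klENN_of_ne_top hy, klENN_of_ne_top hw, hreal _ _ hx hy,
    ← ENNReal.ofReal_add (klFun_nonneg ENNReal.toReal_nonneg)
    (klFun_nonneg ENNReal.toReal_nonneg), ← ENNReal.ofReal_ofNat,
    ← ENNReal.ofReal_mul (by norm_num)] at hxe
  rw [ENNReal.ofReal_eq_ofReal_iff] at hxe
  · simp only [smul_eq_mul] at hc hxe
    linarith
  · exact mul_nonneg (by norm_num) (klFun_nonneg (by positivity))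
  · exact add_nonneg (klFun_nonneg ENNReal.toReal_nonneg) (klFun_nonneg ENNReal.toReal_nonneg)

end Entropy

/-! ### Growth of powers and of the entropy integrand -/

section Growth

/-- A lower power is bounded by a constant plus a small multiple of a higher power. -/
lemma exists_rpow_le_add {a q : ℝ} (ha : 0 < a) (haq : a < q) {ε : ℝ≥0∞} (hε : ε ≠ 0) :
    ∃ N : ℝ≥0∞, N ≠ ∞ ∧ ∀ y : ℝ≥0∞, y ^ a ≤ N + ε * y ^ q := by
  have hq : 0 < q := ha.trans haq
  obtain ⟨δ, hδ0, hδε⟩ := ENNReal.lt_iff_exists_nnreal_btwn.1 (pos_iff_ne_zero.2 hε)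
  have hδ : 0 < (δ : ℝ) := by simpa using hδ0
  -- beyond `K` the quotient `y ^ (a - q)` of the two powers is at most `δ`
  set K : ℝ := (δ : ℝ) ^ (1 / (a - q)) with hK
  have hKpos : 0 < K := Real.rpow_pos_of_pos hδ _
  have hne : a - q ≠ 0 := by linarith
  have hKpow : K ^ (a - q) = δ := by
    rw [hK, ← Real.rpow_mul hδ.le, one_div_mul_cancel hne, Real.rpow_one]
  refine ⟨ENNReal.ofReal (K ^ a), ENNReal.ofReal_ne_top, fun y => ?_⟩
  induction y with
  | top => simp [ENNReal.top_rpow_of_pos, hq, hε]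
  | coe y =>
    rcases le_total (y : ℝ) K with h | h
    · refine le_add_right ?_
      rw [← ENNReal.ofReal_coe_nnreal, ENNReal.ofReal_rpow_of_nonneg y.coe_nonneg ha.le]
      exact ENNReal.ofReal_le_ofReal (Real.rpow_le_rpow y.coe_nonneg h ha.le)
    · refine le_add_left (le_trans ?_ (mul_le_mul_left hδε.le _))
      have hy : 0 < (y : ℝ) := hKpos.trans_le h
      rw [← ENNReal.ofReal_coe_nnreal, ← ENNReal.ofReal_coe_nnreal,
        ENNReal.ofReal_rpow_of_nonneg y.coe_nonneg ha.le,
        ENNReal.ofReal_rpow_of_nonneg y.coe_nonneg hq.le,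
        ← ENNReal.ofReal_mul hδ.le]
      refine ENNReal.ofReal_le_ofReal ?_
      calc (y : ℝ) ^ a = (y : ℝ) ^ (a - q) * (y : ℝ) ^ q := by
            rw [← Real.rpow_add hy]; congr 1; ring
        _ ≤ δ * (y : ℝ) ^ q := by
            gcongr
            rw [← hKpow]
            exact Real.rpow_le_rpow_of_nonpos hKpos h (by linarith)

/-- The bound `log y ≤ log L + (y / L) ^ (q - 1) / (q - 1)` applied to the entropy integrand, with
a free parameter `L`. -/
lemma klENN_le {q : ℝ} (hq : 1 < q) {L : ℝ} (hL : 1 ≤ L) (y : ℝ≥0∞) :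
    klENN y ≤ 1 + ENNReal.ofReal (Real.log L) * y +
      ENNReal.ofReal (((q - 1) * L ^ (q - 1))⁻¹) * y ^ q := by
  have hL0 : 0 < L := by linarith
  have hq1 : 0 < q - 1 := by linarith
  have hc : 0 < ((q - 1) * L ^ (q - 1))⁻¹ := by positivity
  induction y with
  | top =>
    have : ENNReal.ofReal (((q - 1) * L ^ (q - 1))⁻¹) * (∞ : ℝ≥0∞) ^ q = ∞ := by
      rw [ENNReal.top_rpow_of_pos (by linarith), ENNReal.mul_top]
      exact (ENNReal.ofReal_pos.2 hc).ne'
    rw [this]; simp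
  | coe y =>
    rw [klENN_of_ne_top ENNReal.coe_ne_top, ENNReal.coe_toReal,
      ← ENNReal.ofReal_coe_nnreal (p := y),
      ENNReal.ofReal_rpow_of_nonneg y.coe_nonneg (by linarith), ← ENNReal.ofReal_one,
      ← ENNReal.ofReal_mul (Real.log_nonneg hL), ← ENNReal.ofReal_mul hc.le,
      ← ENNReal.ofReal_add (by norm_num) (mul_nonneg (Real.log_nonneg hL) y.coe_nonneg),
      ← ENNReal.ofReal_add (add_nonneg (by norm_num) (mul_nonneg (Real.log_nonneg hL) y.coe_nonneg))
        (by have := y.coe_nonneg; positivity)]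
    refine ENNReal.ofReal_le_ofReal ?_
    have hy0 : (0 : ℝ) ≤ y := y.coe_nonneg
    rw [klFun_apply]
    rcases hy0.eq_or_lt with h | h
    · rw [← h]
      simp [Real.zero_rpow (by linarith : q ≠ 0)]
    · have hlog : Real.log y ≤ Real.log L + (y / L : ℝ) ^ (q - 1) / (q - 1) := by
        have := Real.log_le_rpow_div (by positivity : 0 ≤ (y / L : ℝ)) hq1
        rw [Real.log_div h.ne' hL0.ne'] at this
        linarith
      have h2 : (y : ℝ) * ((y / L : ℝ) ^ (q - 1) / (q - 1)) =
          ((q - 1) * L ^ (q - 1))⁻¹ * (y : ℝ) ^ q := by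
        rw [Real.div_rpow hy0 hL0.le, show (y : ℝ) ^ q = y * (y : ℝ) ^ (q - 1) by
          conv_rhs => rw [mul_comm, ← Real.rpow_add_one h.ne', sub_add_cancel]]
        field_simp
      have h3 := mul_le_mul_of_nonneg_left hlog hy0
      rw [mul_add, h2] at h3
      linarith

lemma exists_klENN_le_add {q : ℝ} (hq : 1 < q) {ε : ℝ≥0∞} (hε : ε ≠ 0) :
    ∃ N : ℝ≥0∞, N ≠ ∞ ∧ ∀ y : ℝ≥0∞, klENN y ≤ N + ε * y ^ q := by
  have h1 : 1 < (1 + q) / 2 := by linarith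
  set c : ℝ≥0∞ := ENNReal.ofReal ((((1 + q) / 2 - 1) * 1 ^ ((1 + q) / 2 - 1))⁻¹)
  have hct : c + 1 ≠ ∞ := by finiteness
  obtain ⟨N, hN, h⟩ := exists_rpow_le_add (a := (1 + q) / 2) (q := q) (by linarith) (by linarith)
    (ε := ε / (c + 1)) (ENNReal.div_ne_zero.2 ⟨hε, hct⟩)
  refine ⟨1 + (c + 1) * N, by finiteness, fun y => ?_⟩
  calc klENN y ≤ 1 + ENNReal.ofReal (Real.log 1) * y + c * y ^ ((1 + q) / 2) := klENN_le h1 le_rfl y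
    _ ≤ 1 + (c + 1) * (N + ε / (c + 1) * y ^ q) := by
        simp only [Real.log_one, ENNReal.ofReal_zero, zero_mul, add_zero]
        gcongr
        · exact le_self_add
        · exact h y
    _ = 1 + (c + 1) * N + ε * y ^ q := by
        rw [mul_add, ← mul_assoc (c + 1), ENNReal.mul_div_cancel (by simp) hct, add_assoc]

/-- A version of Vitali's convergence theorem: pointwise convergence together with uniformly small
integrals of the excess over large constants. -/
lemma tendsto_lintegral_of_excess {X : Type*} [MeasurableSpace X] {ν : Measure X}
    [IsFiniteMeasure ν] {f : ℕ → X → ℝ≥0∞} {g : X → ℝ≥0∞} (hf : ∀ i, AEMeasurable (f i) ν)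
    (hlim : ∀ᵐ x ∂ν, Tendsto (fun i => f i x) atTop (𝓝 (g x)))
    (hexc : ∀ ε : ℝ≥0∞, ε ≠ 0 → ∃ N : ℝ≥0∞, N ≠ ∞ ∧ ∀ i, ∫⁻ x, (f i x - N) ∂ν ≤ ε) :
    Tendsto (fun i => ∫⁻ x, f i x ∂ν) atTop (𝓝 (∫⁻ x, g x ∂ν)) := by
  refine tendsto_of_le_liminf_of_limsup_le ?_ ?_
  · calc ∫⁻ x, g x ∂ν = ∫⁻ x, liminf (fun i => f i x) atTop ∂ν :=
        lintegral_congr_ae (hlim.mono fun x hx => hx.liminf_eq.symm)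
      _ ≤ _ := lintegral_liminf_le' hf
  · refine ENNReal.le_of_forall_pos_le_add fun ε hε _ => ?_
    obtain ⟨N, hN, hle⟩ := hexc ε (by simpa using hε.ne')
    have hdom : Tendsto (fun i => ∫⁻ x, min (f i x) N ∂ν) atTop (𝓝 (∫⁻ x, min (g x) N ∂ν)) := by
      refine tendsto_lintegral_of_dominated_convergence' (fun _ => N)
        (fun i => (hf i).min aemeasurable_const) (fun i => ae_of_all _ fun x => min_le_right _ _)
        ?_ ?_
      · rw [lintegral_const]
        exact ENNReal.mul_ne_top hN (measure_ne_top _ _)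
      · filter_upwards [hlim] with x hx
        exact hx.min tendsto_const_nhds
    have hbd : ∀ i, ∫⁻ x, f i x ∂ν ≤ ∫⁻ x, min (f i x) N ∂ν + ε := by
      intro i
      calc ∫⁻ x, f i x ∂ν ≤ ∫⁻ x, (min (f i x) N + (f i x - N)) ∂ν := by
            refine lintegral_mono fun x => ?_
            rcases le_total (f i x) N with h | h
            · simp [h]
            · simp [h, add_tsub_cancel_of_le h]
        _ = ∫⁻ x, min (f i x) N ∂ν + ∫⁻ x, (f i x - N) ∂ν :=
            lintegral_add_left' ((hf i).min aemeasurable_const) _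
        _ ≤ _ := by gcongr; exact hle i
    calc limsup (fun i => ∫⁻ x, f i x ∂ν) atTop
        ≤ limsup (fun i => ∫⁻ x, min (f i x) N ∂ν + ε) atTop :=
          limsup_le_limsup (Eventually.of_forall hbd)
      _ = ∫⁻ x, min (g x) N ∂ν + ε := (hdom.add_const _).limsup_eq
      _ ≤ _ := by gcongr; exact min_le_left _ _

end Growth

/-! ### Lower semi-continuous log-convex functions and states -/

section States

variable {E : Type*} [NormedAddCommGroup E] [NormedSpace ℝ E]

/-- A state up to normalization: a positive lower semi-continuous log-convex function on `P`, finite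
in the interior. -/
structure IsUnnormalizedState (P : Set E) (u : E → ℝ≥0∞) : Prop where
  pos : ∀ x ∈ P, 0 < u x
  finite : ∀ x ∈ interior P, u x < ∞
  lsc : LowerSemicontinuousOn u P
  logConvex : IsLogConvexOn P u

variable {P : Set E} {u v : E → ℝ≥0∞}

lemma IsUnnormalizedState.continuousOn [FiniteDimensional ℝ E] (hu : IsUnnormalizedState P u)
    (hP : Convex ℝ P) : ContinuousOn u (interior P) :=
  hu.logConvex.continuousOn_interior hP (fun x hx => hu.pos x (interior_subset hx)) hu.finite

/-- The regularization of a log-convex function which is positive and finite in the interior. -/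
lemma isUnnormalizedState_regularize [FiniteDimensional ℝ E] (hP : Convex ℝ P) {x₀ : E}
    (hx₀ : x₀ ∈ interior P) (hu : IsLogConvexOn (interior P) u) (h0 : ∀ x ∈ interior P, 0 < u x)
    (h1 : ∀ x ∈ interior P, u x < ∞) :
    IsUnnormalizedState P (regularize x₀ u) ∧ ∀ x ∈ interior P, regularize x₀ u x = u x := by
  have hcont : ContinuousOn u (interior P) := by
    have := IsLogConvexOn.continuousOn_interior (P := interior P) (u := u) hu hP.interior
    rw [interior_interior] at this
    exact this h0 h1
  have heq : ∀ x ∈ interior P, regularize x₀ u x = u x := by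
    intro x hx
    refine IsLogConvexOn.regularize_eq hP.interior hu (by rwa [interior_interior]) (h0 _ hx₀)
      (h1 _ hx₀) hx ?_
    exact hcont.lowerSemicontinuousOn x hx
  refine ⟨⟨fun x hx => ?_, fun x hx => by rw [heq x hx]; exact h1 x hx,
    lowerSemicontinuousOn_regularize hP hx₀ (h0 _ hx₀) (h1 _ hx₀) hcont,
    isLogConvexOn_regularize hP hx₀ hu⟩, heq⟩
  have ht : (1 / 2 : ℝ) ∈ Ioo (0 : ℝ) 1 := by norm_num
  refine lt_of_lt_of_le ?_ (le_iSup (fun t : Ioo (0 : ℝ) 1 => extrapolate x₀ u t x) ⟨1 / 2, ht⟩)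
  have hmid := contract_mem_interior hP hx₀ hx ht
  unfold extrapolate
  refine ENNReal.mul_pos ?_ ?_
  · simp [(h0 _ hx₀).ne', (h1 _ hx₀).ne, ENNReal.rpow_eq_zero_iff]
  · exact (ENNReal.rpow_pos (h0 _ hmid) (h1 _ hmid).ne).ne'

/-- A quantitative Harnack-type bound: a lower bound at one point, well inside `P`, and an upper
bound near that point give a lower bound everywhere. -/
lemma IsLogConvexOn.le_of_extrapolation (hu : IsLogConvexOn P u) {x y : E} {η : ℝ} (hη : 0 < η)
    (hy : y ∈ P) (hz : x + η • (x - y) ∈ P) {M c : ℝ≥0∞} (hM : u (x + η • (x - y)) ≤ M)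
    (hc : c ≤ u x) :
    (c * (M ^ (1 / (1 + η)))⁻¹) ^ ((1 + η) / η) ≤ u y := by
  have h1 := hu _ hz y hy (η / (1 + η))
    ⟨by positivity, by rw [div_le_one (by positivity)]; linarith⟩
  have hx : (1 - η / (1 + η)) • (x + η • (x - y)) + (η / (1 + η)) • y = x := by
    have h2 : (1 - η / (1 + η)) • (x + η • (x - y)) + (η / (1 + η)) • y =
      ((1 - η / (1 + η)) * (1 + η)) • x + (η / (1 + η) - (1 - η / (1 + η)) * η) • y := by module
    rw [h2, show (1 - η / (1 + η)) * (1 + η) = 1 by field_simp; ring,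
      show η / (1 + η) - (1 - η / (1 + η)) * η = 0 by field_simp; ring]
    simp
  rw [hx, show 1 - η / (1 + η) = 1 / (1 + η) by field_simp; ring] at h1
  have h2 : c * (M ^ (1 / (1 + η)))⁻¹ ≤ u y ^ (η / (1 + η)) := by
    rw [← div_eq_mul_inv]
    refine ENNReal.div_le_of_le_mul ?_
    rw [mul_comm]
    refine hc.trans (h1.trans ?_)
    gcongr
  calc (c * (M ^ (1 / (1 + η)))⁻¹) ^ ((1 + η) / η)
      ≤ (u y ^ (η / (1 + η))) ^ ((1 + η) / η) := ENNReal.rpow_le_rpow h2 (by positivity)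
    _ = u y := by
        rw [← ENNReal.rpow_mul, show η / (1 + η) * ((1 + η) / η) = 1 by field_simp,
          ENNReal.rpow_one]

lemma IsUnnormalizedState.const_mul (hu : IsUnnormalizedState P u) {c : ℝ≥0∞} (h0 : c ≠ 0)
    (h1 : c ≠ ∞) : IsUnnormalizedState P (fun x => c * u x) where
  pos x hx := ENNReal.mul_pos h0 (hu.pos x hx).ne'
  finite x hx := ENNReal.mul_lt_top h1.lt_top (hu.finite x hx)
  lsc := by
    have := (ENNReal.continuous_const_mul h1).comp_lowerSemicontinuousOn hu.lsc
      (fun a b hab => by dsimp; gcongr)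
    exact this
  logConvex := hu.logConvex.const_mul c

lemma IsUnnormalizedState.add (hu : IsUnnormalizedState P u) (hv : IsUnnormalizedState P v) :
    IsUnnormalizedState P (fun x => u x + v x) where
  pos x hx := (hu.pos x hx).trans_le le_self_add
  finite x hx := ENNReal.add_lt_top.2 ⟨hu.finite x hx, hv.finite x hx⟩
  lsc := hu.lsc.add hv.lsc
  logConvex := hu.logConvex.add hv.logConvex

lemma IsUnnormalizedState.isState [MeasurableSpace E] {m : Measure E}
    (hu : IsUnnormalizedState P u)
    (hm : m P ≠ ∞) (hnorm : ∫⁻ x in P, u x ∂m = m P) : IsState P m 1 u where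
  pos := hu.pos
  lsc := hu.lsc
  logConvex := hu.logConvex
  normalized := hnorm
  integrable := by
    rw [eLpNorm_one_eq_lintegral_enorm]
    simpa [hnorm] using hm.lt_top

lemma aemeasurable_of_lowerSemicontinuousOn {X : Type*} [TopologicalSpace X]
    [MeasurableSpace X] [BorelSpace X] {P : Set X} {u : X → ℝ≥0∞} (m : Measure X) (hP : IsClosed P)
    (hl : LowerSemicontinuousOn u P) : AEMeasurable u (m.restrict P) := by
  have hg := measurable_indicator_of_lowerSemicontinuousOn hP hl
  exact (aemeasurable_indicator_iff hP.measurableSet).1 hg.aemeasurable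

variable [FiniteDimensional ℝ E] [MeasurableSpace E]

/-- A lower semi-continuous log-convex function is determined by its almost everywhere class. -/
lemma IsUnnormalizedState.eqOn_of_ae_eq {m : Measure E} [m.IsAddHaarMeasure] (hP : Convex ℝ P)
    (hne : (interior P).Nonempty) (hu : IsUnnormalizedState P u) (hv : IsUnnormalizedState P v)
    (h : u =ᵐ[m.restrict P] v) : EqOn u v P := by
  have hint : EqOn u v (interior P) :=
    Measure.eqOn_open_of_ae_eq (ae_restrict_of_ae_restrict_of_subset interior_subset h)
      isOpen_interior (hu.continuousOn hP) (hv.continuousOn hP)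
  obtain ⟨x₀, hx₀⟩ := hne
  intro x hx
  have hu0 := hu.pos x₀ (interior_subset hx₀)
  have hv0 := hv.pos x₀ (interior_subset hx₀)
  rw [← hu.logConvex.regularize_eq hP hx₀ hu0 (hu.finite x₀ hx₀) hx (hu.lsc x hx),
    ← hv.logConvex.regularize_eq hP hx₀ hv0 (hv.finite x₀ hx₀) hx (hv.lsc x hx)]
  unfold regularize extrapolate
  rw [hint hx₀]
  congr with t
  rw [hint (contract_mem_interior hP hx₀ hx t.2)]

variable [BorelSpace E]

/-- Sub-mean value inequality for log-convex functions. -/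
lemma IsLogConvexOn.mul_measure_ball_le (m : Measure E) [m.IsAddHaarMeasure] (hP : IsClosed P)
    (hu : IsLogConvexOn P u) (hl : LowerSemicontinuousOn u P) {x : E} {r : ℝ}
    (hr : Metric.ball x r ⊆ P) : u x * m (Metric.ball 0 r) ≤ 2 * ∫⁻ z in P, u z ∂m := by
  have hg := measurable_indicator_of_lowerSemicontinuousOn hP hl
  set g := P.indicator u with hgdef
  calc u x * m (Metric.ball 0 r) = ∫⁻ _z in Metric.ball 0 r, u x ∂m := by rw [setLIntegral_const]
    _ ≤ ∫⁻ z in Metric.ball 0 r, (g (x + z) + g (x - z)) ∂m := by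
        refine setLIntegral_mono' Metric.isOpen_ball.measurableSet fun z hz => ?_
        rw [mem_ball_zero_iff] at hz
        have h1 : x + z ∈ P := hr (by simpa [mem_ball_iff_norm] using hz)
        have h2 : x - z ∈ P := hr (by simpa [mem_ball_iff_norm] using hz)
        have h3 := hu.le_max h1 h2 (t := 1 / 2) (by norm_num)
        rw [show (1 - 1 / 2 : ℝ) • (x + z) + (1 / 2 : ℝ) • (x - z) = x by module] at h3
        rw [hgdef, indicator_of_mem h1, indicator_of_mem h2]
        exact h3.trans (max_le le_self_add le_add_self)
    _ ≤ ∫⁻ z, (g (x + z) + g (x - z)) ∂m := setLIntegral_le_lintegral _ _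
    _ = 2 * ∫⁻ z in P, u z ∂m := by
        rw [lintegral_add_left (by exact hg.comp (measurable_const_add x)),
          lintegral_add_left_eq_self,
          lintegral_sub_left_eq_self, hgdef, lintegral_indicator hP.measurableSet, two_mul]

lemma IsLogConvexOn.lt_top_of_mem_interior (m : Measure E) [m.IsAddHaarMeasure] (hP : IsClosed P)
    (hu : IsLogConvexOn P u) (hl : LowerSemicontinuousOn u P) (hint : ∫⁻ z in P, u z ∂m ≠ ∞)
    {x : E} (hx : x ∈ interior P) : u x < ∞ := by
  obtain ⟨r, hr, hball⟩ := Metric.isOpen_iff.1 isOpen_interior x hx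
  have h := hu.mul_measure_ball_le m hP hl (hball.trans interior_subset)
  have h2 : 2 * ∫⁻ z in P, u z ∂m ≠ ∞ := by finiteness
  by_contra hinf
  rw [not_lt_top_iff.1 hinf, ENNReal.top_mul (Metric.measure_ball_pos m 0 hr).ne'] at h
  exact h2 (top_le_iff.1 h)

lemma IsState.isUnnormalizedState {m : Measure E} [m.IsAddHaarMeasure] {p : ℝ≥0∞}
    (hP : IsCompact P) (hu : IsState P m p u) : IsUnnormalizedState P u where
  pos := hu.pos
  finite x hx := by
    refine IsLogConvexOn.lt_top_of_mem_interior m hP.isClosed hu.logConvex hu.lsc ?_ hx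
    rw [hu.normalized]
    exact hP.measure_lt_top.ne
  lsc := hu.lsc
  logConvex := hu.logConvex

/-- The set of states is convex. -/
lemma IsState.mean {m : Measure E} [m.IsAddHaarMeasure] (hP : IsCompact P)
    (hu : IsState P m 1 u) (hv : IsState P m 1 v) :
    IsState P m 1 (fun x => 2⁻¹ * (u x + v x)) := by
  refine (((hu.isUnnormalizedState hP).add (hv.isUnnormalizedState hP)).const_mul
    (by simp) (by simp)).isState hP.measure_lt_top.ne ?_
  have hmu := aemeasurable_of_lowerSemicontinuousOn m hP.isClosed hu.lsc
  rw [lintegral_const_mul' _ _ (by simp), lintegral_add_left' hmu, hu.normalized, hv.normalized,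
    ← two_mul, ← mul_assoc, ENNReal.inv_mul_cancel (by simp) (by simp), one_mul]

/-- States with bounded `L^q` norm, `q > 1`, are bounded below by a common positive constant: their
mass cannot escape to the boundary, so that they are somewhere at least `1/2` well inside `P`. -/
lemma exists_uniform_lower_bound (m : Measure E) [m.IsAddHaarMeasure] (hP : IsCompact P)
    (hconv : Convex ℝ P) (hne : (interior P).Nonempty) {q : ℝ} (hq : 1 < q) {B : ℝ≥0∞}
    (hB : B ≠ ∞) : ∃ c : ℝ≥0∞, c ≠ 0 ∧ c ≠ ∞ ∧ ∀ u : E → ℝ≥0∞, IsState P m 1 u →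
      ∫⁻ x in P, u x ^ q ∂m ≤ B → ∀ y ∈ P, c ≤ u y := by
  have hmP : m P ≠ ∞ := hP.measure_lt_top.ne
  have hmP0 : 0 < m P := (isOpen_interior.measure_pos m hne).trans_le (measure_mono interior_subset)
  have hmint : m (interior P) = m P := by
    refine le_antisymm (measure_mono interior_subset) ?_
    calc m P ≤ m (interior P ∪ frontier P) := measure_mono (by
          rw [← closure_eq_interior_union_frontier]; exact subset_closure)
      _ ≤ m (interior P) + m (frontier P) := measure_union_le _ _
      _ = m (interior P) := by rw [hconv.addHaar_frontier m, add_zero]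
  -- `K` is so large that the mass of each admissible `u` on `P \ K` is at most `m P / 4`
  have hε : m P / 8 / (B + 1) ≠ 0 := by
    simp only [ne_eq, ENNReal.div_eq_zero_iff, hmP0.ne', false_or]
    simp [hB]
  obtain ⟨N, hN, hpow⟩ := exists_rpow_le_add zero_lt_one hq hε
  simp only [ENNReal.rpow_one] at hpow
  obtain ⟨K, hKP, hK, hKm⟩ : ∃ K ⊆ interior P, IsCompact K ∧
      m P - m P / 8 / (N + 1) < m K := by
    refine isOpen_interior.exists_lt_isCompact ?_
    rw [hmint]
    refine ENNReal.sub_lt_self hmP hmP0.ne' ?_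
    simp only [ne_eq, ENNReal.div_eq_zero_iff, hmP0.ne', false_or]
    simp [hN]
  have hsmall : m (P \ K) ≤ m P / 8 / (N + 1) := by
    rw [measure_sdiff (hKP.trans interior_subset) hK.measurableSet.nullMeasurableSet
      hK.measure_lt_top.ne]
    rw [tsub_le_iff_right]
    have := hKm.le
    rw [tsub_le_iff_right] at this
    rwa [add_comm]
  have hdiv : ∀ a : ℝ≥0∞, a ≠ ∞ → m P / 8 / (a + 1) * a ≤ m P / 8 := by
    intro a ha
    calc m P / 8 / (a + 1) * a ≤ m P / 8 / (a + 1) * (a + 1) := by gcongr; exact le_self_add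
      _ = m P / 8 := ENNReal.div_mul_cancel (by simp) (by finiteness)
  obtain ⟨ρ, hρ, hthick⟩ := hK.exists_thickening_subset_open isOpen_interior hKP
  obtain ⟨D, hD⟩ := hP.isBounded.exists_norm_le
  obtain ⟨x₀, hx₀⟩ := hne
  have hD0 : 0 ≤ D := (norm_nonneg _).trans (hD x₀ (interior_subset hx₀))
  set η : ℝ := ρ / 2 / (2 * D + 1) with hη
  have hηpos : 0 < η := by positivity
  set M : ℝ≥0∞ := 2 * m P / m (Metric.ball 0 (ρ / 2)) with hM
  have hball0 : m (Metric.ball 0 (ρ / 2)) ≠ 0 := (Metric.measure_ball_pos m 0 (by positivity)).ne'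
  have hballt : m (Metric.ball 0 (ρ / 2)) ≠ ∞ := measure_ball_lt_top.ne
  have hM0 : M ≠ 0 := by
    refine ENNReal.div_ne_zero.2 ⟨mul_ne_zero (by simp) hmP0.ne', hballt⟩
  have hMt : M ≠ ∞ := ENNReal.div_ne_top (by finiteness) hball0
  have hMr0 : M ^ (1 / (1 + η)) ≠ 0 := (ENNReal.rpow_pos (pos_iff_ne_zero.2 hM0) hMt).ne'
  have hMrt : M ^ (1 / (1 + η)) ≠ ∞ := ENNReal.rpow_ne_top_of_nonneg (by positivity) hMt
  refine ⟨(2⁻¹ * (M ^ (1 / (1 + η)))⁻¹) ^ ((1 + η) / η), ?_, ?_, fun u hu hub y hy => ?_⟩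
  · refine (ENNReal.rpow_pos (ENNReal.mul_pos (by simp) (ENNReal.inv_ne_zero.2 hMrt)) ?_).ne'
    exact ENNReal.mul_ne_top (by simp) (ENNReal.inv_ne_top.2 hMr0)
  · exact ENNReal.rpow_ne_top_of_nonneg (by positivity)
      (ENNReal.mul_ne_top (by simp) (ENNReal.inv_ne_top.2 hMr0))
  -- otherwise the mass of `u` would be at most `m P / 2 + m P / 4`
  obtain ⟨x, hxK, hx⟩ : ∃ x ∈ K, 2⁻¹ ≤ u x := by
    by_contra! hlt
    have h1 : ∫⁻ x in K, u x ∂m ≤ m P / 2 := by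
      calc ∫⁻ x in K, u x ∂m ≤ ∫⁻ x in K, 2⁻¹ ∂m :=
            setLIntegral_mono' hK.measurableSet fun x hx => (hlt x hx).le
        _ = 2⁻¹ * m K := setLIntegral_const _ _
        _ ≤ 2⁻¹ * m P := by gcongr; exact hKP.trans interior_subset
        _ = m P / 2 := by rw [mul_comm, div_eq_mul_inv]
    have h2 : ∫⁻ x in P \ K, u x ∂m ≤ m P / 8 + m P / 8 := by
      calc ∫⁻ x in P \ K, u x ∂m
          ≤ ∫⁻ x in P \ K, (N + m P / 8 / (B + 1) * u x ^ q) ∂m := lintegral_mono fun x => hpow _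
        _ = N * m (P \ K) + m P / 8 / (B + 1) * ∫⁻ x in P \ K, u x ^ q ∂m := by
            rw [lintegral_add_left measurable_const, setLIntegral_const, lintegral_const_mul' _ _
              (ENNReal.div_ne_top (by finiteness) (by simp))]
        _ ≤ N * (m P / 8 / (N + 1)) + m P / 8 / (B + 1) * B := by
            gcongr
            exact (lintegral_mono_set sdiff_subset).trans hub
        _ ≤ m P / 8 + m P / 8 := by
            rw [mul_comm N]
            exact add_le_add (hdiv N hN) (hdiv B hB)
    have h3 : m P ≤ m P / 2 + (m P / 8 + m P / 8) := by
      calc m P = ∫⁻ x in P, u x ∂m := hu.normalized.symm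
        _ ≤ ∫⁻ x in K ∪ P \ K, u x ∂m := lintegral_mono_set (by
            intro z hz; by_cases hzK : z ∈ K
            · exact Or.inl hzK
            · exact Or.inr ⟨hz, hzK⟩)
        _ ≤ ∫⁻ x in K, u x ∂m + ∫⁻ x in P \ K, u x ∂m := lintegral_union_le _ _ _
        _ ≤ _ := add_le_add h1 h2
    have h4 := ENNReal.toReal_mono (by finiteness) h3
    have h5 : 0 < (m P).toReal := ENNReal.toReal_pos hmP0.ne' hmP
    rw [ENNReal.toReal_add (by finiteness) (by finiteness),
      ENNReal.toReal_add (by finiteness) (by finiteness), ENNReal.toReal_div,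
      ENNReal.toReal_div] at h4
    simp only [ENNReal.toReal_ofNat] at h4
    linarith
  have hball : Metric.ball (x + η • (x - y)) (ρ / 2) ⊆ P := by
    refine Subset.trans ?_ ((Metric.ball_subset_thickening hxK ρ).trans
      (hthick.trans interior_subset))
    intro w hw
    rw [mem_ball_iff_norm] at hw ⊢
    have hxP := hKP.trans interior_subset hxK
    have h1 : ‖η • (x - y)‖ ≤ ρ / 2 := by
      rw [norm_smul, Real.norm_of_nonneg hηpos.le]
      calc η * ‖x - y‖ ≤ η * (2 * D + 1) := by
            gcongr
            have := norm_sub_le x y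
            have := hD x hxP
            have := hD y hy
            linarith
        _ = ρ / 2 := by rw [hη]; field_simp
    calc ‖w - x‖ = ‖(w - (x + η • (x - y))) + η • (x - y)‖ := by congr 1; abel
      _ ≤ ‖w - (x + η • (x - y))‖ + ‖η • (x - y)‖ := norm_add_le _ _
      _ < ρ := by linarith
  have hzM : u (x + η • (x - y)) ≤ M := by
    rw [hM, ENNReal.le_div_iff_mul_le (Or.inl hball0) (Or.inl hballt), ← hu.normalized]
    exact IsLogConvexOn.mul_measure_ball_le m hP.isClosed hu.logConvex hu.lsc hball
  exact IsLogConvexOn.le_of_extrapolation hu.logConvex hηpos hy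
    (hball (Metric.mem_ball_self (by positivity))) hzM hx

end States

/-! ### Compactness of the space of states -/

section Compactness

variable {E : Type*} [NormedAddCommGroup E] [NormedSpace ℝ E]

/-- Convex functions which are uniformly bounded near `x` and converge on a dense set converge
at `x`: they are equi-Lipschitz near `x`. -/
lemma cauchySeq_of_convexOn_of_dense {f : ℕ → E → ℝ} {x : E} {r Λ : ℝ} (hr : 0 < r)
    (hf : ∀ i, ConvexOn ℝ (Metric.ball x r) (f i))
    (hΛ : ∀ i, ∀ y ∈ Metric.ball x r, |f i y| ≤ Λ)
    (hd : ∀ δ > 0, ∃ y ∈ Metric.ball x δ, CauchySeq fun i => f i y) :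
    CauchySeq fun i => f i x := by
  have hlip : ∀ i, LipschitzOnWith (2 * Λ / (r / 2)).toNNReal (f i) (Metric.ball x (r - r / 2)) :=
    fun i => (hf i).lipschitzOnWith_of_abs_le (by positivity) fun a ha => hΛ i a ha
  set K : ℝ≥0 := (2 * Λ / (r / 2)).toNNReal
  rw [Metric.cauchySeq_iff']
  intro ε hε
  have hδ : 0 < min (r / 2) (ε / (3 * (K + 1))) := by positivity
  obtain ⟨y, hy, hcy⟩ := hd _ hδ
  obtain ⟨N, hN⟩ := Metric.cauchySeq_iff'.1 hcy (ε / 3) (by positivity)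
  have hyr : y ∈ Metric.ball x (r - r / 2) := by
    rw [Metric.mem_ball] at hy ⊢
    have := hy.trans_le (min_le_left _ _)
    linarith
  have hxr : x ∈ Metric.ball x (r - r / 2) := Metric.mem_ball_self (by linarith)
  have hxy : ∀ i, dist (f i x) (f i y) ≤ ε / 3 := by
    intro i
    calc dist (f i x) (f i y) ≤ K * dist x y := (hlip i).dist_le_mul x hxr y hyr
      _ ≤ K * (ε / (3 * (K + 1))) := by
          gcongr
          rw [dist_comm]
          exact (Metric.mem_ball.1 hy).le.trans (min_le_right _ _)
      _ ≤ (K + 1) * (ε / (3 * (K + 1))) := by gcongr; linarith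
      _ = ε / 3 := by field_simp
  refine ⟨N, fun n hn => ?_⟩
  have h1 := dist_triangle4 (f n x) (f n y) (f N y) (f N x)
  have h2 := hxy n
  have h3 := hxy N
  rw [dist_comm] at h3
  have h4 := hN n hn
  linarith

variable [FiniteDimensional ℝ E] [MeasurableSpace E] [BorelSpace E] {P : Set E}

/-- States with a common positive lower bound have a subsequence converging at all interior
points. -/
lemma exists_subseq_tendsto_interior (m : Measure E) [m.IsAddHaarMeasure] (hP : IsCompact P)
    (hne : (interior P).Nonempty) {u : ℕ → E → ℝ≥0∞}
    (hu : ∀ i, IsState P m 1 (u i)) {c : ℝ≥0∞} (hc0 : c ≠ 0)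
    (hcu : ∀ i, ∀ y ∈ P, c ≤ u i y) :
    ∃ φ : ℕ → ℕ, StrictMono φ ∧ ∀ x ∈ interior P, ∃ a : ℝ≥0∞, a ≠ 0 ∧ a ≠ ∞ ∧
      Tendsto (fun i => u (φ i) x) atTop (𝓝 a) := by
  have : Nonempty (interior P) := hne.to_subtype
  let d : ℕ → interior P := TopologicalSpace.denseSeq (interior P)
  obtain ⟨a, φ, hφ, ha⟩ := CompactSpace.tendsto_subseq (fun i k => u i (d k))
  rw [tendsto_pi_nhds] at ha
  refine ⟨φ, hφ, fun x hx => ?_⟩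
  have hU := fun i => (hu i).isUnnormalizedState hP
  obtain ⟨r, hr, hball⟩ := Metric.isOpen_iff.1 isOpen_interior x hx
  -- uniform bounds near `x`
  set M : ℝ≥0∞ := 2 * m P / m (Metric.ball 0 (r / 2)) with hM
  have hball0 : m (Metric.ball 0 (r / 2)) ≠ 0 := (Metric.measure_ball_pos m 0 (by positivity)).ne'
  have hballt : m (Metric.ball 0 (r / 2)) ≠ ∞ := measure_ball_lt_top.ne
  have hmP : m P ≠ ∞ := hP.measure_lt_top.ne
  have hMt : M ≠ ∞ := ENNReal.div_ne_top (by finiteness) hball0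
  have hsub : Metric.ball x (r / 2) ⊆ interior P :=
    (Metric.ball_subset_ball (by linarith)).trans hball
  have huM : ∀ i, ∀ y ∈ Metric.ball x (r / 2), u i y ≤ M := by
    intro i y hy
    rw [hM, ENNReal.le_div_iff_mul_le (Or.inl hball0) (Or.inl hballt), ← (hu i).normalized]
    refine IsLogConvexOn.mul_measure_ball_le m hP.isClosed (hu i).logConvex (hu i).lsc
      (Subset.trans ?_ (hball.trans interior_subset))
    refine Metric.ball_subset_ball' ?_
    have := Metric.mem_ball.1 hy
    linarith
  have hcx : c ≤ M := (hcu 0 x (interior_subset hx)).trans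
    (huM 0 x (Metric.mem_ball_self (by positivity)))
  have hct : c ≠ ∞ := ne_top_of_le_ne_top hMt hcx
  have hlogc : ∀ i, ∀ y ∈ Metric.ball x (r / 2), Real.log (u i y).toReal ∈
      Icc (Real.log c.toReal) (Real.log M.toReal) := by
    intro i y hy
    have hyt : u i y ≠ ∞ := ne_top_of_le_ne_top hMt (huM i y hy)
    have hcy := hcu i y (interior_subset (hsub hy))
    have h1 := ENNReal.toReal_mono hyt hcy
    have h2 := ENNReal.toReal_mono hMt (huM i y hy)
    have h3 := ENNReal.toReal_pos hc0 hct
    exact ⟨Real.log_le_log h3 h1, Real.log_le_log (h3.trans_le h1) h2⟩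
  have hcauchy : CauchySeq fun i => Real.log (u (φ i) x).toReal := by
    refine cauchySeq_of_convexOn_of_dense (f := fun i y => Real.log (u (φ i) y).toReal)
      (r := r / 2) (Λ := max |Real.log c.toReal| |Real.log M.toReal|) (by positivity)
      (fun i => ?_) (fun i y hy => ?_) (fun δ hδ => ?_)
    · exact ((hU _).logConvex.mono (hsub.trans interior_subset)).convexOn_log (convex_ball _ _)
        (fun y hy => (hU _).pos y (interior_subset (hsub hy)))
        (fun y hy => (hU _).finite y (hsub hy))
    · exact abs_le_max_abs_abs (hlogc _ y hy).1 (hlogc _ y hy).2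
    · have hopen : IsOpen {z : interior P | (z : E) ∈ Metric.ball x (min δ (r / 2))} :=
        Metric.isOpen_ball.preimage continuous_subtype_val
      obtain ⟨k, hk⟩ := (TopologicalSpace.denseRange_denseSeq (interior P)).exists_mem_open hopen
        ⟨⟨x, hx⟩, Metric.mem_ball_self (by positivity)⟩
      have hk1 : (d k : E) ∈ Metric.ball x δ := Metric.ball_subset_ball (min_le_left _ _) hk
      have hk2 : (d k : E) ∈ Metric.ball x (r / 2) := Metric.ball_subset_ball (min_le_right _ _) hk
      refine ⟨d k, hk1, ?_⟩
      have hak := ha k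
      have h1 : c ≤ a k := ge_of_tendsto' hak fun i => hcu _ _ (interior_subset (hsub hk2))
      have h2 : a k ≤ M := le_of_tendsto' hak fun i => huM _ _ hk2
      have h3 : a k ≠ ∞ := ne_top_of_le_ne_top hMt h2
      have h4 : (a k).toReal ≠ 0 :=
        (ENNReal.toReal_pos (ne_bot_of_le_ne_bot hc0 h1) h3).ne'
      exact (((ENNReal.tendsto_toReal h3).comp hak).log h4).cauchySeq
  obtain ⟨l, hl⟩ := cauchySeq_tendsto_of_complete hcauchy
  refine ⟨ENNReal.ofReal (Real.exp l), (ENNReal.ofReal_pos.2 (Real.exp_pos _)).ne',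
    ENNReal.ofReal_ne_top, ?_⟩
  refine ((ENNReal.continuous_ofReal.comp Real.continuous_exp).tendsto l |>.comp hl).congr
    fun i => ?_
  have hpos := (hU (φ i)).pos x (interior_subset hx)
  have hfin := (hU (φ i)).finite x hx
  simp only [Function.comp_apply]
  rw [Real.exp_log (ENNReal.toReal_pos hpos.ne' hfin.ne), ENNReal.ofReal_toReal hfin.ne]

/-- Compactness: a sequence of states that is bounded in `L^q`, `q > 1`, has a subsequence
converging to a state, with convergence of the entropies. At boundary points the limit is only a
lower bound for the lower limit of the sequence. -/
lemma exists_limit_state (m : Measure E) [m.IsAddHaarMeasure] (hP : IsCompact P)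
    (hconv : Convex ℝ P) (hne : (interior P).Nonempty) {q : ℝ} (hq : 1 < q) {B : ℝ≥0∞}
    (hB : B ≠ ∞) {u : ℕ → E → ℝ≥0∞} (hu : ∀ i, IsState P m 1 (u i))
    (huB : ∀ i, ∫⁻ x in P, u i x ^ q ∂m ≤ B) :
    ∃ v : E → ℝ≥0∞, ∃ φ : ℕ → ℕ, StrictMono φ ∧ IsState P m 1 v ∧
      (∀ x ∈ P, v x ≤ liminf (fun i => u (φ i) x) atTop) ∧
      Tendsto (fun i => relEntropy P m (u (φ i))) atTop (𝓝 (relEntropy P m v)) := by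
  obtain ⟨c, hc0, -, hc⟩ := exists_uniform_lower_bound m hP hconv hne hq hB
  obtain ⟨φ, hφ, hlim⟩ := exists_subseq_tendsto_interior m hP hne hu hc0
    (fun i => hc (u i) (hu i) (huB i))
  have hmP : m P ≠ ∞ := hP.measure_lt_top.ne
  have hmP0 : m P ≠ 0 :=
    ((isOpen_interior.measure_pos m hne).trans_le (measure_mono interior_subset)).ne'
  have : IsFiniteMeasure (m.restrict P) := ⟨by simpa using hmP.lt_top⟩
  set w : E → ℝ≥0∞ := fun x => liminf (fun i => u (φ i) x) atTop
  have hwlim : ∀ x ∈ interior P, Tendsto (fun i => u (φ i) x) atTop (𝓝 (w x)) := by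
    intro x hx
    obtain ⟨a, -, -, ha⟩ := hlim x hx
    have hwa : w x = a := ha.liminf_eq
    rwa [hwa]
  have hw0 : ∀ x ∈ interior P, 0 < w x ∧ w x < ∞ := by
    intro x hx
    obtain ⟨a, ha0, hat, ha⟩ := hlim x hx
    rw [tendsto_nhds_unique (hwlim x hx) ha]
    exact ⟨pos_iff_ne_zero.2 ha0, hat.lt_top⟩
  have hwlc : IsLogConvexOn (interior P) w := by
    intro x hx y hy t ht
    have h1 : 0 ≤ 1 - t := by linarith [ht.2]
    have hz : (1 - t) • x + t • y ∈ interior P := hconv.interior hx hy h1 ht.1 (by ring)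
    refine le_of_tendsto_of_tendsto' (hwlim _ hz) (ENNReal.Tendsto.mul
      ((hwlim x hx).ennrpow_const (1 - t)) (Or.inr ?_) ((hwlim y hy).ennrpow_const t) (Or.inr ?_))
      fun i => (hu (φ i)).logConvex x (interior_subset hx) y (interior_subset hy) t ht
    · exact ENNReal.rpow_ne_top_of_nonneg ht.1 (hw0 y hy).2.ne
    · exact ENNReal.rpow_ne_top_of_nonneg h1 (hw0 x hx).2.ne
  obtain ⟨x₀, hx₀⟩ := hne
  obtain ⟨hv, hvw⟩ := isUnnormalizedState_regularize hconv hx₀ hwlc (fun x hx => (hw0 x hx).1)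
    (fun x hx => (hw0 x hx).2)
  set v := regularize x₀ w with hvdef
  have hae : ∀ᵐ x ∂m.restrict P, Tendsto (fun i => u (φ i) x) atTop (𝓝 (v x)) ∧ v x ≠ ∞ := by
    rw [ae_restrict_iff' hP.isClosed.measurableSet]
    have hfr : ∀ᵐ x ∂m, x ∉ frontier P := measure_eq_zero_iff_ae_notMem.1 (hconv.addHaar_frontier m)
    filter_upwards [hfr] with x hx hxP
    have hxi : x ∈ interior P := by
      by_contra hxi
      exact hx ⟨subset_closure hxP, hxi⟩
    rw [hvw x hxi]
    exact ⟨hwlim x hxi, (hw0 x hxi).2.ne⟩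
  have hmeas := fun i => aemeasurable_of_lowerSemicontinuousOn m hP.isClosed (hu (φ i)).lsc
  -- the `L^q` bound makes `Ψ (u i)` uniformly integrable for each `Ψ` growing slower than `y ^ q`
  have htail : ∀ Ψ : ℝ≥0∞ → ℝ≥0∞,
      (∀ ε : ℝ≥0∞, ε ≠ 0 → ∃ N : ℝ≥0∞, N ≠ ∞ ∧ ∀ y, Ψ y ≤ N + ε * y ^ q) →
      ∀ ε : ℝ≥0∞, ε ≠ 0 → ∃ N : ℝ≥0∞, N ≠ ∞ ∧
        ∀ i, ∫⁻ x in P, (Ψ (u (φ i) x) - N) ∂m ≤ ε := by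
    intro Ψ hΨ ε hε
    by_cases hεt : ε = ∞
    · exact ⟨0, by simp, fun i => by simp [hεt]⟩
    obtain ⟨N, hN, h⟩ := hΨ (ε / (B + 1)) (ENNReal.div_ne_zero.2 ⟨hε, by finiteness⟩)
    refine ⟨N, hN, fun i => ?_⟩
    calc ∫⁻ x in P, (Ψ (u (φ i) x) - N) ∂m ≤ ∫⁻ x in P, ε / (B + 1) * u (φ i) x ^ q ∂m :=
          lintegral_mono fun x => tsub_le_iff_left.2 (h _)
      _ = ε / (B + 1) * ∫⁻ x in P, u (φ i) x ^ q ∂m :=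
          lintegral_const_mul' _ _ (ENNReal.div_ne_top hεt (by simp))
      _ ≤ ε / (B + 1) * (B + 1) := by gcongr; exact (huB _).trans le_self_add
      _ = ε := ENNReal.div_mul_cancel (by simp) (by finiteness)
  have hnorm : ∫⁻ x in P, v x ∂m = m P := by
    have h1 := tendsto_lintegral_of_excess hmeas (hae.mono fun x hx => hx.1)
      (htail id fun ε hε => by simpa using exists_rpow_le_add zero_lt_one hq hε)
    refine tendsto_nhds_unique h1 (tendsto_const_nhds.congr fun i => ?_)
    exact (hu (φ i)).normalized.symm
  refine ⟨v, φ, hφ, hv.isState hmP hnorm, fun x hx => iSup_le fun t => ?_, ?_⟩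
  · have ht := contract_mem_interior hconv hx₀ hx t.2
    have h1t : 0 < 1 - (t : ℝ) := by linarith [t.2.2]
    have h1 : Tendsto (fun i => extrapolate x₀ (u (φ i)) t x) atTop (𝓝 (extrapolate x₀ w t x)) := by
      refine ENNReal.Tendsto.mul ((hwlim x₀ hx₀).ennrpow_const _) (Or.inr ?_)
        ((hwlim _ ht).ennrpow_const _) (Or.inr ?_)
      · exact ENNReal.rpow_ne_top_of_nonneg (by positivity) (hw0 _ ht).2.ne
      · exact ENNReal.rpow_ne_top_of_ne_zero (hw0 _ hx₀).1.ne' (hw0 _ hx₀).2.ne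
    rw [← h1.liminf_eq]
    refine liminf_le_liminf (Eventually.of_forall fun i => ?_)
    have hUi := (hu (φ i)).isUnnormalizedState hP
    exact hUi.logConvex.extrapolate_le (interior_subset hx₀) (hUi.pos _ (interior_subset hx₀))
      (hUi.finite _ hx₀) hx t.2
  · have h1 := tendsto_lintegral_of_excess (g := fun x => klENN (v x))
      (fun i => measurable_klENN.comp_aemeasurable (hmeas i))
      (hae.mono fun x hx => (continuousAt_klENN hx.2).tendsto.comp hx.1)
      (htail klENN fun ε hε => exists_klENN_le_add hq hε)
    exact ENNReal.Tendsto.div_const h1 (Or.inr hmP0)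

end Compactness

/-! ### Energy estimates -/

section Energy

variable {E : Type*} [NormedAddCommGroup E] [NormedSpace ℝ E] [MeasurableSpace E]

/-- A polytope presented by its facets, together with a measure that is flat on each facet. -/
structure IsPolytopeSystem (P : Set E) (s : Finset (E →ᵃ[ℝ] ℝ)) (σ : Measure E) : Prop where
  isFacetPresentation : IsFacetPresentation P s
  isCompact : IsCompact P
  interior_nonempty : (interior P).Nonempty
  isFlatOnFacets : IsFlatOnFacets σ P s

lemma IsSimpleSystem.exists_isPolytopeSystem [FiniteDimensional ℝ E] {P : Set E} {μ σ : Measure E}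
    (h : IsSimpleSystem P μ σ) : ∃ (m : Measure E) (s : Finset (E →ᵃ[ℝ] ℝ)),
      m.IsAddHaarMeasure ∧ μ = m.restrict P ∧ IsPolytopeSystem P s σ := by
  obtain ⟨m, hm, rfl⟩ := h.flat.exists_isAddHaarMeasure h.simple.1.2.1
  obtain ⟨s, hs⟩ := h.simple.1.exists_isFacetPresentation
  exact ⟨m, s, hm, rfl, hs, h.simple.1.1, h.simple.1.2.1,
    fun ℓ hℓ => h.flat_boundary.2 _ (hs.isFacet ℓ hℓ)⟩

namespace IsPolytopeSystem

variable {P : Set E} {s : Finset (E →ᵃ[ℝ] ℝ)} {σ : Measure E} (h : IsPolytopeSystem P s σ)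
  (m : Measure E) [m.IsAddHaarMeasure]
include h

lemma convex : Convex ℝ P := h.isFacetPresentation.convex

lemma measure_ne_top : m P ≠ ∞ := h.isCompact.measure_lt_top.ne

lemma measure_ne_zero : m P ≠ 0 := ((isOpen_interior.measure_pos m h.interior_nonempty).trans_le
  (measure_mono interior_subset)).ne'

lemma internalEnergy_ne_top_iff {u : E → ℝ≥0∞} :
    internalEnergy P m σ u ≠ ∞ ↔ ∫⁻ x in frontier P, u x ∂σ ≠ ∞ := by
  have h0 := h.measure_ne_zero m
  have h1 := h.measure_ne_top m
  rw [internalEnergy, ne_eq, ne_eq, not_iff_not, ENNReal.div_eq_top]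
  simp [h0, h1]

lemma integral_eq_mul_internalEnergy (u : E → ℝ≥0∞) :
    ∫⁻ x in frontier P, u x ∂σ = internalEnergy P m σ u * m P :=
  (ENNReal.div_mul_cancel (h.measure_ne_zero m) (h.measure_ne_top m)).symm

variable [FiniteDimensional ℝ E]

lemma isClosed : IsClosed P := h.isFacetPresentation.isClosed

lemma measure_frontier_lt_top : σ (frontier P) < ∞ := by
  rw [h.isFacetPresentation.frontier_eq]
  exact measure_biUnion_lt_top s.finite_toSet fun ℓ hℓ =>
    IsFlatMeasureOn.lt_top (isCompact_facet h.isCompact ℓ) (h.isFlatOnFacets ℓ hℓ)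

/-- The constant function `1` is a state of finite internal energy. -/
lemma isState_one : IsState P m 1 (fun _ => 1) ∧ internalEnergy P m σ (fun _ => 1) ≠ ∞ := by
  refine ⟨IsUnnormalizedState.isState ⟨by simp, by simp, lowerSemicontinuousOn_const, ?_⟩
    (h.measure_ne_top m) (by simp), (h.internalEnergy_ne_top_iff m).2 ?_⟩
  · intro x _ y _ t _; simp
  · simpa using h.measure_frontier_lt_top.ne

variable [BorelSpace E]

/-- The boundary integral controls the `L^q` norm of log-convex functions for some `q > 1`; one may
take `n / (n - 1)` in dimension `n ≥ 2`, and any `q` in dimension one. -/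
lemma exists_exponent (hn : 1 ≤ Module.finrank ℝ E) : ∃ q : ℝ, 1 < q ∧ ∃ C : ℝ≥0∞, C ≠ ∞ ∧
    ∀ u : E → ℝ≥0∞, IsLogConvexOn P u → LowerSemicontinuousOn u P →
      ∫⁻ x in P, u x ^ q ∂m ≤ (C * ∫⁻ z in frontier P, u z ∂σ) ^ q := by
  rcases hn.eq_or_lt with hn | hn
  · obtain ⟨C, hC, hle⟩ := h.isFacetPresentation.exists_le_boundary_integral h.isCompact
      h.isFlatOnFacets hn.symm
    refine ⟨2, by norm_num, C * (m P) ^ (1 / 2 : ℝ), ENNReal.mul_ne_top hC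
      (ENNReal.rpow_ne_top_of_nonneg (by norm_num) (h.measure_ne_top m)), fun u hu _ => ?_⟩
    calc ∫⁻ x in P, u x ^ (2 : ℝ) ∂m
        ≤ ∫⁻ _x in P, (C * ∫⁻ z in frontier P, u z ∂σ) ^ (2 : ℝ) ∂m :=
          setLIntegral_mono' h.isClosed.measurableSet fun x hx =>
            ENNReal.rpow_le_rpow (hle u hu x hx) (by norm_num)
      _ = (C * ∫⁻ z in frontier P, u z ∂σ) ^ (2 : ℝ) * m P := setLIntegral_const _ _
      _ = _ := by
          rw [mul_right_comm, ENNReal.mul_rpow_of_nonneg _ ((m P) ^ (1 / 2 : ℝ)) (by norm_num),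
            ← ENNReal.rpow_mul]
          norm_num
  · obtain ⟨C, hC, hle⟩ := h.isFacetPresentation.exists_lintegral_rpow_le h.isCompact m
      h.isFlatOnFacets hn rfl
    refine ⟨_, ?_, C, hC, hle⟩
    have : (1 : ℝ) < Module.finrank ℝ E := by exact_mod_cast hn
    rw [lt_div_iff₀ (by linarith)]
    linarith

/-- The entropy is small compared to the internal energy. -/
lemma exists_relEntropy_le (hn : 1 ≤ Module.finrank ℝ E) {ε : ℝ} (hε : 0 < ε) :
    ∃ A : ℝ, ∀ u : E → ℝ≥0∞, IsState P m 1 u → internalEnergy P m σ u ≠ ∞ →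
      relEntropy P m u ≠ ∞ ∧
        (relEntropy P m u).toReal ≤ ε * (internalEnergy P m σ u).toReal + A := by
  obtain ⟨q, hq, C, hC, hle⟩ := h.exists_exponent m hn
  have hM0 := h.measure_ne_zero m
  have hMt := h.measure_ne_top m
  set M : ℝ := (m P).toReal with hM
  have hMpos : 0 < M := ENNReal.toReal_pos hM0 hMt
  have hq1 : 0 < q - 1 := by linarith
  -- the parameter in the logarithmic estimate is `K (1 + D)`, `D` the boundary integral
  set K : ℝ := max 1 ((2 * C.toReal ^ q / ((q - 1) * ε)) ^ (1 / (q - 1))) with hK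
  have hK1 : 1 ≤ K := le_max_left _ _
  have hCnn : 0 ≤ C.toReal := ENNReal.toReal_nonneg
  have hKpow : 2 * C.toReal ^ q / ((q - 1) * ε) ≤ K ^ (q - 1) := by
    calc 2 * C.toReal ^ q / ((q - 1) * ε)
        = ((2 * C.toReal ^ q / ((q - 1) * ε)) ^ (1 / (q - 1))) ^ (q - 1) := by
          rw [← Real.rpow_mul (by positivity), one_div_mul_cancel hq1.ne', Real.rpow_one]
      _ ≤ K ^ (q - 1) := Real.rpow_le_rpow (by positivity) (le_max_right _ _) hq1.le
  set a : ℝ := ε / (2 * M) with ha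
  have hapos : 0 < a := by positivity
  refine ⟨1 + Real.log K - Real.log a + ε / M, fun u hu hU => ?_⟩
  have hD := (h.internalEnergy_ne_top_iff m).1 hU
  set D : ℝ := (∫⁻ z in frontier P, u z ∂σ).toReal with hDdef
  have hDnn : 0 ≤ D := ENNReal.toReal_nonneg
  have hUD : (internalEnergy P m σ u).toReal = D / M := ENNReal.toReal_div _ _
  set L : ℝ := K * (1 + D) with hL
  have hL1 : 1 ≤ L := by nlinarith
  set κ : ℝ := ((q - 1) * L ^ (q - 1))⁻¹ with hκ
  have hκnn : 0 ≤ κ := by positivity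
  have hint : ∫⁻ x in P, klENN (u x) ∂m ≤
      m P + ENNReal.ofReal (Real.log L) * m P +
        ENNReal.ofReal κ * (C * ∫⁻ z in frontier P, u z ∂σ) ^ q := by
    have hmeas := aemeasurable_of_lowerSemicontinuousOn m h.isClosed hu.lsc
    calc ∫⁻ x in P, klENN (u x) ∂m
        ≤ ∫⁻ x in P, (1 + ENNReal.ofReal (Real.log L) * u x + ENNReal.ofReal κ * u x ^ q) ∂m :=
          lintegral_mono fun x => klENN_le hq hL1 (u x)
      _ = m P + ENNReal.ofReal (Real.log L) * m P +
            ENNReal.ofReal κ * ∫⁻ x in P, u x ^ q ∂m := by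
          rw [lintegral_add_left' (by exact aemeasurable_const.add (hmeas.const_mul _)),
            lintegral_add_left measurable_const, lintegral_const_mul' _ _ ENNReal.ofReal_ne_top,
            lintegral_const_mul' _ _ ENNReal.ofReal_ne_top, hu.normalized]
          simp
      _ ≤ _ := by gcongr; exact hle u hu.logConvex hu.lsc
  have hrhs : m P + ENNReal.ofReal (Real.log L) * m P +
        ENNReal.ofReal κ * (C * ∫⁻ z in frontier P, u z ∂σ) ^ q ≠ ∞ := by
    have : (C * ∫⁻ z in frontier P, u z ∂σ) ^ q ≠ ∞ :=
      ENNReal.rpow_ne_top_of_nonneg (by linarith) (ENNReal.mul_ne_top hC hD)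
    finiteness
  have hkl := ne_top_of_le_ne_top hrhs hint
  refine ⟨ENNReal.div_ne_top hkl hM0, ?_⟩
  have hreal : (∫⁻ x in P, klENN (u x) ∂m).toReal ≤
      M + Real.log L * M + κ * (C.toReal * D) ^ q := by
    refine (ENNReal.toReal_mono hrhs hint).trans_eq ?_
    have h3 : (C * ∫⁻ z in frontier P, u z ∂σ) ^ q ≠ ∞ :=
      ENNReal.rpow_ne_top_of_nonneg (by linarith) (ENNReal.mul_ne_top hC hD)
    rw [ENNReal.toReal_add (by finiteness) (by finiteness),
      ENNReal.toReal_add (by finiteness) (by finiteness), ENNReal.toReal_mul, ENNReal.toReal_mul,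
      ← ENNReal.toReal_rpow, ENNReal.toReal_mul, ENNReal.toReal_ofReal (Real.log_nonneg hL1),
      ENNReal.toReal_ofReal hκnn]
  have hpow : κ * (C.toReal * D) ^ q ≤ ε / 2 * (1 + D) := by
    have hD1 : 0 < 1 + D := by linarith
    have h4 : κ * (C.toReal * (1 + D)) ^ q =
        C.toReal ^ q / ((q - 1) * K ^ (q - 1)) * (1 + D) := by
      have h5 : (1 + D) ^ q = (1 + D) ^ (q - 1) * (1 + D) := by
        rw [← Real.rpow_add_one hD1.ne', sub_add_cancel]
      rw [hκ, hL, Real.mul_rpow (by linarith) hD1.le, Real.mul_rpow hCnn hD1.le, h5]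
      have : 0 < (1 + D) ^ (q - 1) := Real.rpow_pos_of_pos hD1 _
      have : 0 < K ^ (q - 1) := Real.rpow_pos_of_pos (by linarith) _
      field_simp
    calc κ * (C.toReal * D) ^ q ≤ κ * (C.toReal * (1 + D)) ^ q := by
          gcongr; linarith
      _ = C.toReal ^ q / ((q - 1) * K ^ (q - 1)) * (1 + D) := h4
      _ ≤ ε / 2 * (1 + D) := by
          refine mul_le_mul_of_nonneg_right ?_ hD1.le
          have : 0 < K ^ (q - 1) := Real.rpow_pos_of_pos (by linarith) _
          rw [div_le_iff₀ (by positivity)] at hKpow ⊢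
          linarith
  have hlog : Real.log L ≤ Real.log K + a * (1 + D) - Real.log a := by
    have hD1 : 0 < 1 + D := by linarith
    have h6 := Real.log_le_sub_one_of_pos (mul_pos hapos hD1)
    rw [Real.log_mul hapos.ne' hD1.ne'] at h6
    rw [hL, Real.log_mul (by linarith) hD1.ne']
    linarith
  have hJ : (relEntropy P m u).toReal = (∫⁻ x in P, klENN (u x) ∂m).toReal / M :=
    ENNReal.toReal_div _ _
  rw [hJ, hUD, div_le_iff₀ hMpos]
  have h7 : (ε * (D / M) + (1 + Real.log K - Real.log a + ε / M)) * M =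
      ε * D + ε + (1 + Real.log K - Real.log a) * M := by field_simp; ring
  have h8 : Real.log L * M ≤ (Real.log K - Real.log a) * M + ε / 2 * (1 + D) := by
    calc Real.log L * M ≤ (Real.log K + a * (1 + D) - Real.log a) * M := by gcongr
      _ = _ := by rw [ha]; field_simp; ring
  rw [h7]
  linarith

lemma entropy_eq {u : E → ℝ≥0∞} (hu : IsState P m 1 u) :
    entropy P m u = -(relEntropy P m u : EReal) :=
  entropy_eq_neg_relEntropy (h.measure_ne_zero m) (h.measure_ne_top m)
    (aemeasurable_of_lowerSemicontinuousOn m h.isClosed hu.lsc) hu.normalized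

lemma relEntropy_ne_top (hn : 1 ≤ Module.finrank ℝ E) {u : E → ℝ≥0∞} (hu : IsState P m 1 u)
    (hU : internalEnergy P m σ u ≠ ∞) : relEntropy P m u ≠ ∞ :=
  have ⟨_, hA⟩ := h.exists_relEntropy_le m hn zero_lt_one
  (hA u hu hU).1

lemma freeEnergy_eq (hn : 1 ≤ Module.finrank ℝ E) (T : ℝ) {u : E → ℝ≥0∞} (hu : IsState P m 1 u)
    (hU : internalEnergy P m σ u ≠ ∞) : freeEnergy P m σ T u =
      (((internalEnergy P m σ u).toReal + T * (relEntropy P m u).toReal : ℝ) : EReal) :=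
  freeEnergy_eq_coe (h.entropy_eq m hu) hU (h.relEntropy_ne_top m hn hu hU)

/-- Minimizers have finite energy, and only states of finite energy matter for minimality. -/
lemma isMinimizer_iff (hn : 1 ≤ Module.finrank ℝ E) {T : ℝ} {u : E → ℝ≥0∞} :
    IsMinimizer P m σ T u ↔ IsState P m 1 u ∧ internalEnergy P m σ u ≠ ∞ ∧
      ∀ v, IsState P m 1 v → internalEnergy P m σ v ≠ ∞ →
        (internalEnergy P m σ u).toReal + T * (relEntropy P m u).toReal ≤
          (internalEnergy P m σ v).toReal + T * (relEntropy P m v).toReal := by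
  constructor
  · rintro ⟨hu, hmin⟩
    have hU : internalEnergy P m σ u ≠ ∞ := by
      intro hU
      have h1 := hmin _ (h.isState_one m).1
      rw [freeEnergy_eq_top (h.entropy_eq m hu) (Or.inl hU),
        h.freeEnergy_eq m hn T (h.isState_one m).1 (h.isState_one m).2, top_le_iff] at h1
      exact EReal.coe_ne_top _ h1
    refine ⟨hu, hU, fun v hv hV => ?_⟩
    have h1 := hmin v hv
    rwa [h.freeEnergy_eq m hn T hu hU, h.freeEnergy_eq m hn T hv hV, EReal.coe_le_coe_iff] at h1
  · rintro ⟨hu, hU, hmin⟩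
    refine ⟨hu, fun v hv => ?_⟩
    by_cases hV : internalEnergy P m σ v = ∞
    · rw [freeEnergy_eq_top (h.entropy_eq m hv) (Or.inl hV)]
      exact le_top
    · rw [h.freeEnergy_eq m hn T hu hU, h.freeEnergy_eq m hn T hv hV, EReal.coe_le_coe_iff]
      exact hmin v hv hV

/-- Compactness of the states of bounded internal energy, with lower semi-continuity of the internal
energy and continuity of the entropy. -/
lemma exists_limit (hn : 1 ≤ Module.finrank ℝ E) {u : ℕ → E → ℝ≥0∞}
    (hu : ∀ i, IsState P m 1 (u i)) {R : ℝ≥0∞} (hR : R ≠ ∞)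
    (huR : ∀ i, internalEnergy P m σ (u i) ≤ R) :
    ∃ v : E → ℝ≥0∞, ∃ φ : ℕ → ℕ, StrictMono φ ∧ IsState P m 1 v ∧
      internalEnergy P m σ v ≠ ∞ ∧
      (∀ a : ℝ≥0∞, Tendsto (fun i => internalEnergy P m σ (u (φ i))) atTop (𝓝 a) →
        internalEnergy P m σ v ≤ a) ∧
      Tendsto (fun i => (relEntropy P m (u (φ i))).toReal) atTop
        (𝓝 (relEntropy P m v).toReal) := by
  obtain ⟨q, hq, C, hC, hle⟩ := h.exists_exponent m hn
  have hM0 := h.measure_ne_zero m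
  have hMt := h.measure_ne_top m
  have hD : ∀ i, ∫⁻ z in frontier P, u i z ∂σ ≤ R * m P := fun i => by
    rw [h.integral_eq_mul_internalEnergy m]
    gcongr
    exact huR i
  obtain ⟨v, φ, hφ, hv, hvle, hJ⟩ := exists_limit_state m h.isCompact h.convex h.interior_nonempty
    hq (B := (C * (R * m P)) ^ q) (ENNReal.rpow_ne_top_of_nonneg (by linarith) (by finiteness)) hu
    fun i => (hle (u i) (hu i).logConvex (hu i).lsc).trans
      (ENNReal.rpow_le_rpow (by gcongr; exact hD i) (by linarith))
  have hfatou : ∫⁻ z in frontier P, v z ∂σ ≤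
      liminf (fun i => ∫⁻ z in frontier P, u (φ i) z ∂σ) atTop := by
    have hfr : frontier P ⊆ P := h.isClosed.frontier_subset
    calc ∫⁻ z in frontier P, v z ∂σ
        ≤ ∫⁻ z in frontier P, liminf (fun i => u (φ i) z) atTop ∂σ :=
          setLIntegral_mono' isClosed_frontier.measurableSet fun z hz => hvle z (hfr hz)
      _ ≤ _ := lintegral_liminf_le' fun i =>
          (aemeasurable_of_lowerSemicontinuousOn σ h.isClosed (hu (φ i)).lsc).mono_measure
            (Measure.restrict_mono hfr le_rfl)
  have hvU : internalEnergy P m σ v ≠ ∞ := by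
    rw [h.internalEnergy_ne_top_iff m]
    refine ne_top_of_le_ne_top (by finiteness : R * m P ≠ ∞) (hfatou.trans ?_)
    exact (liminf_le_liminf (Eventually.of_forall fun i => hD (φ i))).trans (liminf_const _).le
  refine ⟨v, φ, hφ, hv, hvU, fun a ha => ?_, ?_⟩
  · have h1 : Tendsto (fun i => ∫⁻ z in frontier P, u (φ i) z ∂σ) atTop (𝓝 (a * m P)) := by
      simp only [h.integral_eq_mul_internalEnergy m]
      exact ENNReal.Tendsto.mul_const ha (Or.inr hMt)
    rw [h1.liminf_eq] at hfatou
    exact ENNReal.div_le_of_le_mul hfatou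
  · exact (ENNReal.tendsto_toReal (h.relEntropy_ne_top m hn hv hvU)).comp hJ

end IsPolytopeSystem

end Energy

/-! ### Existence and uniqueness of minimizers -/

section Minimizers

variable {E : Type*} [NormedAddCommGroup E] [NormedSpace ℝ E] [FiniteDimensional ℝ E]
  [MeasurableSpace E] [BorelSpace E]

namespace IsPolytopeSystem

variable {P : Set E} {s : Finset (E →ᵃ[ℝ] ℝ)} {σ : Measure E} (h : IsPolytopeSystem P s σ)
  (m : Measure E)
include h

lemma internalEnergy_mean {u v : E → ℝ≥0∞} (hu : IsState P m 1 u) :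
    internalEnergy P m σ (fun x => 2⁻¹ * (u x + v x)) =
      2⁻¹ * (internalEnergy P m σ u + internalEnergy P m σ v) := by
  have hmu := (aemeasurable_of_lowerSemicontinuousOn σ h.isClosed hu.lsc).mono_measure
    (Measure.restrict_mono h.isClosed.frontier_subset le_rfl)
  unfold internalEnergy
  rw [lintegral_const_mul' _ _ (by simp), lintegral_add_left' hmu, mul_div_assoc, ENNReal.add_div]

variable [m.IsAddHaarMeasure]

/-- The free energy controls the internal energy, also at negative temperatures. -/
lemma exists_energy_ge (hn : 1 ≤ Module.finrank ℝ E) (T : ℝ) :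
    ∃ A : ℝ, ∀ u : E → ℝ≥0∞, IsState P m 1 u → internalEnergy P m σ u ≠ ∞ →
      (internalEnergy P m σ u).toReal / 2 - A ≤
        (internalEnergy P m σ u).toReal + T * (relEntropy P m u).toReal := by
  obtain ⟨A, hA⟩ := h.exists_relEntropy_le m hn (ε := 1 / (2 * (|T| + 1))) (by positivity)
  refine ⟨|T| * A, fun u hu hU => ?_⟩
  have h1 := (hA u hu hU).2
  set U := (internalEnergy P m σ u).toReal
  set J := (relEntropy P m u).toReal
  have hU0 : 0 ≤ U := ENNReal.toReal_nonneg
  have hJ0 : 0 ≤ J := ENNReal.toReal_nonneg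
  have h2 : -(|T| * J) ≤ T * J := by
    have := neg_abs_le T
    nlinarith
  have h3 : |T| * J ≤ |T| * (1 / (2 * (|T| + 1)) * U + A) := by gcongr
  have h4 : |T| * (1 / (2 * (|T| + 1)) * U) ≤ U / 2 := by
    have : |T| * (1 / (2 * (|T| + 1))) ≤ 1 / 2 := by
      rw [mul_one_div, div_le_iff₀ (by positivity)]
      linarith
    calc |T| * (1 / (2 * (|T| + 1)) * U) = |T| * (1 / (2 * (|T| + 1))) * U := by ring
      _ ≤ 1 / 2 * U := by gcongr
      _ = U / 2 := by ring
  linarith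

theorem exists_isMinimizer (hn : 1 ≤ Module.finrank ℝ E) (T : ℝ) :
    ∃ u : E → ℝ≥0∞, IsMinimizer P m σ T u := by
  obtain ⟨A, hA⟩ := h.exists_energy_ge m hn T
  let S : Set (E → ℝ≥0∞) := {u | IsState P m 1 u ∧ internalEnergy P m σ u ≠ ∞}
  let F : (E → ℝ≥0∞) → ℝ := fun u =>
    (internalEnergy P m σ u).toReal + T * (relEntropy P m u).toReal
  have hne : (F '' S).Nonempty := ⟨_, _, h.isState_one m, rfl⟩
  have hbdd : BddBelow (F '' S) := by
    refine ⟨-A, ?_⟩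
    rintro _ ⟨u, hu, rfl⟩
    have h1 := hA u hu.1 hu.2
    have h2 : 0 ≤ (internalEnergy P m σ u).toReal := ENNReal.toReal_nonneg
    change -A ≤ (internalEnergy P m σ u).toReal + T * (relEntropy P m u).toReal
    linarith
  obtain ⟨x, -, hx, hxS⟩ := exists_seq_tendsto_sInf hne hbdd
  choose u huS huF using hxS
  obtain ⟨b, hb⟩ := hx.bddAbove_range
  have huR : ∀ i, internalEnergy P m σ (u i) ≤ ENNReal.ofReal (2 * (b + A)) := by
    intro i
    rw [ENNReal.le_ofReal_iff_toReal_le (huS i).2]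
    · have h1 := hA (u i) (huS i).1 (huS i).2
      have h2 : F (u i) ≤ b := by rw [huF i]; exact hb ⟨i, rfl⟩
      change (internalEnergy P m σ (u i)).toReal + T * (relEntropy P m (u i)).toReal ≤ b at h2
      linarith
    · have h1 := hA (u i) (huS i).1 (huS i).2
      have h2 : F (u i) ≤ b := by rw [huF i]; exact hb ⟨i, rfl⟩
      have h3 : 0 ≤ (internalEnergy P m σ (u i)).toReal := ENNReal.toReal_nonneg
      change (internalEnergy P m σ (u i)).toReal + T * (relEntropy P m (u i)).toReal ≤ b at h2
      linarith
  obtain ⟨v, φ, hφ, hv, hvU, hlim, hJ⟩ := h.exists_limit m hn (fun i => (huS i).1)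
    ENNReal.ofReal_ne_top huR
  refine ⟨v, (h.isMinimizer_iff m hn).2 ⟨hv, hvU, fun w hw hwU => ?_⟩⟩
  have h1 : Tendsto (fun i => (internalEnergy P m σ (u (φ i))).toReal) atTop
      (𝓝 (sInf (F '' S) - T * (relEntropy P m v).toReal)) := by
    refine ((hx.comp hφ.tendsto_atTop).sub (hJ.const_mul T)).congr fun i => ?_
    simp only [Function.comp_apply, ← huF, F]
    ring
  have h2 : 0 ≤ sInf (F '' S) - T * (relEntropy P m v).toReal :=
    ge_of_tendsto' h1 fun i => ENNReal.toReal_nonneg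
  have h3 : Tendsto (fun i => internalEnergy P m σ (u (φ i))) atTop
      (𝓝 (ENNReal.ofReal (sInf (F '' S) - T * (relEntropy P m v).toReal))) := by
    refine ((ENNReal.continuous_ofReal.tendsto _).comp h1).congr fun i => ?_
    exact ENNReal.ofReal_toReal (huS (φ i)).2
  have h4 := ENNReal.toReal_mono ENNReal.ofReal_ne_top (hlim _ h3)
  rw [ENNReal.toReal_ofReal h2] at h4
  have h5 : sInf (F '' S) ≤ F w := csInf_le hbdd ⟨w, ⟨hw, hwU⟩, rfl⟩
  change sInf (F '' S) ≤ (internalEnergy P m σ w).toReal + T * (relEntropy P m w).toReal at h5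
  linarith

lemma isState_of_internalEnergy_ne_top {n : ℕ} (hn : 1 ≤ n) (hdim : Module.finrank ℝ E = n)
    {u : E → ℝ≥0∞} (hu : IsState P m 1 u) (hU : internalEnergy P m σ u ≠ ∞) :
    IsState P m ((n : ℝ≥0∞) / ((n : ℝ≥0∞) - 1)) u := by
  refine { hu with integrable := ?_ }
  have hD := (h.internalEnergy_ne_top_iff m).1 hU
  rcases hn.eq_or_lt with rfl | hn
  · obtain ⟨C, hC, hle⟩ := h.isFacetPresentation.exists_le_boundary_integral h.isCompact
      h.isFlatOnFacets hdim
    have : ((1 : ℕ) : ℝ≥0∞) / (((1 : ℕ) : ℝ≥0∞) - 1) = ∞ := by simp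
    rw [this, eLpNorm_exponent_top]
    refine (essSup_le_of_ae_le (C * ∫⁻ z in frontier P, u z ∂σ) ?_).trans_lt
      (ENNReal.mul_lt_top hC.lt_top hD.lt_top)
    filter_upwards [ae_restrict_mem h.isClosed.measurableSet] with x hx
    exact hle u hu.logConvex x hx
  · obtain ⟨C, hC, hle⟩ := h.isFacetPresentation.exists_lintegral_rpow_le h.isCompact m
      h.isFlatOnFacets hn hdim
    have hn1 : (1 : ℝ) < n := by exact_mod_cast hn
    have hsub : (n : ℝ≥0∞) - 1 = ((n - 1 : ℕ) : ℝ≥0∞) := by simp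
    have hn2 : ((n - 1 : ℕ) : ℝ≥0∞) ≠ 0 := by
      rw [Nat.cast_ne_zero]; omega
    have hp : ((n : ℝ≥0∞) / ((n : ℝ≥0∞) - 1)).toReal = (n : ℝ) / (n - 1) := by
      rw [hsub, ENNReal.toReal_div, ENNReal.toReal_natCast, ENNReal.toReal_natCast,
        Nat.cast_sub hn.le, Nat.cast_one]
    rw [eLpNorm_lt_top_iff_lintegral_rpow_enorm_lt_top, hp]
    · refine (hle u hu.logConvex hu.lsc).trans_lt (ENNReal.rpow_lt_top_of_nonneg ?_ ?_)
      · exact div_nonneg (by linarith) (by linarith)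
      · exact ENNReal.mul_ne_top hC hD
    · rw [hsub]
      exact ENNReal.div_ne_zero.2 ⟨by rw [Nat.cast_ne_zero]; omega, by simp⟩
    · rw [hsub]
      exact ENNReal.div_ne_top (by simp) hn2

/-- Two states whose mean has no smaller relative entropy agree. -/
lemma eqOn_of_relEntropy_mean {u v : E → ℝ≥0∞} (hn : 1 ≤ Module.finrank ℝ E)
    (hu : IsState P m 1 u) (hv : IsState P m 1 v) (hU : internalEnergy P m σ u ≠ ∞)
    (hV : internalEnergy P m σ v ≠ ∞)
    (hJ : (relEntropy P m u).toReal + (relEntropy P m v).toReal ≤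
      2 * (relEntropy P m (fun x => 2⁻¹ * (u x + v x))).toReal) : EqOn u v P := by
  have hw := hu.mean h.isCompact hv
  have hW : internalEnergy P m σ (fun x => 2⁻¹ * (u x + v x)) ≠ ∞ := by
    rw [h.internalEnergy_mean m hu]; finiteness
  have hJu := h.relEntropy_ne_top m hn hu hU
  have hJv := h.relEntropy_ne_top m hn hv hV
  have hJw := h.relEntropy_ne_top m hn hw hW
  have hfin : ∀ {w : E → ℝ≥0∞}, IsState P m 1 w → ∀ᵐ x ∂m.restrict P, w x ≠ ∞ := by
    intro w hw
    have h1 := ae_lt_top' (aemeasurable_of_lowerSemicontinuousOn m h.isClosed hw.lsc)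
      (hw.normalized.trans_ne (h.measure_ne_top m))
    exact h1.mono fun x hx => hx.ne
  refine (hu.isUnnormalizedState h.isCompact).eqOn_of_ae_eq h.convex h.interior_nonempty
    (hv.isUnnormalizedState h.isCompact) (ae_eq_of_relEntropy_mean_le (h.measure_ne_zero m)
      (h.measure_ne_top m) (aemeasurable_of_lowerSemicontinuousOn m h.isClosed hu.lsc)
      (aemeasurable_of_lowerSemicontinuousOn m h.isClosed hv.lsc) (hfin hu) (hfin hv) hJu hJv ?_)
  rw [← ENNReal.toReal_le_toReal (by finiteness) (by finiteness), ENNReal.toReal_add hJu hJv,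
    ENNReal.toReal_mul, ENNReal.toReal_ofNat]
  exact hJ

theorem eqOn_of_isMinimizer (hn : 1 ≤ Module.finrank ℝ E) {T : ℝ} (hT : 0 < T)
    {u v : E → ℝ≥0∞} (hu : IsMinimizer P m σ T u) (hv : IsMinimizer P m σ T v) : EqOn u v P := by
  obtain ⟨hus, hU, humin⟩ := (h.isMinimizer_iff m hn).1 hu
  obtain ⟨hvs, hV, hvmin⟩ := (h.isMinimizer_iff m hn).1 hv
  have hmean := h.internalEnergy_mean m (v := v) hus
  have hW : internalEnergy P m σ (fun x => 2⁻¹ * (u x + v x)) ≠ ∞ := by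
    rw [hmean]; finiteness
  have h1 := humin _ (hus.mean h.isCompact hvs) hW
  have h2 := hvmin _ (hus.mean h.isCompact hvs) hW
  refine h.eqOn_of_relEntropy_mean m hn hus hvs hU hV ?_
  have h3 : (internalEnergy P m σ (fun x => 2⁻¹ * (u x + v x))).toReal =
      2⁻¹ * ((internalEnergy P m σ u).toReal + (internalEnergy P m σ v).toReal) := by
    rw [hmean, ENNReal.toReal_mul, ENNReal.toReal_add hU hV]; simp
  refine le_of_mul_le_mul_left ?_ hT
  linarith

theorem freeEnergy_zero (hn : 1 ≤ Module.finrank ℝ E) {u : E → ℝ≥0∞} (hu : IsState P m 1 u) :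
    freeEnergy P m σ 0 u = (internalEnergy P m σ u : EReal) := by
  by_cases hU : internalEnergy P m σ u = ∞
  · rw [freeEnergy_eq_top (h.entropy_eq m hu) (Or.inl hU), hU]; rfl
  · rw [h.freeEnergy_eq m hn 0 hu hU, zero_mul, add_zero, EReal.coe_ennreal_toReal hU]

theorem exists_unique_isMaxEntropyMinimizer (hn : 1 ≤ Module.finrank ℝ E) :
    ∃ u : E → ℝ≥0∞, IsMaxEntropyMinimizer P m σ 0 u ∧
      ∀ v : E → ℝ≥0∞, IsMaxEntropyMinimizer P m σ 0 v → EqOn v u P := by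
  have hiff : ∀ u, IsMinimizer P m σ 0 u ↔ IsState P m 1 u ∧ internalEnergy P m σ u ≠ ∞ ∧
      ∀ v, IsState P m 1 v → internalEnergy P m σ v ≠ ∞ →
        (internalEnergy P m σ u).toReal ≤ (internalEnergy P m σ v).toReal := by
    intro u
    rw [h.isMinimizer_iff m hn]
    simp only [zero_mul, add_zero]
  have hent : ∀ {u v}, IsMinimizer P m σ 0 u → IsMinimizer P m σ 0 v →
      (entropy P m v ≤ entropy P m u ↔
        (relEntropy P m u).toReal ≤ (relEntropy P m v).toReal) := by
    intro u v hu hv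
    obtain ⟨hus, hU, -⟩ := (hiff u).1 hu
    obtain ⟨hvs, hV, -⟩ := (hiff v).1 hv
    rw [h.entropy_eq m hus, h.entropy_eq m hvs, EReal.neg_le_neg_iff,
      EReal.coe_ennreal_le_coe_ennreal_iff, ENNReal.toReal_le_toReal
      (h.relEntropy_ne_top m hn hus hU) (h.relEntropy_ne_top m hn hvs hV)]
  have hexists : ∃ u, IsMaxEntropyMinimizer P m σ 0 u := by
    let F : (E → ℝ≥0∞) → ℝ := fun u => (relEntropy P m u).toReal
    let S : Set (E → ℝ≥0∞) := {u | IsMinimizer P m σ 0 u}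
    obtain ⟨u₀, hu₀⟩ := h.exists_isMinimizer m hn 0
    have hbdd : BddBelow (F '' S) := ⟨0, by rintro _ ⟨u, -, rfl⟩; exact ENNReal.toReal_nonneg⟩
    have hne : (F '' S).Nonempty := ⟨_, u₀, hu₀, rfl⟩
    obtain ⟨x, -, hx, hxS⟩ := exists_seq_tendsto_sInf hne hbdd
    choose u huS huF using hxS
    obtain ⟨hu₀s, hU₀, hu₀min⟩ := (hiff u₀).1 hu₀
    have hconst : ∀ i, internalEnergy P m σ (u i) = internalEnergy P m σ u₀ := by
      intro i
      obtain ⟨his, hiU, himin⟩ := (hiff _).1 (huS i)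
      rw [← ENNReal.toReal_eq_toReal_iff' hiU hU₀]
      exact le_antisymm (himin _ hu₀s hU₀) (hu₀min _ his hiU)
    obtain ⟨v, φ, hφ, hv, hvU, hlim, hJ⟩ := h.exists_limit m hn (fun i => ((hiff _).1 (huS i)).1)
      hU₀ (fun i => (hconst i).le)
    have hvmin : IsMinimizer P m σ 0 v := by
      refine (hiff v).2 ⟨hv, hvU, fun w hw hwU => le_trans ?_ (hu₀min w hw hwU)⟩
      refine ENNReal.toReal_mono hU₀ (hlim _ ?_)
      simp only [hconst]
      exact tendsto_const_nhds
    refine ⟨v, hvmin, fun w hw => (hent hvmin hw).2 ?_⟩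
    have h1 : Tendsto (fun i => (relEntropy P m (u (φ i))).toReal) atTop (𝓝 (sInf (F '' S))) :=
      (hx.comp hφ.tendsto_atTop).congr fun i => (huF (φ i)).symm
    rw [tendsto_nhds_unique hJ h1]
    exact csInf_le hbdd ⟨w, hw, rfl⟩
  obtain ⟨u, hu⟩ := hexists
  refine ⟨u, hu, fun v hv => ?_⟩
  obtain ⟨hus, hU, humin⟩ := (hiff u).1 hu.1
  obtain ⟨hvs, hV, hvmin⟩ := (hiff v).1 hv.1
  have hmean := h.internalEnergy_mean m (v := u) hvs
  have hW : internalEnergy P m σ (fun x => 2⁻¹ * (v x + u x)) ≠ ∞ := by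
    rw [hmean]; finiteness
  have h3 : (internalEnergy P m σ (fun x => 2⁻¹ * (v x + u x))).toReal =
      2⁻¹ * ((internalEnergy P m σ v).toReal + (internalEnergy P m σ u).toReal) := by
    rw [hmean, ENNReal.toReal_mul, ENNReal.toReal_add hV hU]; simp
  have hw : IsMinimizer P m σ 0 (fun x => 2⁻¹ * (v x + u x)) := by
    refine (hiff _).2 ⟨hvs.mean h.isCompact hus, hW, fun w hw hwU => ?_⟩
    rw [h3]
    have := humin w hw hwU
    have := hvmin w hw hwU
    linarith
  refine h.eqOn_of_relEntropy_mean m hn hvs hus hV hU ?_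
  have h4 := (hent hu.1 hw).1 (hu.2 _ hw)
  have h5 := (hent hv.1 hw).1 (hv.2 _ hw)
  linarith

end IsPolytopeSystem

end Minimizers

/-! ### Slope limitation -/

section SlopeLimit

variable {E : Type*} [NormedAddCommGroup E] [NormedSpace ℝ E]

/-- The lower envelope of `u` whose logarithm grows at rate at most `L` in the direction `e`:
the value at `x` is the infimum of `u (x - r • e) * exp (L * r)` over all `r ≥ 0` such that
`x - r • e` lies in `P`. -/
noncomputable def slopeLimit (P : Set E) (e : E) (L : ℝ) (u : E → ℝ≥0∞) (x : E) : ℝ≥0∞ :=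
  ⨅ r : {r : ℝ // 0 ≤ r ∧ x - r • e ∈ P}, u (x - r.1 • e) * ENNReal.ofReal (Real.exp (L * r.1))

variable {P : Set E} {e : E} {L : ℝ} {u : E → ℝ≥0∞}

lemma slopeLimit_le {x : E} {r : ℝ} (hr : 0 ≤ r) (hx : x - r • e ∈ P) :
    slopeLimit P e L u x ≤ u (x - r • e) * ENNReal.ofReal (Real.exp (L * r)) :=
  iInf_le (fun r : {r : ℝ // 0 ≤ r ∧ x - r • e ∈ P} =>
    u (x - r.1 • e) * ENNReal.ofReal (Real.exp (L * r.1))) ⟨r, hr, hx⟩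

lemma slopeLimit_le_self {x : E} (hx : x ∈ P) : slopeLimit P e L u x ≤ u x := by
  simpa using slopeLimit_le (P := P) (e := e) (L := L) (u := u) (x := x) (r := 0) le_rfl (by simpa)

lemma one_le_ofReal_exp {a : ℝ} (ha : 0 ≤ a) : 1 ≤ ENNReal.ofReal (Real.exp a) := by
  rw [← ENNReal.ofReal_one]
  exact ENNReal.ofReal_le_ofReal (Real.one_le_exp ha)

lemma le_slopeLimit (hL : 0 ≤ L) {c : ℝ≥0∞} (hc : ∀ x ∈ P, c ≤ u x) (x : E) :
    c ≤ slopeLimit P e L u x := by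
  refine le_iInf fun r => (hc _ r.2.2).trans ?_
  exact le_mul_of_one_le_right' (one_le_ofReal_exp (mul_nonneg hL r.2.1))

lemma isLogConvexOn_slopeLimit (hu : IsLogConvexOn P u) (hP : Convex ℝ P) (hL : 0 ≤ L) {c : ℝ≥0∞}
    (hc0 : c ≠ 0) (hc : ∀ x ∈ P, c ≤ u x) : IsLogConvexOn P (slopeLimit P e L u) := by
  intro x hx y hy t ht
  have hpos : ∀ z, slopeLimit P e L u z ≠ 0 := fun z =>
    ((pos_iff_ne_zero.2 hc0).trans_le (le_slopeLimit hL hc z)).ne'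
  rcases ht.1.eq_or_lt with rfl | ht0
  · simp
  rcases ht.2.eq_or_lt with rfl | ht1
  · simp
  have ht1' : 0 < 1 - t := by linarith
  by_cases hxt : slopeLimit P e L u x = ∞
  · rw [hxt, ENNReal.top_rpow_of_pos ht1', ENNReal.top_mul]
    · exact le_top
    · simp [ENNReal.rpow_eq_zero_iff, hpos y, ht0.not_gt]
  by_cases hyt : slopeLimit P e L u y = ∞
  · rw [hyt, ENNReal.top_rpow_of_pos ht0, ENNReal.mul_top]
    · exact le_top
    · simp [ENNReal.rpow_eq_zero_iff, hpos x, ht1'.not_gt]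
  have hpow : ∀ (z : E) {p : ℝ} (hp : 0 < p), slopeLimit P e L u z ^ p =
      ⨅ r : {r : ℝ // 0 ≤ r ∧ z - r • e ∈ P},
        (u (z - r.1 • e) * ENNReal.ofReal (Real.exp (L * r.1))) ^ p := fun z p hp =>
    (ENNReal.orderIsoRpow p hp).map_iInf _
  have hex : ∀ (z : E) {p : ℝ} (hp : 0 < p), slopeLimit P e L u z ≠ ∞ →
      ∃ r : {r : ℝ // 0 ≤ r ∧ z - r • e ∈ P},
        (u (z - r.1 • e) * ENNReal.ofReal (Real.exp (L * r.1))) ^ p ≠ ∞ := by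
    intro z p hp hz
    by_contra! hcon
    refine hz (iInf_eq_top.2 fun r => ?_)
    have := hcon r
    rwa [ENNReal.rpow_eq_top_iff_of_pos hp] at this
  rw [hpow x ht1', hpow y ht0]
  refine ENNReal.le_iInf_mul_iInf (hex x ht1' hxt) (hex y ht0 hyt) fun r r' => ?_
  obtain ⟨r, hr, hxr⟩ := r
  obtain ⟨r', hr', hyr⟩ := r'
  have heq : (1 - t) • x + t • y - ((1 - t) * r + t * r') • e =
      (1 - t) • (x - r • e) + t • (y - r' • e) := by module
  have hmem : (1 - t) • (x - r • e) + t • (y - r' • e) ∈ P :=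
    hP hxr hyr ht1'.le ht0.le (by ring)
  refine (slopeLimit_le (r := (1 - t) * r + t * r') (by positivity) (by rwa [heq])).trans ?_
  rw [heq, ENNReal.mul_rpow_of_nonneg _ _ ht1'.le, ENNReal.mul_rpow_of_nonneg _ _ ht0.le,
    mul_mul_mul_comm]
  refine mul_le_mul' (hu _ hxr _ hyr t ht) (le_of_eq ?_)
  rw [ENNReal.ofReal_rpow_of_nonneg (Real.exp_pos _).le ht1'.le,
    ENNReal.ofReal_rpow_of_nonneg (Real.exp_pos _).le ht0.le,
    ← ENNReal.ofReal_mul (by positivity), ← Real.exp_mul, ← Real.exp_mul, ← Real.exp_add]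
  ring_nf

/-- If `log u` grows between `x - r' • e` and `x` at a rate above `L`, it keeps growing at least
at that rate behind `x`. -/
lemma IsLogConvexOn.exp_mul_le (hu : IsLogConvexOn P u) {x : E} {r r' : ℝ} (hr : 0 ≤ r)
    (hr' : 0 ≤ r') (hx : x - r' • e ∈ P) (hb : x + r • e ∈ P) (h0 : 0 < u (x - r' • e))
    (hlt : u (x - r' • e) * ENNReal.ofReal (Real.exp (L * r')) < u x) :
    ENNReal.ofReal (Real.exp (L * r)) * u x ≤ u (x + r • e) := by
  rcases hr.eq_or_lt with rfl | hr
  · simp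
  rcases hr'.eq_or_lt with rfl | hr'
  · simp at hlt
  by_cases hbt : u (x + r • e) = ∞
  · simp [hbt]
  have hyt : u (x - r' • e) ≠ ∞ := by
    intro h
    rw [h, ENNReal.top_mul (by simp [Real.exp_pos])] at hlt
    exact not_top_lt hlt
  set τ : ℝ := r' / (r' + r) with hτ
  have hτ0 : 0 < τ := by positivity
  have hτ1 : 0 < 1 - τ := by
    have : 1 - τ = r / (r' + r) := by rw [hτ]; field_simp; ring
    rw [this]; positivity
  have hx' : (1 - τ) • (x - r' • e) + τ • (x + r • e) = x := by
    have h1 : (1 - τ) • (x - r' • e) + τ • (x + r • e) = x + (τ * (r' + r) - r') • e := by module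
    rw [h1, hτ, div_mul_cancel₀ _ (by positivity), sub_self, zero_smul, add_zero]
  have hconv := hu _ hx _ hb τ ⟨hτ0.le, by linarith⟩
  rw [hx'] at hconv
  set A := u (x - r' • e)
  set B := u (x + r • e)
  by_contra! hcon
  -- in the opposite case both endpoints lie strictly below the exponential through `x`
  have hxt : u x ≠ ∞ := ne_top_of_le_ne_top (ENNReal.mul_ne_top
    (ENNReal.rpow_ne_top_of_nonneg hτ1.le hyt) (ENNReal.rpow_ne_top_of_nonneg hτ0.le hbt)) hconv
  have hA : A < u x * ENNReal.ofReal (Real.exp (-(L * r'))) := by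
    have h2 : A = A * ENNReal.ofReal (Real.exp (L * r')) *
        ENNReal.ofReal (Real.exp (-(L * r'))) := by
      rw [mul_assoc, ← ENNReal.ofReal_mul (Real.exp_pos _).le, ← Real.exp_add]
      simp
    rw [h2]
    exact ENNReal.mul_lt_mul_left (by simp [Real.exp_pos]) ENNReal.ofReal_ne_top hlt
  have hlt' : A ^ (1 - τ) * B ^ τ < (u x * ENNReal.ofReal (Real.exp (-(L * r')))) ^ (1 - τ) *
      (ENNReal.ofReal (Real.exp (L * r)) * u x) ^ τ :=
    ENNReal.mul_lt_mul (ENNReal.rpow_lt_rpow hA hτ1) (ENNReal.rpow_lt_rpow hcon hτ0)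
  refine (hconv.trans_lt hlt').ne ?_
  rw [ENNReal.mul_rpow_of_nonneg _ _ hτ1.le, ENNReal.mul_rpow_of_nonneg _ _ hτ0.le,
    mul_comm (ENNReal.ofReal _ ^ τ), mul_mul_mul_comm,
    ← ENNReal.rpow_add_of_nonneg _ _ hτ1.le hτ0.le,
    ENNReal.ofReal_rpow_of_nonneg (Real.exp_pos _).le hτ1.le,
    ENNReal.ofReal_rpow_of_nonneg (Real.exp_pos _).le hτ0.le,
    ← ENNReal.ofReal_mul (by positivity), ← Real.exp_mul, ← Real.exp_mul, ← Real.exp_add]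
  have : -(L * r') * (1 - τ) + L * r * τ = 0 := by
    rw [hτ]; field_simp; ring
  rw [this, Real.exp_zero, ENNReal.ofReal_one, mul_one, sub_add_cancel, ENNReal.rpow_one]

/-- The defect `u - slopeLimit P e L u` increases in the direction `e`. -/
lemma IsLogConvexOn.add_slopeLimit_le (hu : IsLogConvexOn P u) (hL : 0 ≤ L)
    (h0 : ∀ x ∈ P, 0 < u x) {x : E} {r : ℝ} (hr : 0 ≤ r) (hb : x + r • e ∈ P) :
    u x + slopeLimit P e L u (x + r • e) ≤ u (x + r • e) + slopeLimit P e L u x := by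
  conv_rhs => unfold slopeLimit
  rw [ENNReal.add_iInf]
  refine le_iInf fun ⟨r', hr', hy⟩ => ?_
  dsimp only
  rcases le_or_gt (u x) (u (x - r' • e) * ENNReal.ofReal (Real.exp (L * r'))) with hle | hlt
  · rw [add_comm]
    exact add_le_add (slopeLimit_le_self hb) hle
  have hgrow := hu.exp_mul_le hr hr' hy hb (h0 _ hy) hlt
  set Y := u (x - r' • e) * ENNReal.ofReal (Real.exp (L * r'))
  have hsl : slopeLimit P e L u (x + r • e) ≤ ENNReal.ofReal (Real.exp (L * r)) * Y := by
    have heq : x + r • e - (r + r') • e = x - r' • e := by module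
    refine (slopeLimit_le (r := r + r') (by positivity) (by rwa [heq])).trans_eq ?_
    rw [heq, mul_add, Real.exp_add, ENNReal.ofReal_mul (Real.exp_pos _).le]
    ring
  obtain ⟨k, hk⟩ := exists_add_of_le (one_le_ofReal_exp (mul_nonneg hL hr))
  rw [hk] at hgrow hsl
  calc u x + slopeLimit P e L u (x + r • e) ≤ u x + (1 + k) * Y := by gcongr
    _ = u x + Y + k * Y := by ring
    _ ≤ u x + Y + k * u x := by gcongr
    _ = (1 + k) * u x + Y := by ring
    _ ≤ _ := by gcongr

end SlopeLimit

/-! ### Regularity of minimizers of the internal energy -/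

section Regularity

variable {E : Type*} [NormedAddCommGroup E] [NormedSpace ℝ E] [FiniteDimensional ℝ E]

/-- A bounded lower semi-continuous log-convex function on a polytope is continuous up to the
boundary: near `x` every point of the polytope is a convex combination, with prescribed small
weight `t`, of `x` and another point of the polytope. -/
lemma IsFacetPresentation.continuousOn_of_le {P : Set E} {s : Finset (E →ᵃ[ℝ] ℝ)}
    (h : IsFacetPresentation P s) {u : E → ℝ≥0∞} (hu : IsLogConvexOn P u)
    (hl : LowerSemicontinuousOn u P) (h0 : ∀ x ∈ P, 0 < u x) {C : ℝ≥0} (hC : ∀ x ∈ P, u x ≤ C) :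
    ContinuousOn u P := by
  intro x hx
  refine continuousWithinAt_iff_lower_upperSemicontinuousWithinAt.2 ⟨hl x hx, fun a ha => ?_⟩
  obtain ⟨b, hb⟩ : ∃ b : ℝ≥0, u x = b :=
    ⟨(u x).toNNReal, (ENNReal.coe_toNNReal (ne_top_of_le_ne_top ENNReal.coe_ne_top (hC x hx))).symm⟩
  have hb0 : b ≠ 0 := by
    rintro rfl
    exact (h0 x hx).ne' (by simpa using hb)
  have hC0 : C ≠ 0 := by
    rintro rfl
    exact (h0 x hx).not_ge (by simpa using hC x hx)
  have hlim : Tendsto (fun t : ℝ => (b : ℝ≥0∞) ^ (1 - t) * (C : ℝ≥0∞) ^ t) (𝓝[>] 0) (𝓝 b) := by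
    have h1 : ContinuousAt (fun t : ℝ => b ^ (1 - t) * C ^ t) 0 :=
      ((NNReal.continuousAt_rpow (Or.inl hb0)).comp₂ continuousAt_const (by fun_prop)).mul
        ((NNReal.continuousAt_rpow (Or.inl hC0)).comp₂ continuousAt_const (by fun_prop))
    have h2 := ENNReal.tendsto_coe.2 (h1.tendsto.mono_left (nhdsWithin_le_nhds (s := Ioi 0)))
    simpa [ENNReal.coe_mul, ENNReal.coe_rpow_of_ne_zero, hb0, hC0] using h2
  replace ha : (b : ℝ≥0∞) < a := hb ▸ ha
  obtain ⟨t, hta, ht0, ht1⟩ := ((hlim.eventually_lt_const ha).and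
    (Ioc_mem_nhdsGT (zero_lt_one' ℝ))).exists
  have hev : ∀ᶠ y in 𝓝[P] x, x + t⁻¹ • (y - x) ∈ P := by
    simp only [h.mem_iff]
    rw [Filter.eventually_all_finset]
    intro ℓ hℓ
    rcases (h.mem_iff.1 hx ℓ hℓ).eq_or_lt with h1 | h1
    · filter_upwards [self_mem_nhdsWithin] with y hy
      have h2 := h.mem_iff.1 hy ℓ hℓ
      have h3 := affine_add_smul ℓ x (y - x) 1
      rw [one_smul, add_sub_cancel, ← h1] at h3
      rw [affine_add_smul, ← h1]
      have : ℓ.linear (y - x) = ℓ y := by linarith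
      rw [this, zero_add]
      positivity
    · have hcont : Continuous fun y => ℓ (x + t⁻¹ • (y - x)) :=
        (continuous_affine ℓ).comp (by fun_prop)
      have h2 : ∀ᶠ y in 𝓝 x, 0 < ℓ (x + t⁻¹ • (y - x)) :=
        hcont.continuousAt.eventually_const_lt (by simpa using h1)
      exact (h2.filter_mono nhdsWithin_le_nhds).mono fun y hy => hy.le
  filter_upwards [hev] with y hy
  have heq : (1 - t) • x + t • (x + t⁻¹ • (y - x)) = y := by
    rw [smul_add, smul_inv_smul₀ ht0.ne']
    module
  have h1 := hu x hx _ hy t ⟨ht0.le, ht1⟩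
  rw [heq, hb] at h1
  refine (h1.trans ?_).trans_lt hta
  gcongr
  exact hC _ hy

/-- For steep slopes the slope limitation only changes `u` close to the part of the boundary that
the direction `e` points at. -/
lemma IsFacetPresentation.exists_slopeLimit_eq {P : Set E} {s : Finset (E →ᵃ[ℝ] ℝ)}
    (h : IsFacetPresentation P s) (hc : IsCompact P) {u : E → ℝ≥0∞}
    (hu : IsUnnormalizedState P u) {c : ℝ≥0∞} (hc0 : c ≠ 0) (hcu : ∀ x ∈ P, c ≤ u x)
    {e : E} (he : ∀ ℓ ∈ s, ℓ.linear e ≠ 0) {δ : ℝ} (hδ : 0 < δ) :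
    ∃ L : ℝ, 0 ≤ L ∧ ∀ x ∈ P, x + (2 * δ) • e ∈ P → slopeLimit P e L u x = u x := by
  set K : Set E := P ∩ ⋂ ℓ ∈ s, {x | δ * |ℓ.linear e| ≤ ℓ x} with hK
  have hKc : IsCompact K := hc.inter_right (isClosed_biInter fun ℓ _ =>
    isClosed_le continuous_const (continuous_affine ℓ))
  have hKi : K ⊆ interior P := fun x hx => h.mem_interior fun ℓ hℓ =>
    (mul_pos hδ (abs_pos.2 (he ℓ hℓ))).trans_le (mem_iInter₂.1 hx.2 ℓ hℓ)
  obtain ⟨M, hM⟩ : ∃ M : ℝ≥0, ∀ x ∈ K, u x ≤ M := by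
    rcases K.eq_empty_or_nonempty with hKe | hKne
    · exact ⟨0, by simp [hKe]⟩
    obtain ⟨z, hz, hmax⟩ := hKc.exists_isMaxOn hKne ((hu.continuousOn h.convex).mono hKi)
    refine ⟨(u z).toNNReal, fun x hx => ?_⟩
    rw [ENNReal.coe_toNNReal (hu.finite z (hKi hz)).ne]
    exact hmax hx
  obtain ⟨L, hL0, hL⟩ : ∃ L : ℝ, 0 ≤ L ∧ (M : ℝ≥0∞) < ENNReal.ofReal (Real.exp (L * δ)) * c := by
    have h1 : Tendsto (fun L : ℝ => ENNReal.ofReal (Real.exp (L * δ)) * c) atTop (𝓝 ∞) := by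
      have h2 : Tendsto (fun L : ℝ => ENNReal.ofReal (Real.exp (L * δ))) atTop (𝓝 ∞) :=
        ENNReal.tendsto_ofReal_nhds_top.2
          (Real.tendsto_exp_atTop.comp (tendsto_id.atTop_mul_const hδ))
      have h3 := ENNReal.Tendsto.mul_const (b := c) h2 (Or.inl ENNReal.top_ne_zero)
      rwa [ENNReal.top_mul hc0] at h3
    obtain ⟨L, h2, h3⟩ := ((h1.eventually_const_lt ENNReal.coe_lt_top).and
      (eventually_ge_atTop 0)).exists
    exact ⟨L, h3, h2⟩
  refine ⟨L, hL0, fun x hx hx2 => le_antisymm (slopeLimit_le_self hx) (le_iInf ?_)⟩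
  rintro ⟨r', hr', hy⟩
  by_contra! hlt
  have hmem : x + δ • e ∈ K := by
    have hpos : ∀ ℓ ∈ s, δ * |ℓ.linear e| ≤ ℓ (x + δ • e) := by
      intro ℓ hℓ
      have h1 := h.mem_iff.1 hx ℓ hℓ
      have h2 := h.mem_iff.1 hx2 ℓ hℓ
      rw [affine_add_smul] at h2 ⊢
      rcases abs_cases (ℓ.linear e) with ⟨h3, -⟩ | ⟨h3, -⟩ <;> rw [h3] <;> linarith
    exact ⟨h.mem_iff.2 fun ℓ hℓ => (by positivity : 0 ≤ δ * |ℓ.linear e|).trans (hpos ℓ hℓ),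
      mem_iInter₂.2 hpos⟩
  have hgrow := hu.logConvex.exp_mul_le hδ.le hr' hy hmem.1 (hu.pos _ hy) hlt
  refine (hL.trans_le (le_trans ?_ hgrow)).not_ge (hM _ hmem)
  gcongr
  exact hcu x hx

variable [MeasurableSpace E] [BorelSpace E]

/-- Slicing in the direction `e`: as the defect increases towards the boundary and is supported at
distance at most `2 * δ` from it, its integral over `P` is small compared to its boundary
integral. -/
lemma IsPolytopeSystem.exists_lintegral_defect_le {P : Set E} {s : Finset (E →ᵃ[ℝ] ℝ)}
    {σ : Measure E} (h : IsPolytopeSystem P s σ) (m : Measure E) [m.IsAddHaarMeasure] {e : E}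
    (he0 : e ≠ 0) (he : ∀ ℓ ∈ s, ℓ.linear e ≠ 0) :
    ∃ C : ℝ≥0∞, C ≠ ∞ ∧ ∀ (u v : E → ℝ≥0∞) (L δ : ℝ), IsUnnormalizedState P u →
      LowerSemicontinuousOn v P → 0 ≤ L → 0 < δ → (∀ x ∈ P, v x ≤ slopeLimit P e L u x) →
      (∀ x ∈ interior P, v x = slopeLimit P e L u x) →
      (∀ x ∈ P, x + (2 * δ) • e ∈ P → slopeLimit P e L u x = u x) →
      ∫⁻ x in P, (u x - v x) ∂m ≤
        C * (ENNReal.ofReal (2 * δ) * ∫⁻ z in frontier P, (u z - v z) ∂σ) := by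
  obtain ⟨C, hC, hslice⟩ := h.isFacetPresentation.exists_slice h.isCompact m h.isFlatOnFacets he
  refine ⟨C, hC, fun u v L δ hu hv hL hδ hvle hveq hsupp => ?_⟩
  set g : E → ℝ≥0∞ := fun x => P.indicator u x - P.indicator v x with hg
  have hgm : Measurable g := (measurable_indicator_of_lowerSemicontinuousOn h.isClosed hu.lsc).sub
    (measurable_indicator_of_lowerSemicontinuousOn h.isClosed hv)
  have hgP : ∀ x ∈ P, g x = u x - v x := fun x hx => by simp [hg, hx]
  have hint : ∀ᵐ x ∂m.restrict P, x ∈ interior P := by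
    rw [ae_restrict_iff' h.isClosed.measurableSet]
    have h0 := h.convex.addHaar_frontier m
    filter_upwards [measure_eq_zero_iff_ae_notMem.1 h0] with x hx hxP
    by_contra hxi
    exact hx ⟨subset_closure hxP, hxi⟩
  have hpoint : ∀ x ∈ interior P, u x - v x ≤
      ∑ ℓ ∈ s, (P ∩ {x | ℓ x = 0}).indicator g (slantFoot ℓ e x) *
        (Icc (-(2 * δ)) 0).indicator 1 (slantTime ℓ e x) := by
    intro x hxi
    have hx := interior_subset hxi
    rw [hveq x hxi]
    by_cases hx2 : x + (2 * δ) • e ∈ P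
    · rw [hsupp x hx hx2, tsub_self]
      exact zero_le
    obtain ⟨r, hr, hb, ⟨ℓ, hℓ, hz⟩, -⟩ := h.isFacetPresentation.exists_exit h.isCompact hx he0
    have hr2 : r ≤ 2 * δ := by
      by_contra! hlt
      refine hx2 ?_
      have hmem := h.convex hx hb (a := 1 - 2 * δ / r) (b := 2 * δ / r)
        (by rw [sub_nonneg, div_le_one (by linarith)]; exact hlt.le) (by positivity) (by ring)
      have heq : (1 - 2 * δ / r) • x + (2 * δ / r) • (x + r • e) =
          x + (2 * δ / r * r) • e := by module
      rwa [heq, div_mul_cancel₀ _ (by linarith)] at hmem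
    have hterm : (P ∩ {x | ℓ x = 0}).indicator g (slantFoot ℓ e x) *
        (Icc (-(2 * δ)) 0).indicator 1 (slantTime ℓ e x) = u (x + r • e) - v (x + r • e) := by
      rw [slantFoot_eq (he ℓ hℓ) hz, slantTime_eq (he ℓ hℓ) hz,
        indicator_of_mem (show x + r • e ∈ P ∩ {x | ℓ x = 0} from ⟨hb, hz⟩),
        indicator_of_mem (show -r ∈ Icc (-(2 * δ)) 0 from ⟨by linarith, by linarith⟩), hgP _ hb,
        Pi.one_apply, mul_one]
    refine le_trans ?_ (Finset.single_le_sum (f := fun ℓ =>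
      (P ∩ {x | ℓ x = 0}).indicator g (slantFoot ℓ e x) *
        (Icc (-(2 * δ)) 0).indicator 1 (slantTime ℓ e x)) (fun _ _ => zero_le) hℓ)
    rw [hterm]
    have hfin : slopeLimit P e L u (x + r • e) ≠ ∞ := by
      have heq : x + r • e - r • e = x := by module
      refine ne_top_of_le_ne_top ?_ (slopeLimit_le (r := r) hr (by rwa [heq]))
      rw [heq]
      exact ENNReal.mul_ne_top (hu.finite x hxi).ne ENNReal.ofReal_ne_top
    refine le_trans ?_ (tsub_le_tsub_left (hvle _ hb) _)
    rw [tsub_le_iff_right]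
    have hinc := ENNReal.le_sub_of_add_le_right hfin
      (hu.logConvex.add_slopeLimit_le (e := e) hL hu.pos hr hb)
    exact hinc.trans add_tsub_le_tsub_add
  calc ∫⁻ x in P, (u x - v x) ∂m
      ≤ ∫⁻ x in P, ∑ ℓ ∈ s, (P ∩ {x | ℓ x = 0}).indicator g (slantFoot ℓ e x) *
        (Icc (-(2 * δ)) 0).indicator 1 (slantTime ℓ e x) ∂m := lintegral_mono_ae (hint.mono hpoint)
    _ ≤ _ := setLIntegral_le_lintegral _ _
    _ ≤ C * (volume (Icc (-(2 * δ)) 0) * ∫⁻ z in frontier P, g z ∂σ) :=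
        hslice g hgm _ measurableSet_Icc
    _ = _ := by
        rw [Real.volume_Icc, zero_sub, neg_neg, setLIntegral_congr_fun
          isClosed_frontier.measurableSet fun z hz => hgP z (h.isClosed.frontier_subset hz)]

end Regularity

section BoundedMinimizers

variable {E : Type*} [NormedAddCommGroup E] [NormedSpace ℝ E] [FiniteDimensional ℝ E]
  [MeasurableSpace E] [BorelSpace E]

namespace IsPolytopeSystem

variable {P : Set E} {s : Finset (E →ᵃ[ℝ] ℝ)} {σ : Measure E} (h : IsPolytopeSystem P s σ)
  (m : Measure E) [m.IsAddHaarMeasure]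
include h

/-- Passing from a minimizer `u` of the internal energy to a smaller competitor `v` and normalizing
cannot lower the energy: the relative loss of mass on the boundary is at most that in `P`. -/
lemma mul_boundary_defect_le (hn : 1 ≤ Module.finrank ℝ E) {u v : E → ℝ≥0∞}
    (hu : IsMinimizer P m σ 0 u) (hv : IsUnnormalizedState P v) (hvu : ∀ x ∈ P, v x ≤ u x) :
    m P * ∫⁻ z in frontier P, (u z - v z) ∂σ ≤
      (∫⁻ z in frontier P, u z ∂σ) * ∫⁻ x in P, (u x - v x) ∂m := by
  obtain ⟨hus, hU, hmin⟩ := (h.isMinimizer_iff m hn).1 hu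
  simp only [zero_mul, add_zero] at hmin
  have hM0 := h.measure_ne_zero m
  have hMt := h.measure_ne_top m
  have hfr : frontier P ⊆ P := h.isClosed.frontier_subset
  have hsplit : ∫⁻ x in P, v x ∂m + ∫⁻ x in P, (u x - v x) ∂m = m P := by
    rw [← hus.normalized,
      ← lintegral_add_left' (aemeasurable_of_lowerSemicontinuousOn m h.isClosed hv.lsc)]
    exact setLIntegral_congr_fun h.isClosed.measurableSet
      fun x hx => add_tsub_cancel_of_le (hvu x hx)
  have hsplitb : ∫⁻ z in frontier P, v z ∂σ + ∫⁻ z in frontier P, (u z - v z) ∂σ =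
      ∫⁻ z in frontier P, u z ∂σ := by
    rw [← lintegral_add_left' ((aemeasurable_of_lowerSemicontinuousOn σ h.isClosed
      hv.lsc).mono_measure (Measure.restrict_mono hfr le_rfl))]
    exact setLIntegral_congr_fun isClosed_frontier.measurableSet
      fun x hx => add_tsub_cancel_of_le (hvu x (hfr hx))
  have hB := (h.internalEnergy_ne_top_iff m).1 hU
  have hI0 : ∫⁻ x in P, v x ∂m ≠ 0 := by
    intro h0
    rw [lintegral_eq_zero_iff' (aemeasurable_of_lowerSemicontinuousOn m h.isClosed hv.lsc),
      EventuallyEq, ae_restrict_iff' h.isClosed.measurableSet] at h0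
    refine hM0 (measure_eq_zero_iff_ae_notMem.2 (h0.mono fun x hx hxP => ?_))
    exact (hv.pos x hxP).ne' (hx hxP)
  set I := ∫⁻ x in P, v x ∂m
  set Di := ∫⁻ x in P, (u x - v x) ∂m
  set B := ∫⁻ z in frontier P, u z ∂σ with hBdef
  set Bv := ∫⁻ z in frontier P, v z ∂σ with hBvdef
  set Db := ∫⁻ z in frontier P, (u z - v z) ∂σ
  have hIt : I ≠ ∞ := ne_top_of_le_ne_top hMt (hsplit ▸ le_self_add)
  have hDit : Di ≠ ∞ := ne_top_of_le_ne_top hMt (hsplit ▸ le_add_self)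
  have hBvt : Bv ≠ ∞ := ne_top_of_le_ne_top hB (hsplitb ▸ le_self_add)
  have hDbt : Db ≠ ∞ := ne_top_of_le_ne_top hB (hsplitb ▸ le_add_self)
  have hwst : IsState P m 1 (fun x => m P / I * v x) := by
    refine (hv.const_mul (ENNReal.div_ne_zero.2 ⟨hM0, hIt⟩) (ENNReal.div_ne_top hMt hI0)).isState
      hMt ?_
    rw [lintegral_const_mul' _ _ (ENNReal.div_ne_top hMt hI0)]
    exact ENNReal.div_mul_cancel hI0 hIt
  have hwU : internalEnergy P m σ (fun x => m P / I * v x) = m P / I * Bv / m P := by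
    rw [internalEnergy, lintegral_const_mul' _ _ (ENNReal.div_ne_top hMt hI0)]
  have hwUt : internalEnergy P m σ (fun x => m P / I * v x) ≠ ∞ := by
    rw [hwU]
    exact ENNReal.div_ne_top (ENNReal.mul_ne_top (ENNReal.div_ne_top hMt hI0) hBvt) hM0
  have hle := hmin _ hwst hwUt
  rw [hwU, internalEnergy] at hle
  simp only [ENNReal.toReal_div, ENNReal.toReal_mul, ← hBdef] at hle
  have hMpos := ENNReal.toReal_pos hM0 hMt
  have hIpos := ENNReal.toReal_pos hI0 hIt
  have h1 := congrArg ENNReal.toReal hsplit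
  have h2 := congrArg ENNReal.toReal hsplitb
  rw [ENNReal.toReal_add hIt hDit] at h1
  rw [ENNReal.toReal_add hBvt hDbt] at h2
  rw [← ENNReal.toReal_le_toReal (ENNReal.mul_ne_top hMt hDbt) (ENNReal.mul_ne_top hB hDit),
    ENNReal.toReal_mul, ENNReal.toReal_mul]
  have h3 : B.toReal * I.toReal ≤ (m P).toReal * Bv.toReal := by
    rw [div_le_div_iff_of_pos_right hMpos, div_mul_eq_mul_div, le_div_iff₀ hIpos] at hle
    exact hle
  have h4 : I.toReal = (m P).toReal - Di.toReal := by linarith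
  have h5 : Bv.toReal = B.toReal - Db.toReal := by linarith
  rw [h4, h5] at h3
  linarith

/-- A minimizer of the internal energy agrees with its slope limitation in each transversal
direction `e`, for a sufficiently steep slope. In particular its values at `x` and `x - e` compare
uniformly in `x`. -/
lemma exists_le_mul_exp (hn : 1 ≤ Module.finrank ℝ E) {u : E → ℝ≥0∞}
    (hu : IsMinimizer P m σ 0 u) {e : E} (he0 : e ≠ 0) (he : ∀ ℓ ∈ s, ℓ.linear e ≠ 0) :
    ∃ L : ℝ, ∀ x ∈ P, x - e ∈ P → u x ≤ u (x - e) * ENNReal.ofReal (Real.exp L) := by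
  obtain ⟨hus, hU, -⟩ := (h.isMinimizer_iff m hn).1 hu
  have hun := hus.isUnnormalizedState h.isCompact
  have hB := (h.internalEnergy_ne_top_iff m).1 hU
  have hM0 := h.measure_ne_zero m
  have hMt := h.measure_ne_top m
  obtain ⟨x₀, hx₀⟩ := h.interior_nonempty
  obtain ⟨z, hz, hzmin⟩ :=
    hus.lsc.exists_isMinOn ⟨x₀, interior_subset hx₀⟩ h.isCompact
  have hc0 : u z ≠ 0 := (hus.pos z hz).ne'
  obtain ⟨C, hC, hdef⟩ := h.exists_lintegral_defect_le m he0 he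
  have hBC : (∫⁻ z in frontier P, u z ∂σ) * C ≠ ∞ := ENNReal.mul_ne_top hB hC
  -- so thin a layer that the boundary defect outweighs the interior defect
  obtain ⟨δ, hδ, hsmall⟩ : ∃ δ : ℝ, 0 < δ ∧
      (∫⁻ z in frontier P, u z ∂σ) * C * ENNReal.ofReal (2 * δ) < m P := by
    have hlim : Tendsto (fun δ : ℝ => (∫⁻ z in frontier P, u z ∂σ) * C * ENNReal.ofReal (2 * δ))
        (𝓝[>] 0) (𝓝 0) := by
      have h1 : Tendsto (fun δ : ℝ => ENNReal.ofReal (2 * δ)) (𝓝[>] 0) (𝓝 0) := by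
        have : Continuous fun δ : ℝ => ENNReal.ofReal (2 * δ) :=
          ENNReal.continuous_ofReal.comp (by fun_prop)
        simpa using (this.tendsto 0).mono_left (nhdsWithin_le_nhds (s := Ioi 0))
      simpa using ENNReal.Tendsto.const_mul h1 (Or.inr hBC)
    obtain ⟨δ, h1, h2⟩ := ((hlim.eventually_lt_const (pos_iff_ne_zero.2 hM0)).and
      self_mem_nhdsWithin).exists
    exact ⟨δ, h2, h1⟩
  obtain ⟨L, hL, hsupp⟩ := h.isFacetPresentation.exists_slopeLimit_eq h.isCompact hun hc0
    (fun x hx => hzmin hx) he hδ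
  have hlc := isLogConvexOn_slopeLimit (e := e) hus.logConvex h.convex hL hc0 fun x hx => hzmin hx
  have hpos : ∀ x, 0 < slopeLimit P e L u x := fun x =>
    (pos_iff_ne_zero.2 hc0).trans_le (le_slopeLimit hL (fun x hx => hzmin hx) x)
  have hfin : ∀ x ∈ interior P, slopeLimit P e L u x < ∞ := fun x hx =>
    (slopeLimit_le_self (interior_subset hx)).trans_lt (hun.finite x hx)
  obtain ⟨hv, hveq⟩ := isUnnormalizedState_regularize h.convex hx₀ (hlc.mono interior_subset)
    (fun x _ => hpos x) hfin
  have hvle : ∀ x ∈ P, regularize x₀ (slopeLimit P e L u) x ≤ slopeLimit P e L u x := fun x hx =>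
    hlc.regularize_le (interior_subset hx₀) (hpos _) (hfin _ hx₀) hx
  set v := regularize x₀ (slopeLimit P e L u)
  have hvu : ∀ x ∈ P, v x ≤ u x := fun x hx => (hvle x hx).trans (slopeLimit_le_self hx)
  have hD := hdef u v L δ hun hv.lsc hL hδ hvle hveq hsupp
  have hE := h.mul_boundary_defect_le m hn hu hv hvu
  have hDb : ∫⁻ z in frontier P, (u z - v z) ∂σ = 0 := by
    by_contra hne
    have hlt : ∫⁻ z in frontier P, (u z - v z) ∂σ ≠ ∞ :=
      ne_top_of_le_ne_top hB (lintegral_mono fun z => tsub_le_self)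
    refine (ENNReal.mul_lt_mul_left hne hlt hsmall).not_ge (hE.trans ?_)
    rw [mul_assoc, mul_assoc]
    exact mul_le_mul' le_rfl hD
  have hDi : ∫⁻ x in P, (u x - v x) ∂m = 0 := by
    rw [hDb, mul_zero, mul_zero] at hD
    exact le_antisymm hD zero_le
  have hmeas : AEMeasurable (fun x => u x - v x) (m.restrict P) :=
    (aemeasurable_of_lowerSemicontinuousOn m h.isClosed hus.lsc).sub
      (aemeasurable_of_lowerSemicontinuousOn m h.isClosed hv.lsc)
  rw [lintegral_eq_zero_iff' hmeas] at hDi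
  have hae : u =ᵐ[m.restrict P] v := by
    filter_upwards [hDi, ae_restrict_mem h.isClosed.measurableSet] with x hx hxP
    exact le_antisymm (tsub_eq_zero_iff_le.1 hx) (hvu x hxP)
  have heq := hun.eqOn_of_ae_eq h.convex h.interior_nonempty hv hae
  refine ⟨L, fun x hx hxe => ?_⟩
  rw [heq hx]
  refine (hvle x hx).trans ?_
  simpa using slopeLimit_le (P := P) (e := e) (L := L) (u := u) (x := x) (r := 1) zero_le_one
    (by simpa)

theorem exists_le_of_isMinimizer (hn : 1 ≤ Module.finrank ℝ E) {u : E → ℝ≥0∞}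
    (hu : IsMinimizer P m σ 0 u) : ∃ C : ℝ≥0, ∀ x ∈ P, u x ≤ C := by
  have hun := hu.1.isUnnormalizedState h.isCompact
  have hcont := hun.continuousOn h.convex
  obtain ⟨x₀, hx₀⟩ := h.interior_nonempty
  obtain ⟨d, hd⟩ := exists_forall_linear_ne_zero h.isFacetPresentation.linear_ne_zero
  suffices hloc : ∃ C : ℝ≥0, ∀ x ∈ P, x ∈ P → u x ≤ C by
    obtain ⟨C, hC⟩ := hloc
    exact ⟨C, fun x hx => hC x hx hx⟩
  refine h.isCompact.induction_on (p := fun t => ∃ C : ℝ≥0, ∀ x ∈ t, x ∈ P → u x ≤ C)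
    ⟨0, by simp⟩ ?_ ?_ fun p hp => ?_
  · rintro t t' htt ⟨C, hC⟩
    exact ⟨C, fun x hx => hC x (htt hx)⟩
  · rintro t t' ⟨C, hC⟩ ⟨C', hC'⟩
    refine ⟨max C C', fun x hx hxP => ?_⟩
    rw [ENNReal.coe_max]
    exact hx.elim (fun hx => (hC x hx hxP).trans (le_max_left _ _))
      fun hx => (hC' x hx hxP).trans (le_max_right _ _)
  -- connect `p` to an interior point by a transversal segment
  obtain ⟨e, he, hpe⟩ : ∃ e : E, (∀ ℓ ∈ s, ℓ.linear e ≠ 0) ∧ p - e ∈ interior P := by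
    have h1 : Continuous fun t : ℝ => p - (p - x₀ + t • d) := by fun_prop
    have h2 : ∀ᶠ t in 𝓝 (0 : ℝ), p - (p - x₀ + t • d) ∈ interior P :=
      h1.continuousAt.eventually_mem (isOpen_interior.mem_nhds (by simpa using hx₀))
    obtain ⟨t, h3, h4⟩ := ((eventually_transversal hd (p - x₀)).and
      (h2.filter_mono nhdsWithin_le_nhds)).exists
    exact ⟨_, h3, h4⟩
  obtain ⟨L, hL⟩ : ∃ L : ℝ, ∀ x ∈ P, x - e ∈ P → u x ≤ u (x - e) * ENNReal.ofReal (Real.exp L) := by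
    rcases eq_or_ne e 0 with rfl | he0
    · exact ⟨0, by simp⟩
    · exact h.exists_le_mul_exp m hn hu he0 he
  have hsub : ContinuousAt (fun x => x - e) p := by fun_prop
  obtain ⟨b, hub, hbt⟩ := exists_between (hun.finite _ hpe)
  lift b to ℝ≥0 using hbt.ne
  have hev : ∀ᶠ x in 𝓝 p, x - e ∈ interior P ∧ u (x - e) < b :=
    (hsub.eventually_mem (isOpen_interior.mem_nhds hpe)).and
      (hsub.eventually
        ((hcont.continuousAt (isOpen_interior.mem_nhds hpe)).eventually_lt_const hub))
  refine ⟨_, mem_nhdsWithin_of_mem_nhds hev, b * (Real.exp L).toNNReal, fun x hx hxP => ?_⟩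
  rw [ENNReal.coe_mul]
  exact (hL x hxP (interior_subset hx.1)).trans (mul_le_mul' hx.2.le le_rfl)

theorem continuousOn_of_isMinimizer (hn : 1 ≤ Module.finrank ℝ E) {u : E → ℝ≥0∞}
    (hu : IsMinimizer P m σ 0 u) : ContinuousOn u P :=
  have ⟨_, hC⟩ := h.exists_le_of_isMinimizer m hn hu
  h.isFacetPresentation.continuousOn_of_le hu.1.logConvex hu.1.lsc hu.1.pos hC

end IsPolytopeSystem

end BoundedMinimizers

/-! ### Measures restricted to the polytope -/

section Restrict

variable {E : Type*} [MeasurableSpace E]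

lemma entropy_restrict (P : Set E) (m : Measure E) (u : E → ℝ≥0∞) :
    entropy P (m.restrict P) u = entropy P m u := by
  simp [entropy, Measure.restrict_restrict_of_subset subset_rfl]

variable [NormedAddCommGroup E]

lemma internalEnergy_restrict (P : Set E) (m σ : Measure E) (u : E → ℝ≥0∞) :
    internalEnergy P (m.restrict P) σ u = internalEnergy P m σ u := by
  simp [internalEnergy]

lemma freeEnergy_restrict (P : Set E) (m σ : Measure E) (T : ℝ) (u : E → ℝ≥0∞) :
    freeEnergy P (m.restrict P) σ T u = freeEnergy P m σ T u := by
  simp [freeEnergy, entropy_restrict, internalEnergy_restrict]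

variable [NormedSpace ℝ E] (P : Set E) (m σ : Measure E)

lemma isState_restrict (p : ℝ≥0∞) (u : E → ℝ≥0∞) :
    IsState P (m.restrict P) p u ↔ IsState P m p u := by
  have h1 : (m.restrict P).restrict P = m.restrict P :=
    Measure.restrict_restrict_of_subset subset_rfl
  constructor
  · rintro ⟨hpos, hl, hc, hnorm, hint⟩
    exact ⟨hpos, hl, hc, by simpa [h1] using hnorm, by simpa [h1] using hint⟩
  · rintro ⟨hpos, hl, hc, hnorm, hint⟩
    exact ⟨hpos, hl, hc, by simpa [h1] using hnorm, by simpa [h1] using hint⟩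

lemma isMinimizer_restrict (T : ℝ) (u : E → ℝ≥0∞) :
    IsMinimizer P (m.restrict P) σ T u ↔ IsMinimizer P m σ T u := by
  simp [IsMinimizer, isState_restrict, freeEnergy_restrict]

lemma isMaxEntropyMinimizer_restrict (T : ℝ) (u : E → ℝ≥0∞) :
    IsMaxEntropyMinimizer P (m.restrict P) σ T u ↔ IsMaxEntropyMinimizer P m σ T u := by
  simp [IsMaxEntropyMinimizer, isMinimizer_restrict, entropy_restrict]

end Restrict

end MuEnergy

theorem theorem1 {E : Type*} [NormedAddCommGroup E] [NormedSpace ℝ E] [FiniteDimensional ℝ E]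
    [MeasurableSpace E] [BorelSpace E] (n : ℕ) (hn : 1 ≤ n) (hdim : Module.finrank ℝ E = n)
    (P : Set E) (μ σ : Measure E) (h𝓟 : IsSimpleSystem P μ σ) :
    -- existence for every `T`, and integrability (the exponent is `∞` when `n = 1`)
    (∀ T : ℝ,
      (∃ u : E → ℝ≥0∞, IsMinimizer P μ σ T u) ∧
      (∀ u : E → ℝ≥0∞, IsMinimizer P μ σ T u →
        IsState P μ ((n : ℝ≥0∞) / ((n : ℝ≥0∞) - 1)) u)) ∧
    -- uniqueness for `T > 0`
    (∀ T : ℝ, 0 < T → ∀ u v : E → ℝ≥0∞,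
      IsMinimizer P μ σ T u → IsMinimizer P μ σ T v → EqOn u v P) ∧
    -- for `T = 0` the free energy is the internal energy
    (∀ u : E → ℝ≥0∞, IsState P μ 1 u →
      freeEnergy P μ σ 0 u = (internalEnergy P μ σ u : EReal)) ∧
    -- conditional uniqueness for `T = 0`
    (∃ u : E → ℝ≥0∞, IsMaxEntropyMinimizer P μ σ 0 u ∧
      ∀ v : E → ℝ≥0∞, IsMaxEntropyMinimizer P μ σ 0 v → EqOn v u P) ∧
    -- regularity for `T = 0` and `n = 2`
    (n = 2 → ∀ u : E → ℝ≥0∞, IsMinimizer P μ σ 0 u →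
      (∃ C : ℝ≥0, ∀ x ∈ P, u x ≤ (C : ℝ≥0∞)) ∧ ContinuousOn u P) := by
  obtain ⟨m, s, hm, rfl, h⟩ := h𝓟.exists_isPolytopeSystem
  have hn' : 1 ≤ Module.finrank ℝ E := hn.trans_eq hdim.symm
  simp only [isMinimizer_restrict, isState_restrict, isMaxEntropyMinimizer_restrict,
    freeEnergy_restrict, internalEnergy_restrict]
  refine ⟨fun T => ⟨h.exists_isMinimizer m hn' T, fun u hu => ?_⟩,
    fun T hT u v hu hv => h.eqOn_of_isMinimizer m hn' hT hu hv,
    fun u hu => h.freeEnergy_zero m hn' hu, h.exists_unique_isMaxEntropyMinimizer m hn',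
    fun _ u hu => ⟨h.exists_le_of_isMinimizer m hn' hu, h.continuousOn_of_isMinimizer m hn' hu⟩⟩
  exact h.isState_of_internalEnergy_ne_top m hn hdim hu.1 ((h.isMinimizer_iff m hn').1 hu).2.1
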